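/- There is a function $K:\mathbb R\times\mathbb R\to\mathbb R$ such that the following holds. Let $M$ be a closed three-manifold with a smooth volume form $\mu$, and let $g$ be a smooth Riemannian metric on $M$ whose induced volume is $\mu$. Norms of vector fields are taken with respect to $g$, with $\|W\|_{C^1}=\sup|W|+\sup|\nabla W|$ for the Levi-Civita connection $\nabla$. Norms of $2\times2$ matrices are the maximum of the absolute values of the entries. Let $X$ be a smooth $\mu$-preserving vector field on $M$ with flow $\phi_X^t$. Let $p\in M$ and $T>0$ be such that $t\mapsto\phi_X^t(p)$ is injective on $[0,T)$, and let $\Gamma=\{\phi^t_X(p):t\in[0,T]\}$. Let $\tau$ be a trivialization of the normal bundle of $X$ along $\Gamma$, that is, surjective linear maps $\tau_q:T_qM\to\mathbb R^2$, $q\in\Gamma$, with kernel $\operatorname{span}X(q)$ and with $\tau_{\phi_X^t(p)}$ smooth in $t\in[0,T]$. Assume that $$A_X(t):=\tau_{\phi_X^t(p)}\circ D_p\phi_X^t\circ\tau_p^{-1}\in SL(2,\mathbb R)\qquad(t\in[0,T]).$$ Let $C_\tau$ be a constant that bounds $\tau$ and its inverse: $|\tau_qv|\le C_\tau|v|$ and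 $|v|\le C_\tau|\tau_qv|$ for all $q\in\Gamma$ and all $v\in T_qM$ orthogonal to $X(q)$. Put $\mathfrak a_X(t):=\big(\tfrac{d}{dt}A_X(t)\big)A_X(t)^{-1}$. Let $\varepsilon>0$, let $k\in\{1,2,\dots,\infty\}$, and let $\mathfrak c:[0,T]\to\mathfrak{sl}(2,\mathbb R)$ be a $C^k$ map with $\sup_{t\in[0,T]}\|\mathfrak a_X(t)-\mathfrak c(t)\|<\varepsilon$. If $\phi_X^T(p)=p$, assume also that $\mathfrak c=\mathfrak a_X$ near $0$ and near $T$. Let $U$ be an open neighbourhood of $\Gamma$ (for example an arbitrarily thin tubular neighbourhood). Then there is a $\mu$-preserving vector field $Y$ of class $C^k$ on $M$, exact (with a $C^k$ primitive of $\iota_Y\mu$) if $X$ is exact (with a $C^\infty$ primitive of $\iota_X\mu$), with the following properties. 1. $Y=X$ outside $U$. 2. $\|X-Y\|_{C^1}\le K(\|X\|_{C^0},C_\tau)\,\varepsilon$. 3. $\phi_X^t(p)=\phi_Y^t(p)$ for all $t\in[0,T]$. 4. For all $t\in[0,T]$, $\phi_Y^t$ is differentiable at $p$, and $A_Y(t):=\tau_{\phi_Y^t(p)}\circ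 D_p\phi_Y^t\circ\tau_p^{-1}$ lies in $SL(2,\mathbb R)$, is differentiable in $t$ and satisfies $\big(\tfrac{d}{dt}A_Y(t)\big)A_Y(t)^{-1}=\mathfrak c(t)$. -/

import Mathlib

open Set Function Manifold ContDiff
open scoped ENNReal

/- The norm on `Matrix` is the supremum of the absolute values of the entries. -/
attribute [local instance] Matrix.normedAddCommGroup Matrix.normedSpace

namespace Franks

/-- The model space `ℝ³`. By Mathlib's convention `TangentSpace (𝓡 3) q` is a copy of this space,
identified with the actual tangent space through the preferred chart at `q`. -/
abbrev E3 : Type := EuclideanSpace ℝ (Fin 3)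

section

variable {M : Type*} [TopologicalSpace M] [ChartedSpace E3 M]

variable (M) in
/-- (Not necessarily continuous) vector fields. -/
abbrev VField : Type _ := ∀ q : M, TangentSpace (𝓡 3) q

variable (M) in
/-- (Not necessarily continuous) differential `n`-forms. -/
abbrev DForm (n : ℕ) : Type _ := ∀ q : M, TangentSpace (𝓡 3) q [⋀^Fin n]→L[ℝ] ℝ

variable (M) in
/-- Smooth Riemannian metrics. -/
abbrev RMetric [IsManifold (𝓡 3) ∞ M] : Type _ :=
  Bundle.ContMDiffRiemannianMetric (𝓡 3) ∞ E3 (fun q : M => TangentSpace (𝓡 3) q)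

/-- The vector field is of class `C^k`. -/
def IsCkField [IsManifold (𝓡 3) ∞ M] (k : ℕ∞) (X : VField M) : Prop :=
  ContMDiff (𝓡 3) (𝓡 3).tangent k (fun q => (⟨q, X q⟩ : TangentBundle (𝓡 3) M))

variable [IsManifold (𝓡 3) ∞ M]

/-- The differential at `q` of the inverse of the preferred chart at `x`, for `q` in the domain of
that chart: it turns the coordinates of a tangent vector in the chart at `x` into the vector. -/
noncomputable def fromChart (x q : M) : E3 →L[ℝ] TangentSpace (𝓡 3) q :=
  tangentCoordChange (𝓡 3) x q q

/-- The differential at `q` of the preferred chart at `x`, for `q` in the domain of that chart. -/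
noncomputable def toChart (x q : M) : TangentSpace (𝓡 3) q →L[ℝ] E3 :=
  tangentCoordChange (𝓡 3) q x q

/-- A vector field written in the preferred chart at `x`. -/
noncomputable def fieldInChart (X : VField M) (x : M) (u : E3) : E3 :=
  toChart x ((extChartAt (𝓡 3) x).symm u) (X ((extChartAt (𝓡 3) x).symm u))

/-- A differential form written in the preferred chart at `x`. -/
noncomputable def formInChart {n : ℕ} (η : DForm M n) (x : M) (u : E3) : E3 [⋀^Fin n]→L[ℝ] ℝ :=
  (η ((extChartAt (𝓡 3) x).symm u)).compContinuousLinearMap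
    (fromChart x ((extChartAt (𝓡 3) x).symm u))

/-- A metric written in the preferred chart at `x`: the function
`u ↦ g(V, W)` for the constant coordinate fields `V`, `W`. -/
noncomputable def metricInChart (g : RMetric M) (x : M) (V W : E3) (u : E3) : ℝ :=
  g.inner ((extChartAt (𝓡 3) x).symm u)
    (fromChart x ((extChartAt (𝓡 3) x).symm u) V) (fromChart x ((extChartAt (𝓡 3) x).symm u) W)

/-- The differential form is of class `C^k`: its coefficients in charts are. -/
def IsCkForm {n : ℕ} (k : ℕ∞) (η : DForm M n) : Prop :=
  ∀ x : M, ContDiffOn ℝ k (formInChart η x) (extChartAt (𝓡 3) x).target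

/-- Exterior derivative, computed at `x` in the preferred chart at `x`. -/
noncomputable def extD {n : ℕ} (η : DForm M n) : DForm M (n + 1) :=
  fun x => (extDeriv (formInChart η x) (extChartAt (𝓡 3) x x) : E3 [⋀^Fin (n + 1)]→L[ℝ] ℝ)

/-- The contraction `ι_X η`. -/
noncomputable def contract {n : ℕ} (X : VField M) (η : DForm M (n + 1)) : DForm M n :=
  fun x => (ContinuousAlternatingMap.curryLeft (E := E3) (η x) (X x) : E3 [⋀^Fin n]→L[ℝ] ℝ)

/-- `X` is `μ`-preserving: `ι_X μ` is closed. -/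
def IsVolumePreserving (μ : DForm M 3) (X : VField M) : Prop :=
  extD (contract X μ) = 0

/-- `X` is exact (with a primitive of class `C^k`): `ι_X μ = dα` for some one-form `α`. -/
def IsExactField (k : ℕ∞) (μ : DForm M 3) (X : VField M) : Prop :=
  ∃ α : DForm M 1, IsCkForm k α ∧ extD α = contract X μ

/-- `μ` is a smooth volume form and it is the one induced by `g` (for the orientation given by
`μ`): the square of `μ(v₁, v₂, v₃)` is the Gram determinant of the `vᵢ`. -/
def IsMetricVolumeForm (g : RMetric M) (μ : DForm M 3) : Prop :=
  IsCkForm ⊤ μ ∧ ∀ (q : M) (v : Fin 3 → TangentSpace (𝓡 3) q),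
    (μ q v) ^ 2 = (Matrix.of fun i j => g.inner q (v i) (v j)).det

/-- The length `|v|_g`. -/
noncomputable def len (g : RMetric M) {q : M} (v : TangentSpace (𝓡 3) q) : ℝ :=
  √(g.inner q v v)

/-- `g(∇_V X, W)` at `x`, where `∇` is the Levi-Civita connection of `g`: in coordinates,
`g(D_V X, W) + (X · g(V, W) + V · g(X, W) - W · g(X, V)) / 2`, the last summand being the
contraction of the Christoffel symbols of the first kind with `X`, `V` and `W`. -/
noncomputable def nablaInner (g : RMetric M) (X : VField M) (x : M)
    (V W : TangentSpace (𝓡 3) x) : ℝ :=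
  let u : E3 := extChartAt (𝓡 3) x x
  let D (f : E3 → ℝ) (v : E3) : ℝ := fderiv ℝ f u v
  g.inner x (fderiv ℝ (fieldInChart X x) u V : E3) W +
    (D (metricInChart g x V W) (X x) + D (metricInChart g x (X x) W) V
      - D (metricInChart g x (X x) V) W) / 2

/-- `‖X‖_{C⁰} = sup |X|_g`. -/
noncomputable def c0Norm (g : RMetric M) (X : VField M) : ℝ≥0∞ :=
  ⨆ x : M, ENNReal.ofReal (len g (X x))

/-- `‖X‖_{C¹} = sup |X|_g + sup |∇X|_g`, with the operator norm of `∇X`. -/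
noncomputable def c1Norm (g : RMetric M) (X : VField M) : ℝ≥0∞ :=
  c0Norm g X + ⨆ (x : M) (V : TangentSpace (𝓡 3) x) (W : TangentSpace (𝓡 3) x)
    (_ : len g V ≤ 1) (_ : len g W ≤ 1), ENNReal.ofReal |nablaInner g X x V W|

/-- `φ` is the flow of `X`: `t ↦ φ t q` is the integral curve of `X` through `q`. -/
def IsFlow (X : VField M) (φ : ℝ → M → M) : Prop :=
  ∀ q : M, φ 0 q = q ∧ IsMIntegralCurve (fun t => φ t q) X

variable (M) in
/-- Families of linear maps `τ_q : T_q M → ℝ²`. -/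
abbrev NormalMap : Type _ := ∀ q : M, TangentSpace (𝓡 3) q →L[ℝ] EuclideanSpace ℝ (Fin 2)

/-- `τ` is a trivialization of the normal bundle `TM / span X` along the curve `γ`, `0 ≤ t ≤ T`:
each `τ_{γ(t)}` induces an isomorphism `T_{γ(t)}M / span X ≅ ℝ²`, smoothly in `t`. -/
structure IsNormalTrivialization (X : VField M) (γ : ℝ → M) (T : ℝ) (τ : NormalMap M) : Prop where
  surj : ∀ t ∈ Icc 0 T, Surjective (τ (γ t))
  ker : ∀ t ∈ Icc 0 T, ∀ v : TangentSpace (𝓡 3) (γ t), τ (γ t) v = 0 ↔ ∃ s : ℝ, v = s • X (γ t)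
  smooth : ∀ x : M, ContDiffOn ℝ ∞
    (fun t => ((τ (γ t)).comp (fromChart x (γ t)) : E3 →L[ℝ] EuclideanSpace ℝ (Fin 2)))
    (Icc 0 T ∩ γ ⁻¹' (chartAt E3 x).source)

/-- `C` bounds the trivialization `τ` and its inverse, the normal bundle being identified with the
`g`-orthogonal complement of `X`. -/
def IsTrivializationConstant (g : RMetric M) (X : VField M) (γ : ℝ → M) (T : ℝ) (τ : NormalMap M)
    (C : ℝ) : Prop :=
  ∀ t ∈ Icc 0 T, ∀ v : TangentSpace (𝓡 3) (γ t), g.inner (γ t) v (X (γ t)) = 0 →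
    ‖τ (γ t) v‖ ≤ C * len g v ∧ len g v ≤ C * ‖τ (γ t) v‖

/-- The transverse linearization `A(t) = τ_{φ^t(p)} ∘ D_p φ^t ∘ τ_p⁻¹`. Here `τ_p⁻¹` is any right
inverse of `τ_p`; it is determined up to multiples of `X(p)`, which `D_p φ^t` sends to the kernel
of `τ_{φ^t(p)}`. -/
noncomputable def transverseLin (τ : NormalMap M) (φ : ℝ → M → M) (p : M) (t : ℝ) :
    Matrix (Fin 2) (Fin 2) ℝ :=
  Matrix.of fun i j =>
    τ (φ t p) (mfderiv (𝓡 3) (𝓡 3) (φ t) p (invFun (τ p) (EuclideanSpace.single j 1))) i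

/-- The infinitesimal transverse linearization `𝔞(t) = A'(t) A(t)⁻¹`, `0 ≤ t ≤ T`. -/
noncomputable def infinitesimalLin (τ : NormalMap M) (φ : ℝ → M → M) (p : M) (T t : ℝ) :
    Matrix (Fin 2) (Fin 2) ℝ :=
  derivWithin (transverseLin τ φ p) (Icc 0 T) t * (transverseLin τ φ p t)⁻¹

end

end Franks

/-! Write `Y = X + Z`. If `Z` vanishes along `Γ`, the orbit of `p` is unchanged, and the linearized
equation along it changes exactly by the derivative of `Z`. So what is needed is a `μ`-preserving
`Z`, zero on `Γ` and small in `C¹`, whose derivative acts on the normal bundle as the traceless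
matrix `c - 𝔞`. Traceless `2 × 2` matrices are the linear Hamiltonian fields of the plane; the
quadratic forms `xy`, `y²/2`, `x²/2` generate them.

Near a point of `Γ` take linear coordinates `(s, u₁, u₂)` in which `Γ` is the graph `(s, ζ₁ s, ζ₂
s)`, put `w = (u₁ - ζ₁ s, u₂ - ζ₂ s)`, and let `m` be the density of `μ`. For a function `β` of `s`
alone, the field `Z = (β/m) (∂₂K e₁ - ∂₁K e₂)` satisfies `ι_Z μ = β dK ∧ ds = d(β K ds)`, hence is
divergence-free and exact (`hamField_exact`). No derivative of `β` enters `Z`, so `Z` is as regular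
as `c`. Now let `K = δ² h(w/δ)` with `h` a cut-off quadratic form. Then `Z = O(δ)`; in `∇Z` the
derivative of `β/m` and the Christoffel symbols appear with a factor `δ`, while the second
derivatives of `K` are bounded independently of `δ`. For `δ` small the `C¹` size of `Z` is therefore
a constant times `sup |β/m|`, although `c - 𝔞` is only `C⁰` small (`exists_isPiece`). In a frame
that is orthonormal up to the factor `C`, this is a constant times `C² ε`.

Such fields are produced on short time intervals (`IsFranksData.exists_coeff`,
`IsFranksData.exists_flowBox`, `IsFranksData.exists_localPiece`) and summed with a partition of
unity in time. The supports are thin tubes around short arcs, of which at most three meet at any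
point, so the estimate does not depend on the number of pieces (`IsPiece.sum`,
`IsFranksData.exists_perturbation`). If the orbit does not close up, the arcs may overshoot `[0,
T]`; if it does, nothing has to be changed near its ends (`exists_time_window`).

Finally `transverseLin_perturb` reads off the new linearization. Since `Y` may be only `C¹`, this
rests on the variational equation for `C¹` fields (`exists_localFlow_hasFDerivAt`,
`IsFlow.hasDerivAt_mfderiv`). A Borel-type extension (`exists_contDiff_extension`) carries `C^k`
coefficients from a compact interval to the line. -/

namespace Franks

/-! ### Differentiable dependence of the flow of a `C¹` field on the initial condition. -/

section LocalFlow

open Filter Topology Metric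
open scoped NNReal

variable {E : Type*} [NormedAddCommGroup E] [NormedSpace ℝ E]

/-- Grönwall's inequality on a symmetric interval. -/
theorem norm_le_gronwallBound_abs {e e' : ℝ → E} {ε K c d : ℝ}
    (he : ∀ t ∈ Ioo (-ε) ε, HasDerivAt e (e' t) t) (h0 : ‖e 0‖ ≤ d)
    (hb : ∀ t ∈ Ioo (-ε) ε, ‖e' t‖ ≤ K * ‖e t‖ + c) :
    ∀ t ∈ Ioo (-ε) ε, ‖e t‖ ≤ gronwallBound d K c |t| := by
  have key : ∀ {e e' : ℝ → E}, (∀ t ∈ Ioo (-ε) ε, HasDerivAt e (e' t) t) → ‖e 0‖ ≤ d →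
      (∀ t ∈ Ioo (-ε) ε, ‖e' t‖ ≤ K * ‖e t‖ + c) →
      ∀ t ∈ Ico 0 ε, ‖e t‖ ≤ gronwallBound d K c t := by
    intro e e' he h0 hb t ht
    have hsub : ∀ s ∈ Icc 0 t, s ∈ Ioo (-ε) ε := fun s hs =>
      ⟨by linarith [hs.1, ht.1, ht.2], by linarith [hs.2, ht.2]⟩
    have := norm_le_gronwallBound_of_norm_deriv_right_le (f := e) (f' := e') (a := 0) (b := t)
      (δ := d) (K := K) (ε := c)
      (fun s hs => (he s (hsub s hs)).continuousAt.continuousWithinAt)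
      (fun s hs => (he s (hsub s (Ico_subset_Icc_self hs))).hasDerivWithinAt) h0
      (fun s hs => hb s (hsub s (Ico_subset_Icc_self hs))) t ⟨ht.1, le_rfl⟩
    simpa using this
  intro t ht
  rcases le_total 0 t with h | h
  · rw [abs_of_nonneg h]
    exact key he h0 hb t ⟨h, ht.2⟩
  · rw [abs_of_nonpos h]
    have hneg : ∀ s ∈ Ioo (-ε) ε, -s ∈ Ioo (-ε) ε := fun s hs =>
      ⟨by linarith [hs.2], by linarith [hs.1]⟩
    have := key (e := fun s => e (-s)) (e' := fun s => -e' (-s))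
      (fun s hs => by
        have := (he (-s) (hneg s hs)).scomp s (hasDerivAt_neg s)
        simpa [Function.comp_def] using this)
      (by simpa using h0) (fun s hs => by simpa using hb (-s) (hneg s hs)) (-t)
      ⟨by linarith, by linarith [ht.1]⟩
    simpa using this

/-- Existence for linear differential equations in small time. -/
theorem exists_linear_flow [CompleteSpace E] {ε K : ℝ} (hε : 0 < ε) (hK0 : 0 ≤ K) :
    ∃ ε' > 0, ε' ≤ ε ∧ ∀ A : ℝ → E →L[ℝ] E, ContinuousOn A (Ioo (-ε) ε) →
      (∀ t ∈ Ioo (-ε) ε, ‖A t‖ ≤ K) → ∃ R : ℝ → E →L[ℝ] E, R 0 = ContinuousLinearMap.id ℝ E ∧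
      ∀ t ∈ Ioo (-ε') ε', HasDerivAt R ((A t).comp (R t)) t := by
  let K' : ℝ≥0 := ⟨K, hK0⟩
  let I : E →L[ℝ] E := ContinuousLinearMap.id ℝ E
  let L : ℝ≥0 := K' * (‖I‖₊ + 1)
  have hL0 : (0 : ℝ) ≤ L := L.2
  -- On the unit ball about the identity the speed is at most `L`, so a solution stays in that ball
  -- for time `1 / (L + 1)`. The resulting time depends on `ε` and `K` but not on `A`, so that one
  -- time serves all initial points.
  let ε' : ℝ := min (ε / 2) (1 / (L + 1))
  have hε' : 0 < ε' := by positivity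
  have hε'ε : ε' < ε := (min_le_left _ _).trans_lt (by linarith)
  have hsub : ∀ t ∈ Icc (-ε') ε', t ∈ Ioo (-ε) ε := fun t ht =>
    ⟨by linarith [ht.1], by linarith [ht.2]⟩
  refine ⟨ε', hε', hε'ε.le, fun A hA hK => ?_⟩
  have hPL : IsPicardLindelof (fun t (R : E →L[ℝ] E) => (A t).comp R)
      (tmin := -ε') (tmax := ε') ⟨0, by constructor <;> linarith⟩ I 1 0 L K' := by
    refine ⟨?_, ?_, ?_, ?_⟩
    · intro t ht
      refine LipschitzOnWith.of_dist_le_mul fun R _ S _ => ?_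
      rw [dist_eq_norm, dist_eq_norm, ← ContinuousLinearMap.comp_sub]
      exact (ContinuousLinearMap.opNorm_comp_le _ _).trans
        (mul_le_mul_of_nonneg_right (hK t (hsub t ht)) (norm_nonneg _))
    · intro R _
      exact (hA.mono hsub).clm_comp continuousOn_const
    · intro t ht R hR
      refine (ContinuousLinearMap.opNorm_comp_le _ _).trans ?_
      have hR' : ‖R‖ ≤ ‖I‖ + 1 := by
        have h1 : ‖R - I‖ ≤ 1 := by simpa [dist_eq_norm] using hR
        have := norm_add_le (R - I) I
        rw [sub_add_cancel] at this
        linarith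
      exact mul_le_mul (hK t (hsub t ht)) hR' (norm_nonneg _) hK0
    · have h1 : max (ε' - 0) (0 - -ε') = ε' := by simp
      change (L : ℝ) * max (ε' - 0) (0 - -ε') ≤ ((1 : ℝ≥0) : ℝ) - ((0 : ℝ≥0) : ℝ)
      rw [h1]
      have h2 : ε' ≤ 1 / (L + 1) := min_le_right _ _
      calc (L : ℝ) * ε' ≤ L * (1 / (L + 1)) := mul_le_mul_of_nonneg_left h2 hL0
        _ ≤ ((1 : ℝ≥0) : ℝ) - ((0 : ℝ≥0) : ℝ) := by
          rw [mul_one_div, div_le_iff₀ (by positivity)]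
          simp
  obtain ⟨R, hR0, hR⟩ := hPL.exists_eq_forall_mem_Icc_hasDerivWithinAt₀
  exact ⟨R, hR0, fun t ht =>
    (hR t (Ioo_subset_Icc_self ht)).hasDerivAt (Icc_mem_nhds ht.1 ht.2)⟩

/-- The linearization of a `C¹` map is uniform along a compact piece of a curve. -/
theorem eventually_forall_norm_sub_le {f : E → E} {u : ℝ → E} {s : Set ℝ} (hs : IsCompact s)
    (hf : ∀ t ∈ s, ContDiffAt ℝ 1 f (u t)) (hu : ∀ t ∈ s, ContinuousAt u t) {η : ℝ} (hη : 0 < η) :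
    ∀ᶠ h in 𝓝 (0 : E), ∀ t ∈ s, ‖f (u t + h) - f (u t) - fderiv ℝ f (u t) h‖ ≤ η * ‖h‖ := by
  refine hs.eventually_forall_of_forall_eventually fun t ht => ?_
  -- Strict differentiability compares increments at moving base points with the derivative at the
  -- fixed point `u t`; continuity of `fderiv` then replaces the latter by the derivative at the
  -- moving point. Each of the two steps costs `η / 2`.
  have hstrict : HasStrictFDerivAt f (fderiv ℝ f (u t)) (u t) :=
    (hf t ht).hasStrictFDerivAt one_ne_zero
  have h1 : ∀ᶠ p : E × E in 𝓝 (u t, u t),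
      ‖f p.1 - f p.2 - fderiv ℝ f (u t) (p.1 - p.2)‖ ≤ η / 2 * ‖p.1 - p.2‖ :=
    hstrict.isLittleO.def (half_pos hη)
  have hc2 : ContinuousAt (fun z : E × ℝ => u z.2) ((0 : E), t) :=
    ContinuousAt.comp (f := fun z : E × ℝ => z.2) (hu t ht) continuousAt_snd
  have hc : Tendsto (fun z : E × ℝ => (u z.2 + z.1, u z.2)) (𝓝 ((0 : E), t)) (𝓝 (u t, u t)) := by
    have : ContinuousAt (fun z : E × ℝ => (u z.2 + z.1, u z.2)) ((0 : E), t) :=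
      (hc2.add continuousAt_fst).prodMk hc2
    simpa [ContinuousAt] using this
  have hA : ContinuousAt (fun z : E × ℝ => fderiv ℝ f (u z.2)) ((0 : E), t) :=
    ContinuousAt.comp (f := fun z : E × ℝ => u z.2) (g := fderiv ℝ f)
      ((hf t ht).continuousAt_fderiv one_ne_zero) hc2
  have h2 : ∀ᶠ z : E × ℝ in 𝓝 ((0 : E), t), ‖fderiv ℝ f (u z.2) - fderiv ℝ f (u t)‖ < η / 2 := by
    have := Metric.continuousAt_iff'.1 hA (η / 2) (half_pos hη)
    simpa [dist_eq_norm] using this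
  filter_upwards [hc.eventually h1, h2] with z hz1 hz2
  simp only [add_sub_cancel_left] at hz1
  have : f (u z.2 + z.1) - f (u z.2) - fderiv ℝ f (u z.2) z.1 =
      (f (u z.2 + z.1) - f (u z.2) - fderiv ℝ f (u t) z.1) -
        (fderiv ℝ f (u z.2) - fderiv ℝ f (u t)) z.1 := by
    simp
  rw [this]
  refine (norm_sub_le _ _).trans ?_
  have h3 := (fderiv ℝ f (u z.2) - fderiv ℝ f (u t)).le_of_opNorm_le hz2.le z.1
  linarith

/-- The local flow of a `C¹` vector field is differentiable with respect to the initial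
condition, and its differential solves the linearized equation. -/
theorem exists_localFlow_hasFDerivAt [CompleteSpace E] {f : E → E} {x₀ : E}
    (hf : ContDiffAt ℝ 1 f x₀) {V : Set E} (hV : V ∈ 𝓝 x₀) :
    ∃ r > 0, ∃ ε > 0, ∃ α : E → ℝ → E,
      (∀ x ∈ closedBall x₀ r, α x 0 = x ∧ ∀ t ∈ Ioo (-ε) ε,
        HasDerivAt (α x) (f (α x t)) t ∧ α x t ∈ V) ∧
      ∀ y ∈ ball x₀ r, ∃ R : ℝ → E →L[ℝ] E,
        (∀ t ∈ Ioo (-ε) ε, HasFDerivAt (fun x => α x t) (R t) y) ∧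
        HasDerivAt R (fderiv ℝ f y) 0 := by
  obtain ⟨ε₁, hε₁, a, r, L, K, hr, hPL⟩ := IsPicardLindelof.of_contDiffAt_one hf
  obtain ⟨α, hα, hαc⟩ := (hPL 0).exists_forall_mem_closedBall_eq_hasDerivWithinAt_continuousOn
  simp only [zero_sub, zero_add] at hα hαc
  obtain ⟨K₁, S, hS, hlip⟩ := hf.exists_lipschitzOnWith
  have hcd : ∀ᶠ y in 𝓝 x₀, ContDiffAt ℝ 1 f y := hf.eventually (by simp)
  have hgood : {y | ContDiffAt ℝ 1 f y} ∩ interior S ∩ V ∈ 𝓝 x₀ :=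
    inter_mem (inter_mem hcd (interior_mem_nhds.2 hS)) hV
  have hx₀ : x₀ ∈ closedBall x₀ (r : ℝ) := mem_closedBall_self r.2
  have hct : ContinuousAt α (x₀, 0) := hαc.continuousAt
    (prod_mem_nhds (closedBall_mem_nhds _ hr) (Icc_mem_nhds (by linarith) hε₁))
  have hpre := hct.preimage_mem_nhds (t := {y | ContDiffAt ℝ 1 f y} ∩ interior S ∩ V)
    (by rw [(hα x₀ hx₀).1]; exact hgood)
  rw [nhds_prod_eq, mem_prod_iff] at hpre
  obtain ⟨N₁, hN₁, N₂, hN₂, hN⟩ := hpre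
  obtain ⟨r₂, hr₂, hr₂'⟩ := Metric.nhds_basis_closedBall.mem_iff.1 hN₁
  obtain ⟨ε₂, hε₂, hε₂'⟩ := Metric.nhds_basis_closedBall.mem_iff.1 hN₂
  rw [Real.closedBall_eq_Icc, zero_sub, zero_add] at hε₂'
  set ρ : ℝ := min r r₂ with hρ
  have hρ0 : 0 < ρ := lt_min hr hr₂
  set ε₃ : ℝ := min ε₁ ε₂ with hε₃
  have hε₃0 : 0 < ε₃ := lt_min hε₁ hε₂
  have hball : ∀ x ∈ closedBall x₀ ρ, x ∈ closedBall x₀ (r : ℝ) ∧ x ∈ N₁ := fun x hx =>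
    ⟨closedBall_subset_closedBall (min_le_left _ _) hx,
      hr₂' (closedBall_subset_closedBall (min_le_right _ _) hx)⟩
  have hmem : ∀ x ∈ closedBall x₀ ρ, ∀ t ∈ Ioo (-ε₃) ε₃,
      α (x, t) ∈ {y | ContDiffAt ℝ 1 f y} ∩ interior S ∩ V := fun x hx t ht =>
    hN (show (x, t) ∈ N₁ ×ˢ N₂ from ⟨(hball x hx).2,
      hε₂' ⟨by linarith [ht.1, min_le_right ε₁ ε₂], by linarith [ht.2, min_le_right ε₁ ε₂]⟩⟩)
  have hmemC : ∀ y ∈ ball x₀ ρ, ∀ t ∈ Ioo (-ε₃) ε₃, ContDiffAt ℝ 1 f (α (y, t)) :=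
    fun y hy t ht => (hmem y (ball_subset_closedBall hy) t ht).1.1
  have hder : ∀ x ∈ closedBall x₀ ρ, ∀ t ∈ Ioo (-ε₃) ε₃,
      HasDerivAt (fun s => α (x, s)) (f (α (x, t))) t := fun x hx t ht =>
    ((hα x (hball x hx).1).2 t ⟨by linarith [ht.1, min_le_left ε₁ ε₂],
      by linarith [ht.2, min_le_left ε₁ ε₂]⟩).hasDerivAt
      (Icc_mem_nhds (by linarith [ht.1, min_le_left ε₁ ε₂])
        (by linarith [ht.2, min_le_left ε₁ ε₂]))
  have hAc : ∀ y ∈ ball x₀ ρ, ContinuousOn (fun t => fderiv ℝ f (α (y, t))) (Ioo (-ε₃) ε₃) := fun y hy t ht =>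
    (ContinuousAt.comp (f := fun t => α (y, t)) (g := fderiv ℝ f)
      ((hmemC y hy t ht).continuousAt_fderiv one_ne_zero)
      (hder y (ball_subset_closedBall hy) t ht).continuousAt).continuousWithinAt
  -- A Lipschitz constant of `f` bounds its derivative, uniformly in the initial point `y`; hence a
  -- common existence time for all the linearized equations.
  have hAK : ∀ y ∈ ball x₀ ρ, ∀ t ∈ Ioo (-ε₃) ε₃, ‖fderiv ℝ f (α (y, t))‖ ≤ K₁ := fun y hy t ht =>
    norm_fderiv_le_of_lipschitzOn ℝ (mem_interior_iff_mem_nhds.1 (hmem y (ball_subset_closedBall hy) t ht).1.2) hlip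
  obtain ⟨ε₄, hε₄, hε₄₃, hlinflow⟩ := exists_linear_flow (E := E) hε₃0 K₁.2
  -- Halving leaves room for the compact interval `[-ε, ε]`, on which the linearization of `f` along
  -- the orbit is uniform.
  set ε : ℝ := ε₄ / 2 with hε
  have hε0 : 0 < ε := half_pos hε₄
  have hIcc : ∀ t ∈ Icc (-ε) ε, t ∈ Ioo (-ε₃) ε₃ := fun t ht =>
    ⟨by linarith [ht.1], by linarith [ht.2]⟩
  have hIoo : ∀ t ∈ Ioo (-ε) ε, t ∈ Ioo (-ε₃) ε₃ := fun t ht => hIcc t (Ioo_subset_Icc_self ht)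
  have hIoo' : ∀ t ∈ Ioo (-ε) ε, t ∈ Ioo (-ε₄) ε₄ := fun t ht =>
    ⟨by linarith [ht.1], by linarith [ht.2]⟩
  refine ⟨ρ, hρ0, ε, hε0, fun x t => α (x, t), fun x hx => ⟨(hα x (hball x hx).1).1, fun t ht =>
    ⟨hder x hx t (hIoo t ht), (hmem x hx t (hIoo t ht)).2⟩⟩, fun y hy => ?_⟩
  have hyρ : y ∈ closedBall x₀ ρ := ball_subset_closedBall hy
  obtain ⟨R, hR0, hR⟩ := hlinflow _ (hAc y hy) (hAK y hy)
  refine ⟨R, fun t ht => ?_, ?_⟩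
  -- The added `1` makes the constant nonzero, for the closed form of `gronwallBound`, and absorbs
  -- the strictness of later estimates.
  · set K₂ : ℝ := K₁ + 1 with hK₂
    have hK₂0 : 0 < K₂ := by positivity
    set G : ℝ := Real.exp (K₂ * ε) with hG
    have hG0 : 0 < G := Real.exp_pos _
    -- Lipschitz dependence on the initial condition
    have hlipx : ∀ x ∈ closedBall x₀ ρ, ∀ s ∈ Ioo (-ε) ε,
        ‖α (x, s) - α (y, s)‖ ≤ ‖x - y‖ * G := by
      intro x hx s hs
      have := norm_le_gronwallBound_abs (e := fun s => α (x, s) - α (y, s))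
        (e' := fun s => f (α (x, s)) - f (α (y, s))) (ε := ε) (K := K₂) (c := 0)
        (d := ‖x - y‖) (fun s hs => (hder x hx s (hIoo s hs)).sub (hder y hyρ s (hIoo s hs)))
        (by rw [(hα x (hball x hx).1).1, (hα y (hball y hyρ).1).1])
        (fun s hs => by
          have := hlip.dist_le_mul _ (interior_subset (hmem x hx s (hIoo s hs)).1.2) _
            (interior_subset (hmem y hyρ s (hIoo s hs)).1.2)
          rw [dist_eq_norm, dist_eq_norm] at this
          nlinarith [norm_nonneg (α (x, s) - α (y, s))]) s hs
      rw [gronwallBound_ε0] at this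
      refine this.trans (mul_le_mul_of_nonneg_left ?_ (norm_nonneg _))
      refine Real.exp_le_exp.2 (mul_le_mul_of_nonneg_left ?_ hK₂0.le)
      exact abs_le.2 ⟨hs.1.le, hs.2.le⟩
    rw [hasFDerivAt_iff_isLittleO]
    refine Asymptotics.isLittleO_iff.2 fun c hc => ?_
    -- Chosen so that the final Grönwall bound `η ‖x - y‖ G / K₂ * G` equals `c ‖x - y‖`.
    set η : ℝ := c / (G * (G / K₂)) with hη
    have hη0 : 0 < η := by positivity
    have hlin := eventually_forall_norm_sub_le (f := f) (u := fun t => α (y, t))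
      (isCompact_Icc (a := -ε) (b := ε)) (fun s hs => hmemC y hy s (hIcc s hs))
      (fun s hs => (hder y hyρ s (hIcc s hs)).continuousAt) hη0
    obtain ⟨d, hd, hlin⟩ := Metric.eventually_nhds_iff.1 hlin
    have hnear : ∀ᶠ x in 𝓝 y, x ∈ closedBall x₀ ρ ∧ ‖x - y‖ * G < d := by
      refine Filter.Eventually.and (closedBall_mem_nhds_of_mem hy) ?_
      have : Tendsto (fun x => ‖x - y‖ * G) (𝓝 y) (𝓝 (‖y - y‖ * G)) :=
        ((continuous_id.sub continuous_const).norm.mul continuous_const).tendsto y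
      exact this.eventually_lt_const (by simpa using hd)
    filter_upwards [hnear] with x hx
    -- The error of the linear approximation vanishes at time `0` and solves the linearized equation
    -- up to a term of size `η ‖x - y‖ G`, so Grönwall's inequality bounds it.
    have hbound := norm_le_gronwallBound_abs
      (e := fun s => α (x, s) - α (y, s) - R s (x - y))
      (e' := fun s => f (α (x, s)) - f (α (y, s)) -
        (fderiv ℝ f (α (y, s))) (R s (x - y))) (ε := ε) (K := K₂) (c := η * (‖x - y‖ * G))
      (d := 0)
      (fun s hs => by
        refine ((hder x hx.1 s (hIoo s hs)).sub (hder y hyρ s (hIoo s hs))).sub ?_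
        exact (hR s (hIoo' s hs)).clm_apply (hasDerivAt_const s (x - y)) |>.congr_deriv (by simp))
      (by rw [(hα x (hball x hx.1).1).1, (hα y (hball y hyρ).1).1, hR0]; simp)
      (fun s hs => by
        have h1 := hlin (y := α (x, s) - α (y, s))
          (by rw [dist_zero_right]; exact (hlipx x hx.1 s hs).trans_lt hx.2) s
          (Ioo_subset_Icc_self hs)
        rw [add_sub_cancel] at h1
        have h2 : f (α (x, s)) - f (α (y, s)) - (fderiv ℝ f (α (y, s))) (R s (x - y)) =
            (f (α (x, s)) - f (α (y, s)) -
              (fderiv ℝ f (α (y, s))) (α (x, s) - α (y, s))) +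
            (fderiv ℝ f (α (y, s))) (α (x, s) - α (y, s) - R s (x - y)) := by
          rw [map_sub _ (α (x, s) - α (y, s))]; abel
        rw [h2]
        refine (norm_add_le _ _).trans ?_
        have h3 := (fderiv ℝ f (α (y, s))).le_of_opNorm_le (hAK y hy s (hIoo s hs))
          (α (x, s) - α (y, s) - R s (x - y))
        have h4 := mul_le_mul_of_nonneg_left (hlipx x hx.1 s hs) hη0.le
        nlinarith [norm_nonneg (α (x, s) - α (y, s) - R s (x - y))]) t ht
    refine hbound.trans ?_
    rw [gronwallBound_of_K_ne_0 hK₂0.ne']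
    simp only [zero_mul, zero_add]
    have h5 : Real.exp (K₂ * |t|) - 1 ≤ G := by
      have : Real.exp (K₂ * |t|) ≤ G :=
        Real.exp_le_exp.2 (mul_le_mul_of_nonneg_left (abs_le.2 ⟨ht.1.le, ht.2.le⟩) hK₂0.le)
      linarith
    calc η * (‖x - y‖ * G) / K₂ * (Real.exp (K₂ * |t|) - 1)
        ≤ η * (‖x - y‖ * G) / K₂ * G := mul_le_mul_of_nonneg_left h5 (by positivity)
      _ = c * ‖x - y‖ := by
          rw [hη]; field_simp
  · have := hR 0 ⟨by linarith, hε₄⟩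
    rw [hR0, (hα y (hball y hyρ).1).1] at this
    simpa using this

end LocalFlow

end Franks
-- Fields, forms and metrics in charts, and changes of charts.
namespace Franks

section Charts

open Filter Topology

variable {M : Type*} [TopologicalSpace M] [ChartedSpace E3 M]

/-- The change of coordinates between preferred charts. -/
noncomputable def chg (x y : M) : E3 → E3 := extChartAt (𝓡 3) y ∘ (extChartAt (𝓡 3) x).symm

theorem chg_apply {x y q : M} (hx : q ∈ (extChartAt (𝓡 3) x).source) :
    chg x y (extChartAt (𝓡 3) x q) = extChartAt (𝓡 3) y q := by
  simp only [chg, comp_apply]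
  rw [(extChartAt (𝓡 3) x).left_inv hx]

theorem chg_continuousAt_symm {x : M} {u : E3} (hu : u ∈ (extChartAt (𝓡 3) x).target) :
    ContinuousAt (extChartAt (𝓡 3) x).symm u :=
  (continuousOn_extChartAt_symm x).continuousAt ((isOpen_extChartAt_target x).mem_nhds hu)

/-- Points near a point of two charts are in both charts. -/
theorem eventually_mem_target_source {x y q : M} (hx : q ∈ (extChartAt (𝓡 3) x).source)
    (hy : q ∈ (extChartAt (𝓡 3) y).source) :
    ∀ᶠ u in 𝓝 (extChartAt (𝓡 3) x q), u ∈ (extChartAt (𝓡 3) x).target ∧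
      (extChartAt (𝓡 3) x).symm u ∈ (extChartAt (𝓡 3) y).source := by
  have hu : extChartAt (𝓡 3) x q ∈ (extChartAt (𝓡 3) x).target := (extChartAt (𝓡 3) x).map_source hx
  refine Filter.Eventually.and ((isOpen_extChartAt_target x).mem_nhds hu) ?_
  refine (chg_continuousAt_symm hu).preimage_mem_nhds ?_
  rw [(extChartAt (𝓡 3) x).left_inv hx]
  exact (isOpen_extChartAt_source y).mem_nhds hy

variable [IsManifold (𝓡 3) ∞ M]

theorem chg_contDiffAt {x y q : M} (hx : q ∈ (extChartAt (𝓡 3) x).source)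
    (hy : q ∈ (extChartAt (𝓡 3) y).source) :
    ContDiffAt ℝ ∞ (chg x y) (extChartAt (𝓡 3) x q) := by
  have h' : extChartAt (𝓡 3) x q ∈
      ((extChartAt (𝓡 3) x).symm ≫ (extChartAt (𝓡 3) y)).source := by
    rw [PartialEquiv.trans_source'', PartialEquiv.symm_symm, PartialEquiv.symm_target]
    exact mem_image_of_mem _ ⟨hx, hy⟩
  have := contDiffWithinAt_ext_coord_change (I := 𝓡 3) (n := ∞) y x h'
  rw [modelWithCornersSelf_coe, range_id, contDiffWithinAt_univ] at this
  exact this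

theorem chg_hasFDerivAt {x y q : M} (hx : q ∈ (extChartAt (𝓡 3) x).source)
    (hy : q ∈ (extChartAt (𝓡 3) y).source) :
    HasFDerivAt (chg x y) (tangentCoordChange (𝓡 3) x y q) (extChartAt (𝓡 3) x q) := by
  have := hasFDerivWithinAt_tangentCoordChange (I := 𝓡 3) ⟨hx, hy⟩
  simpa [chg] using this

theorem chg_fderiv {x y q : M} (hx : q ∈ (extChartAt (𝓡 3) x).source)
    (hy : q ∈ (extChartAt (𝓡 3) y).source) :
    fderiv ℝ (chg x y) (extChartAt (𝓡 3) x q) = tangentCoordChange (𝓡 3) x y q :=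
  (chg_hasFDerivAt hx hy).fderiv

theorem toChart_chg {x y q : M} (hx : q ∈ (extChartAt (𝓡 3) x).source)
    (hy : q ∈ (extChartAt (𝓡 3) y).source) (v : TangentSpace (𝓡 3) q) :
    toChart y q v = tangentCoordChange (𝓡 3) x y q (toChart x q v) :=
  (tangentCoordChange_comp (I := 𝓡 3) (v := v) ⟨⟨mem_extChartAt_source q, hx⟩, hy⟩).symm

theorem fromChart_chg {x y q : M} (hx : q ∈ (extChartAt (𝓡 3) x).source)
    (hy : q ∈ (extChartAt (𝓡 3) y).source) (v : E3) :
    fromChart x q v = fromChart y q (tangentCoordChange (𝓡 3) x y q v) :=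
  (tangentCoordChange_comp (I := 𝓡 3) (v := v) ⟨⟨hx, hy⟩, mem_extChartAt_source q⟩).symm

theorem toChart_fromChart {x q : M} (hx : q ∈ (extChartAt (𝓡 3) x).source) (v : E3) :
    toChart x q (fromChart x q v) = v := by
  refine (tangentCoordChange_comp (I := 𝓡 3) (v := v) ⟨⟨hx, mem_extChartAt_source q⟩, hx⟩).trans ?_
  exact tangentCoordChange_self (I := 𝓡 3) hx

theorem fromChart_toChart {x q : M} (hx : q ∈ (extChartAt (𝓡 3) x).source)
    (v : TangentSpace (𝓡 3) q) : fromChart x q (toChart x q v) = v := by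
  refine (tangentCoordChange_comp (I := 𝓡 3) (v := v)
    ⟨⟨mem_extChartAt_source q, hx⟩, mem_extChartAt_source q⟩).trans ?_
  exact tangentCoordChange_self (I := 𝓡 3) (mem_extChartAt_source q)

theorem toChart_self (q : M) (v : TangentSpace (𝓡 3) q) : toChart q q v = v :=
  tangentCoordChange_self (I := 𝓡 3) (mem_extChartAt_source q)

theorem fieldInChart_apply (X : VField M) {x q : M} (hx : q ∈ (extChartAt (𝓡 3) x).source) :
    fieldInChart X x (extChartAt (𝓡 3) x q) = toChart x q (X q) := by
  simp only [fieldInChart]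
  rw [(extChartAt (𝓡 3) x).left_inv hx]

theorem fieldInChart_chg (X : VField M) {x y q : M} (hx : q ∈ (extChartAt (𝓡 3) x).source)
    (hy : q ∈ (extChartAt (𝓡 3) y).source) :
    fieldInChart X y (chg x y (extChartAt (𝓡 3) x q)) =
      fderiv ℝ (chg x y) (extChartAt (𝓡 3) x q) (fieldInChart X x (extChartAt (𝓡 3) x q)) := by
  rw [chg_apply hx, fieldInChart_apply X hx, fieldInChart_apply X hy, chg_fderiv hx hy,
    toChart_chg hx hy]

theorem fieldInChart_chg_eventually (X : VField M) {x y q : M}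
    (hx : q ∈ (extChartAt (𝓡 3) x).source) (hy : q ∈ (extChartAt (𝓡 3) y).source) :
    ∀ᶠ u in 𝓝 (extChartAt (𝓡 3) x q),
      fieldInChart X y (chg x y u) = fderiv ℝ (chg x y) u (fieldInChart X x u) := by
  filter_upwards [eventually_mem_target_source hx hy] with u hu
  have := fieldInChart_chg X ((extChartAt (𝓡 3) x).map_target hu.1) hu.2
  rwa [(extChartAt (𝓡 3) x).right_inv hu.1] at this

theorem metricInChart_chg (g : RMetric M) {x y q : M} (hx : q ∈ (extChartAt (𝓡 3) x).source)
    (hy : q ∈ (extChartAt (𝓡 3) y).source) (V W : E3) :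
    ∀ᶠ u in 𝓝 (extChartAt (𝓡 3) x q), metricInChart g x V W u =
      metricInChart g y (fderiv ℝ (chg x y) u V) (fderiv ℝ (chg x y) u W) (chg x y u) := by
  filter_upwards [eventually_mem_target_source hx hy] with u hu
  have hq := (extChartAt (𝓡 3) x).map_target hu.1
  have hfd := chg_fderiv hq hu.2
  rw [(extChartAt (𝓡 3) x).right_inv hu.1] at hfd
  simp only [metricInChart, chg, comp_apply]
  rw [(extChartAt (𝓡 3) y).left_inv hu.2, fromChart_chg hq hu.2 V, fromChart_chg hq hu.2 W, ← hfd]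
  rfl

theorem formInChart_chg {n : ℕ} (η : DForm M n) {x y q : M}
    (hx : q ∈ (extChartAt (𝓡 3) x).source) (hy : q ∈ (extChartAt (𝓡 3) y).source) :
    ∀ᶠ u in 𝓝 (extChartAt (𝓡 3) x q), formInChart η x u =
      (formInChart η y (chg x y u)).compContinuousLinearMap (fderiv ℝ (chg x y) u) := by
  filter_upwards [eventually_mem_target_source hx hy] with u hu
  have hq := (extChartAt (𝓡 3) x).map_target hu.1
  have hfd := chg_fderiv hq hu.2
  rw [(extChartAt (𝓡 3) x).right_inv hu.1] at hfd
  ext v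
  simp only [formInChart, chg, comp_apply, ContinuousAlternatingMap.compContinuousLinearMap_apply]
  rw [(extChartAt (𝓡 3) y).left_inv hu.2]
  refine congrArg (η _) (funext fun i => ?_)
  simp only [comp_apply]
  rw [fromChart_chg hq hu.2 (v i), ← hfd]
  rfl

/-- The exterior derivative can be computed in any preferred chart. -/
theorem extD_eq {n : ℕ} (η : DForm M n) {y q : M} (hy : q ∈ (extChartAt (𝓡 3) y).source)
    (hη : DifferentiableAt ℝ (formInChart η y) (extChartAt (𝓡 3) y q)) :
    extD η q = ((extDeriv (formInChart η y) (extChartAt (𝓡 3) y q)).compContinuousLinearMap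
      (toChart y q) : E3 [⋀^Fin (n + 1)]→L[ℝ] ℝ) := by
  have hq : q ∈ (extChartAt (𝓡 3) q).source := mem_extChartAt_source q
  have hη' : DifferentiableAt ℝ (formInChart η y) (chg q y (extChartAt (𝓡 3) q q)) := by
    rwa [chg_apply hq]
  simp only [extD]
  -- By definition `extD` uses the chart at `q`; near `q` the expression there is the pullback of
  -- the one in the chart at `y`, and the exterior derivative commutes with pullbacks.
  rw [Filter.EventuallyEq.extDeriv_eq (formInChart_chg η hq hy),
    extDeriv_pullback hη' (chg_contDiffAt hq hy) (by
      rw [minSmoothness_of_isRCLikeNormedField]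
      exact ENat.LEInfty.out),
    chg_apply hq, chg_fderiv hq hy]
  rfl

/-- A vector field is `C^k` iff its expressions in preferred charts are. -/
theorem isCkField_iff {k : ℕ∞} {X : VField M} :
    IsCkField k X ↔ ∀ x : M, ContDiffOn ℝ k (fieldInChart X x) (extChartAt (𝓡 3) x).target := by
  have key : ∀ x : M, ContMDiffOn (𝓡 3) (𝓡 3).tangent k
      (fun q => (⟨q, X q⟩ : TangentBundle (𝓡 3) M)) (chartAt E3 x).source ↔
      ContDiffOn ℝ k (fieldInChart X x) (extChartAt (𝓡 3) x).target := by
    intro x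
    have h1 := (trivializationAt E3 (TangentSpace (𝓡 3) : M → Type _) x).contMDiffOn_section_iff
      (IB := 𝓡 3) (n := k) (s := X) (a := (chartAt E3 x).source) (chartAt E3 x).open_source
      (by rw [TangentBundle.trivializationAt_baseSet])
    refine h1.trans ?_
    rw [contMDiffOn_iff_of_subset_source' (x := x) (y := (0 : E3)) (by rw [extChartAt_source])
      (fun z _ => by
        rw [extChartAt_model_space_eq_id]; trivial)]
    rw [← extChartAt_source (𝓡 3), (extChartAt (𝓡 3) x).image_source_eq_target]
    refine contDiffOn_congr fun u hu => ?_
    simp only [comp_apply, fieldInChart, extChartAt_model_space_eq_id, PartialEquiv.refl_coe, id]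
    rfl
  refine ⟨fun h x => (key x).1 h.contMDiffOn, fun h q => ?_⟩
  exact ((key q).2 (h q)).contMDiffAt ((chartAt E3 q).open_source.mem_nhds (mem_chart_source E3 q))

end Charts

end Franks
-- Coordinate invariance of the covariant derivative.
namespace Franks

section Nabla

open Filter Topology

/-- The covariant derivative `G(∇_V Z, W)` at `u` of the vector field `Z` for the metric `G` on an
open set of `ℝ³`. -/
noncomputable def nablaIn (G : E3 → E3 →L[ℝ] E3 →L[ℝ] ℝ) (Z : E3 → E3) (u V W : E3) : ℝ :=
  G u (fderiv ℝ Z u V) W +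
    (fderiv ℝ G u (Z u) V W + fderiv ℝ G u V (Z u) W - fderiv ℝ G u W (Z u) V) / 2

/-- The product rule. The last two terms carry the second derivative of `ψ` and are responsible for
the inhomogeneous part of the transformation law of the Christoffel symbols. -/
theorem hasFDerivAt_pullback_metric {G : E3 → E3 →L[ℝ] E3 →L[ℝ] ℝ} {ψ : E3 → E3} {u : E3}
    (hψ : ContDiffAt ℝ 2 ψ u) (hG : DifferentiableAt ℝ G (ψ u)) (V W w : E3) :
    fderiv ℝ (fun v => G (ψ v) (fderiv ℝ ψ v V) (fderiv ℝ ψ v W)) u w =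
      fderiv ℝ G (ψ u) (fderiv ℝ ψ u w) (fderiv ℝ ψ u V) (fderiv ℝ ψ u W) +
      G (ψ u) (fderiv ℝ (fderiv ℝ ψ) u w V) (fderiv ℝ ψ u W) +
      G (ψ u) (fderiv ℝ ψ u V) (fderiv ℝ (fderiv ℝ ψ) u w W) := by
  have h1 : HasFDerivAt ψ (fderiv ℝ ψ u) u := (hψ.differentiableAt two_ne_zero).hasFDerivAt
  have h2 : HasFDerivAt (fderiv ℝ ψ) (fderiv ℝ (fderiv ℝ ψ) u) u :=
    ((hψ.fderiv_right (m := 1) (by norm_num)).differentiableAt one_ne_zero).hasFDerivAt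
  have h3 : HasFDerivAt (fun v => G (ψ v)) ((fderiv ℝ G (ψ u)).comp (fderiv ℝ ψ u)) u :=
    HasFDerivAt.comp (g := G) u hG.hasFDerivAt h1
  have h4 := ((h3.clm_apply (h2.clm_apply (hasFDerivAt_const V u))).clm_apply
    (h2.clm_apply (hasFDerivAt_const W u)))
  rw [h4.fderiv]
  simp
  ring

/-- The covariant derivative is covariant under changes of coordinates. -/
theorem nablaIn_pullback {G₁ G₂ : E3 → E3 →L[ℝ] E3 →L[ℝ] ℝ} {Z₁ Z₂ ψ : E3 → E3} {u : E3}
    (hψ : ContDiffAt ℝ 2 ψ u) (hG₂ : DifferentiableAt ℝ G₂ (ψ u)) (hG₁ : DifferentiableAt ℝ G₁ u)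
    (hsymm : ∀ V W, G₂ (ψ u) V W = G₂ (ψ u) W V)
    (hZ₁ : DifferentiableAt ℝ Z₁ u) (hZ₂ : DifferentiableAt ℝ Z₂ (ψ u))
    (hZ : ∀ᶠ v in 𝓝 u, Z₂ (ψ v) = fderiv ℝ ψ v (Z₁ v))
    (hG : ∀ V W, ∀ᶠ v in 𝓝 u, G₁ v V W = G₂ (ψ v) (fderiv ℝ ψ v V) (fderiv ℝ ψ v W))
    (V W : E3) :
    nablaIn G₁ Z₁ u V W = nablaIn G₂ Z₂ (ψ u) (fderiv ℝ ψ u V) (fderiv ℝ ψ u W) := by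
  have h1 : HasFDerivAt ψ (fderiv ℝ ψ u) u := (hψ.differentiableAt two_ne_zero).hasFDerivAt
  have h2 : HasFDerivAt (fderiv ℝ ψ) (fderiv ℝ (fderiv ℝ ψ) u) u :=
    ((hψ.fderiv_right (m := 1) (by norm_num)).differentiableAt one_ne_zero).hasFDerivAt
  have hS : ∀ a b, fderiv ℝ (fderiv ℝ ψ) u a b = fderiv ℝ (fderiv ℝ ψ) u b a := fun a b =>
    (hψ.isSymmSndFDerivAt (by rw [minSmoothness_of_isRCLikeNormedField])) a b
  have hDZ : ∀ w, fderiv ℝ Z₂ (ψ u) (fderiv ℝ ψ u w) =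
      fderiv ℝ (fderiv ℝ ψ) u w (Z₁ u) + fderiv ℝ ψ u (fderiv ℝ Z₁ u w) := by
    intro w
    have h5 : HasFDerivAt (fun v => Z₂ (ψ v)) ((fderiv ℝ Z₂ (ψ u)).comp (fderiv ℝ ψ u)) u :=
      HasFDerivAt.comp (g := Z₂) u hZ₂.hasFDerivAt h1
    have h6 := (h2.clm_apply hZ₁.hasFDerivAt).congr_of_eventuallyEq hZ
    have := congrArg (fun L => L w) (h5.unique h6)
    simpa [add_comm] using this
  have hDG : ∀ V W w, fderiv ℝ G₁ u w V W =
      fderiv ℝ G₂ (ψ u) (fderiv ℝ ψ u w) (fderiv ℝ ψ u V) (fderiv ℝ ψ u W) +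
      G₂ (ψ u) (fderiv ℝ (fderiv ℝ ψ) u w V) (fderiv ℝ ψ u W) +
      G₂ (ψ u) (fderiv ℝ ψ u V) (fderiv ℝ (fderiv ℝ ψ) u w W) := by
    intro V W w
    rw [← hasFDerivAt_pullback_metric hψ hG₂, ← Filter.EventuallyEq.fderiv_eq (hG V W)]
    have := (hG₁.hasFDerivAt.clm_apply (hasFDerivAt_const V u)).clm_apply (hasFDerivAt_const W u)
    rw [this.fderiv]
    simp
  simp only [nablaIn]
  rw [hDG V W, hDG (Z₁ u) W, hDG (Z₁ u) V, hDZ V, hZ.self_of_nhds, (hG _ _).self_of_nhds]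
  -- By symmetry of the second derivative of `ψ` and of the metric, the second-derivative terms of
  -- the Christoffel part cancel among themselves except for one, which is the term that
  -- differentiating `Dψ · Z₁` produces.
  rw [hS W (Z₁ u), hS V (Z₁ u), hS V W, map_add, add_apply,
    hsymm (fderiv ℝ ψ u V) (fderiv ℝ (fderiv ℝ ψ) u (Z₁ u) W)]
  ring

theorem nablaIn_add {G : E3 → E3 →L[ℝ] E3 →L[ℝ] ℝ} {Z Z' : E3 → E3} {u : E3}
    (hZ : DifferentiableAt ℝ Z u) (hZ' : DifferentiableAt ℝ Z' u) (V W : E3) :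
    nablaIn G (Z + Z') u V W = nablaIn G Z u V W + nablaIn G Z' u V W := by
  simp only [nablaIn, fderiv_add hZ hZ', add_apply, map_add, Pi.add_apply]
  ring

theorem nablaIn_neg {G : E3 → E3 →L[ℝ] E3 →L[ℝ] ℝ} {Z : E3 → E3} {u : E3} (V W : E3) :
    nablaIn G (-Z) u V W = - nablaIn G Z u V W := by
  simp only [nablaIn, fderiv_neg, neg_apply, map_neg, Pi.neg_apply]
  ring

variable {M : Type*} [TopologicalSpace M] [ChartedSpace E3 M] [IsManifold (𝓡 3) ∞ M]

/-- The metric in the preferred chart at `x`, as a bilinear form. -/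
noncomputable def metricForm (g : RMetric M) (x : M) (u : E3) : E3 →L[ℝ] E3 →L[ℝ] ℝ :=
  let q : M := (extChartAt (𝓡 3) x).symm u
  let b : E3 →L[ℝ] E3 →L[ℝ] ℝ := g.inner q
  let c : E3 →L[ℝ] E3 := fromChart x q
  b.bilinearComp c c

theorem metricForm_apply (g : RMetric M) (x : M) (u V W : E3) :
    metricForm g x u V W = metricInChart g x V W u := rfl

theorem metricForm_symm (g : RMetric M) (x : M) (u V W : E3) :
    metricForm g x u V W = metricForm g x u W V := g.symm _ _ _

theorem metricForm_toChart (g : RMetric M) {y q : M} (hy : q ∈ (extChartAt (𝓡 3) y).source)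
    (V W : TangentSpace (𝓡 3) q) :
    metricForm g y (extChartAt (𝓡 3) y q) (toChart y q V) (toChart y q W) = g.inner q V W := by
  rw [metricForm_apply, metricInChart, (extChartAt (𝓡 3) y).left_inv hy, fromChart_toChart hy,
    fromChart_toChart hy]

/-- Constant coordinate fields are smooth. -/
theorem contMDiffOn_fromChart (x : M) (V : E3) :
    ContMDiffOn (𝓡 3) (𝓡 3).tangent ∞
      (fun q => (⟨q, fromChart x q V⟩ : TangentBundle (𝓡 3) M)) (extChartAt (𝓡 3) x).source := by
  have h1 := (trivializationAt E3 (TangentSpace (𝓡 3) : M → Type _) x).contMDiffOn_section_iff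
    (IB := 𝓡 3) (n := ∞) (s := fun q => fromChart x q V) (a := (extChartAt (𝓡 3) x).source)
    (isOpen_extChartAt_source x) (by rw [TangentBundle.trivializationAt_baseSet, extChartAt_source])
  refine h1.2 ((contMDiffOn_const (c := V)).congr fun q hq => ?_)
  exact toChart_fromChart hq V

theorem contDiffOn_metricForm (g : RMetric M) (x : M) :
    ContDiffOn ℝ ∞ (metricForm g x) (extChartAt (𝓡 3) x).target := by
  refine contDiffOn_clm_apply.2 fun V => contDiffOn_clm_apply.2 fun W => ?_
  have h1 : ContMDiffOn (𝓡 3) ((𝓡 3).prod 𝓘(ℝ)) ∞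
      (fun m => Bundle.TotalSpace.mk' ℝ (E := Bundle.Trivial M ℝ) m
        (g.inner m (fromChart x m V) (fromChart x m W))) (extChartAt (𝓡 3) x).source :=
    ContMDiffOn.clm_bundle_apply₂ (F₁ := E3) (F₂ := E3) g.contMDiff.contMDiffOn
      (contMDiffOn_fromChart x V) (contMDiffOn_fromChart x W)
  have h2 : ContMDiffOn (𝓡 3) 𝓘(ℝ) ∞
      (fun m => g.inner m (fromChart x m V) (fromChart x m W)) (extChartAt (𝓡 3) x).source := by
    intro q hq
    have := h1 q hq
    simp only [Bundle.contMDiffWithinAt_totalSpace] at this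
    exact this.2
  have h3 := h2.comp (contMDiffOn_extChartAt_symm (I := 𝓡 3) (n := ∞) x)
    (fun u hu => (extChartAt (𝓡 3) x).map_target hu)
  exact contMDiffOn_iff_contDiffOn.1 h3

theorem differentiableAt_metricForm (g : RMetric M) {x q : M}
    (hx : q ∈ (extChartAt (𝓡 3) x).source) :
    DifferentiableAt ℝ (metricForm g x) (extChartAt (𝓡 3) x q) :=
  ((contDiffOn_metricForm g x).contDiffAt ((isOpen_extChartAt_target x).mem_nhds
    ((extChartAt (𝓡 3) x).map_source hx))).differentiableAt (by simp)

/-- A `C^k` field with `1 ≤ k` is differentiable in charts. -/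
theorem IsCkField.differentiableAt {k : ℕ∞} {X : VField M} (hX : IsCkField k X) (hk : 1 ≤ k)
    {x q : M} (hx : q ∈ (extChartAt (𝓡 3) x).source) :
    DifferentiableAt ℝ (fieldInChart X x) (extChartAt (𝓡 3) x q) :=
  ((isCkField_iff.1 hX x).contDiffAt ((isOpen_extChartAt_target x).mem_nhds
    ((extChartAt (𝓡 3) x).map_source hx))).differentiableAt (by
      have : (1 : ℕ∞) ≤ k := hk
      rintro h
      simp only [WithTop.coe_eq_zero] at h
      simp [h] at this)

theorem nablaInner_eq (g : RMetric M) (X : VField M) (x : M) (V W : E3) :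
    nablaInner g X x V W =
      nablaIn (metricForm g x) (fieldInChart X x) (extChartAt (𝓡 3) x x) V W := by
  have hx : x ∈ (extChartAt (𝓡 3) x).source := mem_extChartAt_source x
  have hG := differentiableAt_metricForm g hx
  have hX : fieldInChart X x (extChartAt (𝓡 3) x x) = X x := by
    rw [fieldInChart_apply X hx, toChart_self]
  have hD : ∀ V W w : E3, fderiv ℝ (metricInChart g x V W) (extChartAt (𝓡 3) x x) w =
      fderiv ℝ (metricForm g x) (extChartAt (𝓡 3) x x) w V W := by
    intro V W w
    have := (hG.hasFDerivAt.clm_apply (hasFDerivAt_const V _)).clm_apply (hasFDerivAt_const W _)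
    have h2 : metricInChart g x V W = fun v => metricForm g x v V W := rfl
    rw [h2, this.fderiv]
    simp
  have hg : ∀ V W : E3, metricForm g x (extChartAt (𝓡 3) x x) V W = g.inner x V W := by
    intro V W
    have := metricForm_toChart g hx V W
    rwa [show (toChart x x V : E3) = V from toChart_self x V,
      show (toChart x x W : E3) = W from toChart_self x W] at this
  obtain ⟨Z, hZ⟩ : ∃ Z : E3, Z = X x := ⟨_, rfl⟩
  rw [← hZ] at hX
  simp only [nablaIn]
  rw [hX, hg, ← hD, ← hD, ← hD, hZ]
  rfl

/-- The covariant derivative can be computed in any preferred chart. -/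
theorem nablaInner_eq_chart {g : RMetric M} {X : VField M} {k : ℕ∞} (hX : IsCkField k X)
    (hk : 1 ≤ k) {x y : M} (hy : x ∈ (extChartAt (𝓡 3) y).source) (V W : TangentSpace (𝓡 3) x) :
    nablaInner g X x V W =
      nablaIn (metricForm g y) (fieldInChart X y) (extChartAt (𝓡 3) y x)
        (toChart y x V) (toChart y x W) := by
  have hx : x ∈ (extChartAt (𝓡 3) x).source := mem_extChartAt_source x
  have hc : ContDiffAt ℝ 2 (chg x y) (extChartAt (𝓡 3) x x) :=
    (chg_contDiffAt hx hy).of_le ENat.LEInfty.out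
  have hG : DifferentiableAt ℝ (metricForm g y) (chg x y (extChartAt (𝓡 3) x x)) := by
    rw [chg_apply hx]; exact differentiableAt_metricForm g hy
  have hZ : DifferentiableAt ℝ (fieldInChart X y) (chg x y (extChartAt (𝓡 3) x x)) := by
    rw [chg_apply hx]; exact hX.differentiableAt hk hy
  have key : ∀ V W : E3, nablaInner g X x V W =
      nablaIn (metricForm g y) (fieldInChart X y) (extChartAt (𝓡 3) y x)
        (tangentCoordChange (𝓡 3) x y x V) (tangentCoordChange (𝓡 3) x y x W) := by
    intro V W
    rw [nablaInner_eq, nablaIn_pullback hc hG (differentiableAt_metricForm g hx)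
      (metricForm_symm g y _) (hX.differentiableAt hk hx) hZ (fieldInChart_chg_eventually X hx hy)
      (fun V W => metricInChart_chg g hx hy V W), chg_apply hx, chg_fderiv hx hy]
  exact key V W

theorem nablaInner_add {g : RMetric M} {X Y : VField M} {k : ℕ∞} (hX : IsCkField k X)
    (hY : IsCkField k Y) (hk : 1 ≤ k) (x : M) (V W : TangentSpace (𝓡 3) x) :
    nablaInner g (X + Y) x V W = nablaInner g X x V W + nablaInner g Y x V W := by
  have hx : x ∈ (extChartAt (𝓡 3) x).source := mem_extChartAt_source x
  have key : ∀ V W : E3,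
      nablaInner g (X + Y) x V W = nablaInner g X x V W + nablaInner g Y x V W := by
    intro V W
    rw [nablaInner_eq, nablaInner_eq, nablaInner_eq,
      ← nablaIn_add (hX.differentiableAt hk hx) (hY.differentiableAt hk hx)]
    congr 1
    funext u
    exact map_add (toChart x _) _ _
  exact key V W

theorem nablaInner_neg {g : RMetric M} {X : VField M} (x : M) (V W : TangentSpace (𝓡 3) x) :
    nablaInner g (-X) x V W = - nablaInner g X x V W := by
  have key : ∀ V W : E3, nablaInner g (-X) x V W = - nablaInner g X x V W := by
    intro V W
    rw [nablaInner_eq, nablaInner_eq, ← nablaIn_neg]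
    congr 1
    funext u
    exact map_neg (toChart x _) _
  exact key V W

/-- The covariant derivative of a vector field vanishes where the field vanishes identically. -/
theorem nablaInner_eq_zero {g : RMetric M} {X : VField M} {x : M}
    (h : ∀ᶠ q in 𝓝 x, X q = 0) (V W : TangentSpace (𝓡 3) x) : nablaInner g X x V W = 0 := by
  have hx : x ∈ (extChartAt (𝓡 3) x).source := mem_extChartAt_source x
  have h0 : fieldInChart X x =ᶠ[𝓝 (extChartAt (𝓡 3) x x)] fun _ => 0 := by
    have hc := chg_continuousAt_symm ((extChartAt (𝓡 3) x).map_source hx)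
    have : ∀ᶠ u in 𝓝 (extChartAt (𝓡 3) x x), X ((extChartAt (𝓡 3) x).symm u) = 0 :=
      hc.eventually (by rw [(extChartAt (𝓡 3) x).left_inv hx]; exact h)
    filter_upwards [this] with u hu
    simp only [fieldInChart, hu, map_zero]
  have key : ∀ V W : E3, nablaInner g X x V W = 0 := by
    intro V W
    rw [nablaInner_eq, nablaIn, h0.fderiv_eq, h0.self_of_nhds]
    simp
  exact key V W

end Nabla

end Franks
-- Global flow of a `C¹` field on a closed manifold and the variational equation.
namespace Franks

section Flow

open Filter Topology

variable {M : Type*} [TopologicalSpace M] [ChartedSpace E3 M] [IsManifold (𝓡 3) ∞ M]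

theorem hasMFDerivAt_of_hasDerivAt_chart {γ : ℝ → M} {t : ℝ} {x : M}
    (hx : γ t ∈ (extChartAt (𝓡 3) x).source) (hc : ContinuousAt γ t) {w : E3}
    (h : HasDerivAt (fun s => extChartAt (𝓡 3) x (γ s)) w t) :
    HasMFDerivAt 𝓘(ℝ) (𝓡 3) γ t ((1 : ℝ →L[ℝ] ℝ).smulRight (fromChart x (γ t) w)) := by
  refine ⟨hc, ?_⟩
  have h1 := (chg_hasFDerivAt hx (mem_extChartAt_source (I := 𝓡 3) (γ t))).comp_hasDerivAt t h
  have h2 : HasDerivAt (fun s => extChartAt (𝓡 3) (γ t) (γ s)) (fromChart x (γ t) w : E3) t := by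
    refine h1.congr_of_eventuallyEq ?_
    filter_upwards [hc.preimage_mem_nhds ((isOpen_extChartAt_source x).mem_nhds hx)] with s hs
    exact (chg_apply hs).symm
  have h3 := h2.hasFDerivAt.hasFDerivWithinAt (s := range 𝓘(ℝ))
  simp only [writtenInExtChartAt, extChartAt_model_space_eq_id]
  exact h3

theorem hasDerivAt_chart_of_hasMFDerivAt {γ : ℝ → M} {t : ℝ} {x : M}
    (hx : γ t ∈ (extChartAt (𝓡 3) x).source) {v : TangentSpace (𝓡 3) (γ t)}
    (h : HasMFDerivAt 𝓘(ℝ) (𝓡 3) γ t ((1 : ℝ →L[ℝ] ℝ).smulRight v)) :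
    HasDerivAt (fun s => extChartAt (𝓡 3) x (γ s)) (toChart x (γ t) v) t := by
  have hc : ContinuousAt γ t := h.1
  have h2 := h.2
  simp only [writtenInExtChartAt, extChartAt_model_space_eq_id, modelWithCornersSelf_coe,
    range_id] at h2
  have h3 : HasDerivAt (fun s => extChartAt (𝓡 3) (γ t) (γ s)) (v : E3) t := by
    obtain ⟨w, hw⟩ : ∃ w : E3, w = v := ⟨_, rfl⟩
    have h4 : HasFDerivAt (fun s => extChartAt (𝓡 3) (γ t) (γ s))
      ((1 : ℝ →L[ℝ] ℝ).smulRight w) t := by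
      rw [hw]
      exact hasFDerivWithinAt_univ.1 h2
    have h5 := h4.hasDerivAt
    rw [ContinuousLinearMap.smulRight_apply, one_apply_eq_self, one_smul, hw] at h5
    exact h5
  have hs := mem_extChartAt_source (I := 𝓡 3) (γ t)
  refine ((chg_hasFDerivAt hs hx).comp_hasDerivAt t h3).congr_of_eventuallyEq ?_
  filter_upwards [hc.preimage_mem_nhds ((isOpen_extChartAt_source (γ t)).mem_nhds hs)] with s hs
  exact (chg_apply hs).symm

theorem hasMFDerivAt_of_chart {f : M → M} {q x y : M} (hx : q ∈ (extChartAt (𝓡 3) x).source)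
    (hy : f q ∈ (extChartAt (𝓡 3) y).source) (hc : ContinuousAt f q) {R : E3 →L[ℝ] E3}
    (h : HasFDerivAt (fun u => extChartAt (𝓡 3) y (f ((extChartAt (𝓡 3) x).symm u))) R
      (extChartAt (𝓡 3) x q)) :
    HasMFDerivAt (𝓡 3) (𝓡 3) f q ((fromChart y (f q)).comp (R.comp (toChart x q))) := by
  refine ⟨hc, ?_⟩
  have hq := mem_extChartAt_source (I := 𝓡 3) q
  have hfq := mem_extChartAt_source (I := 𝓡 3) (f q)
  refine HasFDerivAt.hasFDerivWithinAt ?_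
  have h1 := chg_hasFDerivAt hq hx
  rw [← chg_apply (y := x) hq] at h
  have h2 := h.comp (extChartAt (𝓡 3) q q) h1
  have h3 := chg_hasFDerivAt hy hfq
  have h4 : extChartAt (𝓡 3) y (f q) = ((fun u => extChartAt (𝓡 3) y
      (f ((extChartAt (𝓡 3) x).symm u))) ∘ chg q x) (extChartAt (𝓡 3) q q) := by
    simp only [comp_apply, chg_apply hq, (extChartAt (𝓡 3) x).left_inv hx]
  rw [h4] at h3
  have h5 := h3.comp (extChartAt (𝓡 3) q q) h2
  refine h5.congr_of_eventuallyEq ?_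
  have hsymm := chg_continuousAt_symm ((extChartAt (𝓡 3) q).map_source hq)
  have hc' : ContinuousAt (fun u => f ((extChartAt (𝓡 3) q).symm u)) (extChartAt (𝓡 3) q q) :=
    ContinuousAt.comp (g := f) (by rwa [(extChartAt (𝓡 3) q).left_inv hq]) hsymm
  filter_upwards [eventually_mem_target_source hq hx, hc'.preimage_mem_nhds
    ((isOpen_extChartAt_source y).mem_nhds
      (by simpa only [(extChartAt (𝓡 3) q).left_inv hq] using hy))] with u hu hu2
  have hu2' : f ((extChartAt (𝓡 3) q).symm u) ∈ (extChartAt (𝓡 3) y).source := hu2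
  simp only [writtenInExtChartAt, comp_apply]
  rw [show chg q x u = extChartAt (𝓡 3) x ((extChartAt (𝓡 3) q).symm u) from rfl,
    (extChartAt (𝓡 3) x).left_inv hu.2, chg_apply hu2']

/-- The local flow of a `C¹` field on a manifold, its differentiability in the initial condition,
and its linearization at time `0`. -/
theorem exists_localFlow {k : ℕ∞} {Y : VField M} (hY : IsCkField k Y) (hk : 1 ≤ k) {x q₀ : M}
    (hq₀ : q₀ ∈ (extChartAt (𝓡 3) x).source) :
    ∃ N ∈ 𝓝 q₀, ∃ ε > 0, ∃ β : M → ℝ → M, (∀ q ∈ N, β q 0 = q ∧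
      IsMIntegralCurveOn (β q) Y (Ioo (-ε) ε) ∧
      ∀ t ∈ Ioo (-ε) ε, β q t ∈ (extChartAt (𝓡 3) x).source ∧
        MDifferentiableAt (𝓡 3) (𝓡 3) (fun q => β q t) q) ∧
      ∃ R : ℝ → E3 →L[ℝ] E3, (∀ t ∈ Ioo (-ε) ε, HasFDerivAt
        (fun u => extChartAt (𝓡 3) x (β ((extChartAt (𝓡 3) x).symm u) t)) (R t)
          (extChartAt (𝓡 3) x q₀)) ∧
        HasDerivAt R (fderiv ℝ (fieldInChart Y x) (extChartAt (𝓡 3) x q₀)) 0 := by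
  have hu₀ := (extChartAt (𝓡 3) x).map_source hq₀
  have htar := (isOpen_extChartAt_target (I := 𝓡 3) x).mem_nhds hu₀
  have hf : ContDiffAt ℝ 1 (fieldInChart Y x) (extChartAt (𝓡 3) x q₀) :=
    ((isCkField_iff.1 hY x).contDiffAt htar).of_le (by exact_mod_cast hk)
  obtain ⟨r, hr, ε, hε, α, hα, hR⟩ := exists_localFlow_hasFDerivAt hf htar
  set e := extChartAt (𝓡 3) x with he
  set N : Set M := e.source ∩ e ⁻¹' Metric.ball (e q₀) r with hN
  have hNo : IsOpen N := (continuousOn_extChartAt (I := 𝓡 3) x).isOpen_inter_preimage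
    (isOpen_extChartAt_source x) Metric.isOpen_ball
  have hβ : ∀ q ∈ N, ∀ t ∈ Ioo (-ε) ε, α (e q) t ∈ e.target := fun q hq t ht =>
    ((hα (e q) (Metric.ball_subset_closedBall hq.2)).2 t ht).2
  have hchart : ∀ t ∈ Ioo (-ε) ε, ∀ u ∈ e.target, u ∈ Metric.ball (e q₀) r →
      e (e.symm (α (e (e.symm u)) t)) = α u t := by
    intro t ht u hu hur
    rw [e.right_inv hu, e.right_inv]
    exact ((hα u (Metric.ball_subset_closedBall hur)).2 t ht).2
  have hchart' : ∀ t ∈ Ioo (-ε) ε, ∀ u ∈ e.target, u ∈ Metric.ball (e q₀) r →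
      (fun u => e (e.symm (α (e (e.symm u)) t))) =ᶠ[𝓝 u] fun u => α u t := by
    intro t ht u hu hur
    filter_upwards [(isOpen_extChartAt_target (I := 𝓡 3) x).mem_nhds hu,
      Metric.isOpen_ball.mem_nhds hur] with v hv hvr using hchart t ht v hv hvr
  refine ⟨N, hNo.mem_nhds ⟨hq₀, Metric.mem_ball_self hr⟩, ε, hε,
    fun q t => e.symm (α (e q) t), fun q hq => ⟨?_, ?_, fun t ht => ⟨?_, ?_⟩⟩, ?_⟩
  · change e.symm (α (e q) 0) = q
    rw [(hα (e q) (Metric.ball_subset_closedBall hq.2)).1, e.left_inv hq.1]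
  · intro t ht
    have h1 := ((hα (e q) (Metric.ball_subset_closedBall hq.2)).2 t ht).1
    have hsrc : e.symm (α (e q) t) ∈ e.source := e.map_target (hβ q hq t ht)
    have hc : ContinuousAt (fun s => e.symm (α (e q) s)) t :=
      ContinuousAt.comp (g := e.symm) (chg_continuousAt_symm (hβ q hq t ht)) h1.continuousAt
    have h2 : HasDerivAt (fun s => e (e.symm (α (e q) s))) (fieldInChart Y x (α (e q) t)) t := by
      refine h1.congr_of_eventuallyEq ?_
      filter_upwards [Ioo_mem_nhds ht.1 ht.2] with s hs using e.right_inv (hβ q hq s hs)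
    have h3 := hasMFDerivAt_of_hasDerivAt_chart hsrc hc h2
    rw [fieldInChart, fromChart_toChart hsrc] at h3
    exact h3.hasMFDerivWithinAt
  · exact e.map_target (hβ q hq t ht)
  · obtain ⟨R, hR, -⟩ := hR (e q) hq.2
    have h1 := hR t ht
    have hsrc : e.symm (α (e q) t) ∈ e.source := e.map_target (hβ q hq t ht)
    refine (hasMFDerivAt_of_chart (f := fun q => e.symm (α (e q) t)) hq.1 hsrc ?_
      (h1.congr_of_eventuallyEq (hchart' t ht _ (e.map_source hq.1) hq.2))).mdifferentiableAt
    have hc1 : ContinuousAt (fun q => α (e q) t) q :=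
      ContinuousAt.comp (f := e) (g := fun u => α u t) h1.continuousAt
        ((continuousOn_extChartAt (I := 𝓡 3) x).continuousAt
          ((isOpen_extChartAt_source x).mem_nhds hq.1))
    exact ContinuousAt.comp (f := fun q => α (e q) t) (g := e.symm)
      (chg_continuousAt_symm (hβ q hq t ht)) hc1
  · obtain ⟨R, hR, hR'⟩ := hR (e q₀) (Metric.mem_ball_self hr)
    exact ⟨R, fun t ht => (hR t ht).congr_of_eventuallyEq
      (hchart' t ht _ hu₀ (Metric.mem_ball_self hr)), hR'⟩

theorem isCkField_one {k : ℕ∞} {Y : VField M} (hY : IsCkField k Y) (hk : 1 ≤ k) :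
    ContMDiff (𝓡 3) (𝓡 3).tangent 1 (fun q => (⟨q, Y q⟩ : TangentBundle (𝓡 3) M)) :=
  ContMDiff.of_le hY (by exact_mod_cast hk)

/-- The data of a local flow, uniform over a compact manifold. -/
theorem exists_uniform_localFlow [CompactSpace M] {k : ℕ∞} {Y : VField M} (hY : IsCkField k Y)
    (hk : 1 ≤ k) : ∃ ε > 0, ∀ q : M, ∃ N ∈ 𝓝 q, ∃ β : M → ℝ → M, (∀ q ∈ N, β q 0 = q ∧
      IsMIntegralCurveOn (β q) Y (Ioo (-ε) ε) ∧
      ∀ t ∈ Ioo (-ε) ε, MDifferentiableAt (𝓡 3) (𝓡 3) (fun q => β q t) q) := by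
  choose N hN ε hε β hβ _ using
    fun q : M => exists_localFlow hY hk (mem_extChartAt_source (I := 𝓡 3) q)
  obtain ⟨s, hs⟩ := isCompact_univ.elim_nhds_subcover (fun q => interior (N q))
    (fun q _ => interior_mem_nhds.2 (hN q))
  rcases isEmpty_or_nonempty M with hM | ⟨⟨q₁⟩⟩
  · exact ⟨1, one_pos, fun q => hM.elim q⟩
  have hsne : s.Nonempty := by
    obtain ⟨i, hi, -⟩ := mem_iUnion₂.1 (hs.2 (mem_univ q₁))
    exact ⟨i, hi⟩
  refine ⟨s.inf' hsne ε, (Finset.lt_inf'_iff hsne).2 fun i _ => hε i, fun q => ?_⟩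
  obtain ⟨i, hi, hqi⟩ := mem_iUnion₂.1 (hs.2 (mem_univ q))
  have hle : s.inf' hsne ε ≤ ε i := Finset.inf'_le _ hi
  have hsub : Ioo (-(s.inf' hsne ε)) (s.inf' hsne ε) ⊆ Ioo (-ε i) (ε i) :=
    Ioo_subset_Ioo (neg_le_neg hle) hle
  exact ⟨N i, mem_interior_iff_mem_nhds.1 hqi, β i, fun q' hq' => ⟨(hβ i q' hq').1,
    (hβ i q' hq').2.1.mono hsub, fun t ht => ((hβ i q' hq').2.2 t (hsub ht)).2⟩⟩

variable [T2Space M]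

/-- A `C¹` vector field on a closed manifold has a flow. -/
theorem exists_isFlow [CompactSpace M] {k : ℕ∞} {Y : VField M} (hY : IsCkField k Y)
    (hk : 1 ≤ k) : ∃ ψ : ℝ → M → M, IsFlow Y ψ := by
  obtain ⟨ε, hε, h⟩ := exists_uniform_localFlow hY hk
  have h' : ∀ x : M, ∃ γ : ℝ → M, γ 0 = x ∧ IsMIntegralCurve γ Y :=
    exists_isMIntegralCurve_of_isMIntegralCurveOn (isCkField_one hY hk) hε fun x => by
      obtain ⟨N, hN, β, hβ⟩ := h x
      have := hβ x (mem_of_mem_nhds hN)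
      exact ⟨β x, this.1, this.2.1⟩
  choose γ hγ using h'
  exact ⟨fun t q => γ q t, hγ⟩

theorem IsFlow.add {k : ℕ∞} {Y : VField M} (hY : IsCkField k Y) (hk : 1 ≤ k) {ψ : ℝ → M → M}
    (hψ : IsFlow Y ψ) (s t : ℝ) (q : M) : ψ (s + t) q = ψ s (ψ t q) := by
  have h1 : IsMIntegralCurve (fun s => ψ (s + t) q) Y := (hψ q).2.comp_add t
  have := isMIntegralCurve_Ioo_eq_of_contMDiff_boundaryless (t₀ := 0) (isCkField_one hY hk) h1
    (hψ (ψ t q)).2 (by simp [(hψ (ψ t q)).1])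
  exact congrFun this s

theorem IsFlow.eq_local {k : ℕ∞} {Y : VField M} (hY : IsCkField k Y) (hk : 1 ≤ k) {ψ : ℝ → M → M}
    (hψ : IsFlow Y ψ) {q : M} {ε : ℝ} (hε : 0 < ε) {γ : ℝ → M} (h0 : γ 0 = q)
    (hγ : IsMIntegralCurveOn γ Y (Ioo (-ε) ε)) {t : ℝ} (ht : t ∈ Ioo (-ε) ε) : ψ t q = γ t :=
  isMIntegralCurveOn_Ioo_eqOn_of_contMDiff_boundaryless (γ := fun t => ψ t q) (t₀ := 0)
    ⟨by linarith, hε⟩ (isCkField_one hY hk) ((hψ q).2.isMIntegralCurveOn _) hγ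
    (by rw [h0]; exact (hψ q).1) ht

/-- The flow is differentiable in the initial condition. -/
theorem IsFlow.mdifferentiableAt [CompactSpace M] {k : ℕ∞} {Y : VField M} (hY : IsCkField k Y)
    (hk : 1 ≤ k) {ψ : ℝ → M → M} (hψ : IsFlow Y ψ) (t : ℝ) (q : M) :
    MDifferentiableAt (𝓡 3) (𝓡 3) (ψ t) q := by
  obtain ⟨ε, hε, h⟩ := exists_uniform_localFlow hY hk
  have hsmall : ∀ s ∈ Ioo (-ε) ε, ∀ q, MDifferentiableAt (𝓡 3) (𝓡 3) (ψ s) q := by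
    intro s hs q
    obtain ⟨N, hN, β, hβ⟩ := h q
    refine ((hβ q (mem_of_mem_nhds hN)).2.2 s hs).congr_of_eventuallyEq ?_
    filter_upwards [hN] with q' hq'
    exact hψ.eq_local hY hk hε (hβ q' hq').1 (hβ q' hq').2.1 hs
  -- The time `t` is cut into `n` steps shorter than the uniform existence time, and the time-`t`
  -- map is the composition of the `n` short ones.
  obtain ⟨n, hn⟩ := exists_nat_gt (|t| / ε)
  have hn0 : (0 : ℝ) < n := lt_of_le_of_lt (by positivity) hn
  have hs : t / n ∈ Ioo (-ε) ε := by
    refine abs_lt.1 ?_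
    rw [abs_div, Nat.abs_cast, div_lt_iff₀ hn0]
    rw [div_lt_iff₀ hε] at hn
    linarith
  have key : ∀ m : ℕ, MDifferentiableAt (𝓡 3) (𝓡 3) (ψ (m * (t / n))) q := by
    intro m
    induction m with
    | zero =>
      have : ψ ((0 : ℕ) * (t / n)) = id := by
        funext q; simpa using (hψ q).1
      rw [this]; exact mdifferentiableAt_id
    | succ m ih =>
      have : ψ ((m + 1 : ℕ) * (t / n)) = ψ (t / n) ∘ ψ (m * (t / n)) := by
        funext q
        rw [comp_apply, ← hψ.add hY hk]
        congr 1; push_cast; ring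
      rw [this]
      exact (hsmall _ hs _).comp q ih
  have := key n
  rwa [mul_div_cancel₀ _ hn0.ne'] at this

/-- The variational equation: the differential of the flow, in a chart, solves the linearized
equation. -/
theorem IsFlow.hasDerivAt_mfderiv [CompactSpace M] {k : ℕ∞} {Y : VField M} (hY : IsCkField k Y)
    (hk : 1 ≤ k) {ψ : ℝ → M → M} (hψ : IsFlow Y ψ) (p : M) (v : TangentSpace (𝓡 3) p) (t₀ : ℝ)
    {x : M} (hx : ψ t₀ p ∈ (extChartAt (𝓡 3) x).source) :
    HasDerivAt (fun t => (toChart x (ψ t p) (mfderiv (𝓡 3) (𝓡 3) (ψ t) p v) : E3))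
      (fderiv ℝ (fieldInChart Y x) (extChartAt (𝓡 3) x (ψ t₀ p))
        (toChart x (ψ t₀ p) (mfderiv (𝓡 3) (𝓡 3) (ψ t₀) p v))) t₀ := by
  obtain ⟨N, hN, ε, hε, β, hβ, R, hR, hR'⟩ := exists_localFlow hY hk hx
  have hψβ : ∀ q ∈ N, ∀ s ∈ Ioo (-ε) ε, ψ s q = β q s := fun q hq s hs =>
    hψ.eq_local hY hk hε (hβ q hq).1 (hβ q hq).2.1 hs
  have hNx := mem_of_mem_nhds hN
  -- Since `ψ t = ψ (t - t₀) ∘ ψ t₀`, the differential at times near `t₀` is that of the local flow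
  -- at small times applied to a fixed vector. Only the derivative of `R` at time `0` is needed.
  have key : ∀ s ∈ Ioo (-ε) ε, ∀ f : M → M, f = ψ s ∘ ψ t₀ →
      (toChart x (f p) (mfderiv (𝓡 3) (𝓡 3) f p v) : E3) =
        R s (toChart x (ψ t₀ p) (mfderiv (𝓡 3) (𝓡 3) (ψ t₀) p v)) := by
    rintro s hs f rfl
    have hsrc : ψ s (ψ t₀ p) ∈ (extChartAt (𝓡 3) x).source := by
      rw [hψβ _ hNx s hs]; exact ((hβ _ hNx).2.2 s hs).1
    have hev : (fun u => extChartAt (𝓡 3) x (ψ s ((extChartAt (𝓡 3) x).symm u)))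
        =ᶠ[𝓝 (extChartAt (𝓡 3) x (ψ t₀ p))]
        fun u => extChartAt (𝓡 3) x (β ((extChartAt (𝓡 3) x).symm u) s) := by
      have := (chg_continuousAt_symm ((extChartAt (𝓡 3) x).map_source hx)).preimage_mem_nhds
        (t := N) (by rwa [(extChartAt (𝓡 3) x).left_inv hx])
      filter_upwards [this] with u hu
      rw [hψβ _ hu s hs]
    have h1 := hasMFDerivAt_of_chart hx hsrc (hψ.mdifferentiableAt hY hk s _).continuousAt
      ((hR s hs).congr_of_eventuallyEq hev)
    have h2 := h1.comp p (hψ.mdifferentiableAt hY hk t₀ p).hasMFDerivAt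
    rw [h2.mfderiv]
    exact toChart_fromChart hsrc _
  have h3 : HasDerivAt (fun t => R (t - t₀)
      (toChart x (ψ t₀ p) (mfderiv (𝓡 3) (𝓡 3) (ψ t₀) p v)))
      (fderiv ℝ (fieldInChart Y x) (extChartAt (𝓡 3) x (ψ t₀ p))
        (toChart x (ψ t₀ p) (mfderiv (𝓡 3) (𝓡 3) (ψ t₀) p v))) t₀ := by
    have h4 : HasDerivAt (fun t => R (t - t₀))
        (fderiv ℝ (fieldInChart Y x) (extChartAt (𝓡 3) x (ψ t₀ p))) t₀ := by
      have := HasDerivAt.scomp (g₁ := R) (h := fun t => t - t₀) t₀ (by simpa using hR')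
        ((hasDerivAt_id t₀).sub_const t₀)
      simpa [Function.comp_def] using this
    simpa using h4.clm_apply (hasDerivAt_const t₀ _)
  refine h3.congr_of_eventuallyEq ?_
  filter_upwards [Ioo_mem_nhds (show t₀ - ε < t₀ by linarith) (show t₀ < t₀ + ε by linarith)]
    with t ht
  refine key (t - t₀) ⟨by linarith [ht.1], by linarith [ht.2]⟩ (ψ t) ?_
  funext q
  rw [comp_apply, ← hψ.add hY hk, sub_add_cancel]

end Flow

end Franks
-- Borel's lemma and extension of `C^k` functions from a compact interval.
namespace Franks

open Filter Topology

/-- The `k`-th derivative of `l⁻ⁿ P(l x)` carries the factor `l^(k-n)`, and `k < n` leaves at least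
one power of `l⁻¹`. The scale `l` is chosen to beat the bounds `B k` of all the lower derivatives at
once. -/
theorem borel_bound {c l : ℝ} {n k : ℕ} (hkn : k < n) (hl : 1 ≤ l) {B : ℕ → ℝ}
    (hlB : l = 1 + |c| * 2 ^ n * ∑ k ∈ Finset.range n, B k) (hB0 : ∀ k, 0 ≤ B k) {y : ℝ}
    (hy : 0 ≤ y) (hyB : y ≤ B k) :
    |c / n.factorial * l⁻¹ ^ n| * (l ^ k * y) ≤ (1 / 2) ^ n := by
  have hl0 : 0 < l := one_pos.trans_le hl
  have h2 : l⁻¹ ^ n * l ^ k ≤ l⁻¹ := by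
    have : l⁻¹ ^ n * l ^ k = l⁻¹ ^ (n - k) := by
      have : l⁻¹ ^ n = l⁻¹ ^ (n - k) * l⁻¹ ^ k := by rw [← pow_add]; congr 1; omega
      rw [this, mul_assoc, ← mul_pow, inv_mul_cancel₀ hl0.ne', one_pow, mul_one]
    rw [this]
    have h3 := pow_le_pow_of_le_one (inv_nonneg.2 hl0.le) (inv_le_one_of_one_le₀ hl)
      (show 1 ≤ n - k by omega)
    simpa using h3
  have h4 : |c / n.factorial| ≤ |c| := by
    rw [abs_div, Nat.abs_cast]
    exact div_le_self (abs_nonneg _) (by exact_mod_cast n.factorial_pos)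
  have h5 : B k ≤ ∑ k ∈ Finset.range n, B k :=
    Finset.single_le_sum (f := B) (fun k _ => hB0 k) (Finset.mem_range.2 hkn)
  rw [abs_mul, abs_of_nonneg (by positivity : 0 ≤ l⁻¹ ^ n)]
  calc |c / n.factorial| * l⁻¹ ^ n * (l ^ k * y)
      = |c / n.factorial| * (l⁻¹ ^ n * l ^ k) * y := by ring
    _ ≤ |c| * l⁻¹ * ∑ k ∈ Finset.range n, B k :=
        mul_le_mul (mul_le_mul h4 h2 (by positivity) (abs_nonneg _)) (hyB.trans h5) hy
          (by positivity)
    _ ≤ (1 / 2) ^ n := by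
        rw [mul_right_comm, ← div_eq_mul_inv, div_le_iff₀ hl0, one_div, inv_pow,
          inv_mul_eq_div, le_div_iff₀ (by positivity), hlB]
        linarith [mul_right_comm |c| (∑ k ∈ Finset.range n, B k) (2 ^ n)]

/-- The `n`-th term is the monomial `c n xⁿ / n!` cut off at a small scale `1 / l n`. It contributes
only to the jet of order `n`, and for each fixed order of differentiation all but finitely many
terms are bounded by a geometric series. -/
theorem exists_borel_terms (c : ℕ → ℝ) : ∃ f : ℕ → ℝ → ℝ, (∀ n, ContDiff ℝ ∞ (f n)) ∧
    (∀ n k, ∃ v, (∀ x, ‖iteratedFDeriv ℝ k (f n) x‖ ≤ v) ∧ (k < n → v = (1 / 2) ^ n)) ∧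
    ∀ n m, iteratedDeriv m (f n) 0 = if n = m then c m else 0 := by
  let χ : ContDiffBump (0 : ℝ) := ⟨1, 2, one_pos, one_lt_two⟩
  obtain ⟨P, hP, hPc, hP0⟩ : ∃ P : ℕ → ℝ → ℝ, (∀ n, ContDiff ℝ ∞ (P n)) ∧
      (∀ n, HasCompactSupport (P n)) ∧ ∀ n, P n =ᶠ[𝓝 0] fun x => x ^ n := by
    refine ⟨fun n x => x ^ n * χ x, fun n => (contDiff_id.pow n).mul χ.contDiff,
      fun n => χ.hasCompactSupport.mul_left, fun n => ?_⟩
    filter_upwards [χ.eventuallyEq_one] with x hx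
    simp only [hx]; simp
  have hB : ∀ n k, ∃ B, ∀ x, ‖iteratedDeriv k (P n) x‖ ≤ B := by
    intro n k
    have h1 : Continuous (iteratedFDeriv ℝ k (P n)) :=
      (hP n).continuous_iteratedFDeriv (by exact_mod_cast le_top)
    obtain ⟨B, hB⟩ := h1.bounded_above_of_compact_support ((hPc n).iteratedFDeriv k)
    exact ⟨B, fun x => by rw [← norm_iteratedFDeriv_eq_norm_iteratedDeriv]; exact hB x⟩
  choose B hB using hB
  have hB0 : ∀ n k, 0 ≤ B n k := fun n k => (norm_nonneg _).trans (hB n k 0)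
  obtain ⟨l, hlB⟩ : ∃ l : ℕ → ℝ, ∀ n, l n = 1 + |c n| * 2 ^ n * ∑ k ∈ Finset.range n, B n k :=
    ⟨_, fun _ => rfl⟩
  have hl : ∀ n, 1 ≤ l n := fun n => by
    have : 0 ≤ |c n| * 2 ^ n * ∑ k ∈ Finset.range n, B n k :=
      mul_nonneg (by positivity) (Finset.sum_nonneg fun k _ => hB0 n k)
    rw [hlB]; linarith
  let f : ℕ → ℝ → ℝ := fun n x => c n / n.factorial * (l n)⁻¹ ^ n * P n (l n * x)
  have hf : ∀ n, ContDiff ℝ ∞ (f n) := fun n =>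
    contDiff_const.mul ((hP n).comp (contDiff_const.mul contDiff_id))
  have hfd : ∀ n k x, iteratedDeriv k (f n) x =
      c n / n.factorial * (l n)⁻¹ ^ n * (l n ^ k * iteratedDeriv k (P n) (l n * x)) := by
    intro n k x
    have h1 := congrFun (iteratedDeriv_comp_const_mul (n := k)
      ((hP n).of_le (by exact_mod_cast le_top)) (l n)) x
    rw [iteratedDeriv_const_mul_field, h1]
  refine ⟨f, hf, fun n k => ?_, fun n m => ?_⟩
  · have hl0 : 0 < l n := one_pos.trans_le (hl n)
    refine ⟨if k < n then (1 / 2) ^ n else |c n / n.factorial * (l n)⁻¹ ^ n| * (l n ^ k * B n k),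
      fun x => ?_, fun h => if_pos h⟩
    rw [norm_iteratedFDeriv_eq_norm_iteratedDeriv, hfd, norm_mul, norm_mul (l n ^ k),
      Real.norm_eq_abs, Real.norm_of_nonneg (by positivity : 0 ≤ l n ^ k)]
    have h1 := hB n k (l n * x)
    split_ifs with hkn
    · exact borel_bound hkn (hl n) (hlB n) (hB0 n) (norm_nonneg _) h1
    · gcongr
  · rw [hfd, mul_zero, (hP0 n).iteratedDeriv_eq, iteratedDeriv_fun_pow_zero]
    have hl0 : 0 < l n := one_pos.trans_le (hl n)
    split_ifs with h2 h3 h3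
    · subst h3
      have : ((n.factorial : ℕ) : ℝ) ≠ 0 := Nat.cast_ne_zero.2 n.factorial_ne_zero
      rw [inv_pow]
      have h4 : l n ^ n ≠ 0 := pow_ne_zero _ hl0.ne'
      field_simp
    · exact absurd h2.symm h3
    · exact absurd h3.symm h2
    · simp

/-- Borel's lemma: a smooth function with prescribed jet at a point. -/
theorem exists_contDiff_iteratedDeriv_eq (c : ℕ → ℝ) (a : ℝ) :
    ∃ g : ℝ → ℝ, ContDiff ℝ ∞ g ∧ ∀ n, iteratedDeriv n g a = c n := by
  suffices H : ∃ g : ℝ → ℝ, ContDiff ℝ ∞ g ∧ ∀ n, iteratedDeriv n g 0 = c n by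
    obtain ⟨g, hg, hg'⟩ := H
    refine ⟨fun x => g (x - a), hg.comp (contDiff_id.sub contDiff_const), fun n => ?_⟩
    rw [iteratedDeriv_comp_sub_const]
    simpa using hg' n
  obtain ⟨f, hf, hfv, key⟩ := exists_borel_terms c
  choose v hfv hv using hfv
  have hfv' : ∀ k n x, ‖iteratedFDeriv ℝ k (f n) x‖ ≤ v n k := fun k n x => (hfv n k x)
  have hvs : ∀ k, Summable fun n => v n k := by
    intro k
    refine Summable.of_norm_bounded_eventually (g := fun n : ℕ => (1 / 2 : ℝ) ^ n)
      summable_geometric_two ?_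
    rw [Nat.cofinite_eq_atTop]
    filter_upwards [eventually_gt_atTop k] with n hn
    rw [hv n k hn]
    simp
  have h1 : ∀ k : ℕ, (k : ℕ∞) ≤ ⊤ → Summable fun n => v n k := fun k _ => hvs k
  have h2 : ∀ (k n : ℕ) (x : ℝ), (k : ℕ∞) ≤ ⊤ → ‖iteratedFDeriv ℝ k (f n) x‖ ≤ v n k :=
    fun k n x _ => hfv' k n x
  refine ⟨fun x => ∑' n, f n x, contDiff_tsum (v := fun k n => v n k) hf h1 h2, fun m => ?_⟩
  have h3 := iteratedFDeriv_tsum_apply (v := fun k n => v n k) hf h1 h2 (k := m) le_top 0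
  have h4 : Summable fun n => iteratedFDeriv ℝ m (f n) 0 :=
    Summable.of_norm_bounded (hvs m) fun n => hfv' m n 0
  rw [iteratedDeriv_eq_iteratedFDeriv, h3, ContinuousMultilinearMap.tsum_eval h4]
  have h5 : ∀ n, iteratedFDeriv ℝ m (f n) 0 (fun _ => 1) = if n = m then c m else 0 := fun n => by
    rw [← iteratedDeriv_eq_iteratedFDeriv, key n m]
  rw [tsum_congr h5, tsum_eq_single m fun n hn => if_neg hn, if_pos rfl]

/-- A function flat on the frontier stays differentiable when extended by zero, and the derivative
of the extension is the extension of the derivative, which is again flat; hence the induction on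
`n`. -/
theorem contDiff_indicator_nat {s : Set ℝ} (hs : IsClosed s) (hu : UniqueDiffOn ℝ s) (n : ℕ) :
    ∀ h : ℝ → ℝ, ContDiffOn ℝ n h s →
      (∀ x ∈ frontier s, ∀ m ≤ n, iteratedDerivWithin m h s x = 0) →
      ContDiff ℝ n (s.indicator h) := by
  induction n with
  | zero =>
    intro h hh h0
    refine contDiff_zero.2 (continuous_indicator (fun x hx => ?_) ?_)
    · simpa using h0 x hx 0 le_rfl
    · rw [hs.closure_eq]; exact hh.continuousOn
  | succ n ih =>
    intro h hh h0
    have hd := ih (derivWithin h s) (hh.derivWithin hu (by exact_mod_cast le_rfl)) fun x hx m hm => by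
      rw [← iteratedDerivWithin_succ']
      exact h0 x hx (m + 1) (by omega)
    have hfr : ∀ x ∈ frontier s, h x = 0 := fun x hx => by simpa using h0 x hx 0 (by omega)
    have hfr' : ∀ x ∈ frontier s, derivWithin h s x = 0 := fun x hx => by
      have := h0 x hx 1 (by omega)
      rwa [iteratedDerivWithin_one] at this
    have hder : ∀ x, HasDerivAt (s.indicator h) (s.indicator (derivWithin h s) x) x := by
      intro x
      rw [← hasDerivWithinAt_univ, ← union_compl_self s]
      refine HasDerivWithinAt.union ?_ ?_
      · by_cases hx : x ∈ s
        · rw [indicator_of_mem hx]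
          refine HasDerivWithinAt.congr ((hh.differentiableOn (by simp)) x hx).hasDerivWithinAt
            (fun y hy => indicator_of_mem hy _) (indicator_of_mem hx _)
        · exact HasFDerivWithinAt.of_notMem_closure (by rwa [hs.closure_eq])
      · by_cases hx : x ∈ closure sᶜ
        · have hz : s.indicator h x = 0 ∧ s.indicator (derivWithin h s) x = 0 := by
            by_cases hxs : x ∈ s
            · have : x ∈ frontier s := by
                rw [frontier_eq_closure_inter_closure, hs.closure_eq]; exact ⟨hxs, hx⟩
              rw [indicator_of_mem hxs, indicator_of_mem hxs]
              exact ⟨hfr x this, hfr' x this⟩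
            · simp [hxs]
          rw [hz.2]
          exact (hasDerivWithinAt_const x sᶜ (0 : ℝ)).congr
            (fun y hy => indicator_of_notMem hy _) hz.1
        · exact HasFDerivWithinAt.of_notMem_closure hx
    have : deriv (s.indicator h) = s.indicator (derivWithin h s) := funext fun x => (hder x).deriv
    push_cast
    refine contDiff_succ_iff_deriv.2 ⟨fun x => (hder x).differentiableAt, by simp, ?_⟩
    rw [this]; exact hd

/-- A `C^k` function on a compact interval extends to a `C^k` function on the line. -/
theorem exists_contDiff_extension {k : ℕ∞} {f : ℝ → ℝ} {a b : ℝ} (hab : a < b)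
    (hf : ContDiffOn ℝ k f (Icc a b)) :
    ∃ F : ℝ → ℝ, ContDiff ℝ k F ∧ EqOn F f (Icc a b) := by
  have hu := uniqueDiffOn_Icc hab
  -- All orders are prescribed, although beyond `k` the iterated derivatives of `f` may carry no
  -- information; only the orders up to `k` are used.
  obtain ⟨ga, hga, hga'⟩ := exists_contDiff_iteratedDeriv_eq
    (fun n => iteratedDerivWithin n f (Icc a b) a) a
  obtain ⟨gb, hgb, hgb'⟩ := exists_contDiff_iteratedDeriv_eq
    (fun n => iteratedDerivWithin n f (Icc a b) b) b
  -- `S` is `0` on the first third of the interval and `1` on the last, so `g` has the jets of `f`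
  -- at both ends. Then `f - g` is flat there and extends by zero.
  let S : ℝ → ℝ := fun x => Real.smoothTransition (3 * ((x - a) / (b - a)) - 1)
  have hS : ContDiff ℝ ∞ S := Real.smoothTransition.contDiff.comp (by fun_prop)
  let g : ℝ → ℝ := fun x => ga x + S x * (gb x - ga x)
  have hg : ContDiff ℝ ∞ g := hga.add (hS.mul (hgb.sub hga))
  have hga2 : g =ᶠ[𝓝 a] ga := by
    have h1 : ContinuousAt (fun x : ℝ => 3 * ((x - a) / (b - a)) - 1) a := by fun_prop
    have h2 : ∀ᶠ x in 𝓝 a, 3 * ((x - a) / (b - a)) - 1 < 0 :=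
      h1.eventually (Iio_mem_nhds (by simp))
    filter_upwards [h2] with x hx
    simp [g, S, Real.smoothTransition.zero_of_nonpos hx.le]
  have hgb2 : g =ᶠ[𝓝 b] gb := by
    have h1 : ContinuousAt (fun x : ℝ => 3 * ((x - a) / (b - a)) - 1) b := by fun_prop
    have h2 : ∀ᶠ x in 𝓝 b, 1 < 3 * ((x - a) / (b - a)) - 1 :=
      h1.eventually (Ioi_mem_nhds (by
        simp only [div_self (sub_pos.2 hab).ne']; norm_num))
    filter_upwards [h2] with x hx
    simp [g, S, Real.smoothTransition.one_of_one_le hx.le]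
  have hjet : ∀ x ∈ frontier (Icc a b), ∀ m : ℕ, (m : ℕ∞) ≤ k →
      iteratedDerivWithin m (f - g) (Icc a b) x = 0 := by
    intro x hx m hm
    rw [frontier_Icc hab.le] at hx
    have hxI : x ∈ Icc a b := by
      rcases hx with rfl | rfl
      · exact left_mem_Icc.2 hab.le
      · exact right_mem_Icc.2 hab.le
    have hgm : ContDiffAt ℝ m g x := (hg.of_le (by exact_mod_cast le_top)).contDiffAt
    rw [iteratedDerivWithin_sub hxI hu ((hf x hxI).of_le (by exact_mod_cast hm))
      hgm.contDiffWithinAt, iteratedDerivWithin_eq_iteratedDeriv hu hgm hxI, sub_eq_zero]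
    rcases hx with rfl | rfl
    · rw [hga2.iteratedDeriv_eq, hga']
    · rw [hgb2.iteratedDeriv_eq, hgb']
  refine ⟨fun x => g x + (Icc a b).indicator (f - g) x,
    (hg.of_le (by exact_mod_cast le_top)).add ?_, fun x hx => by simp [indicator_of_mem hx]⟩
  refine contDiff_iff_forall_nat_le.2 fun m hm => contDiff_indicator_nat isClosed_Icc hu m _
    ((hf.of_le (by exact_mod_cast hm)).sub (hg.of_le (by exact_mod_cast le_top)).contDiffOn)
    fun x hx j hj => hjet x hx j (le_trans (by exact_mod_cast hj) hm)

end Franks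
-- Transverse linearization along an orbit and its change under a perturbation.
namespace Franks

open Filter Topology

abbrev E2 : Type := EuclideanSpace ℝ (Fin 2)

variable {M : Type*} [TopologicalSpace M] [ChartedSpace E3 M] [IsManifold (𝓡 3) ∞ M]

/-- A trivialization along a curve, written in the chart at `x`. -/
noncomputable def tauC (τ : NormalMap M) (γ : ℝ → M) (x : M) (t : ℝ) : E3 →L[ℝ] E2 :=
  (τ (γ t)).comp (fromChart x (γ t))

theorem tauC_toChart (τ : NormalMap M) (γ : ℝ → M) {x : M} {t : ℝ}
    (hx : γ t ∈ (extChartAt (𝓡 3) x).source) (v : TangentSpace (𝓡 3) (γ t)) :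
    tauC τ γ x t (toChart x (γ t) v) = τ (γ t) v := by
  show τ (γ t) (fromChart x (γ t) (toChart x (γ t) v)) = _
  rw [fromChart_toChart hx]

theorem IsNormalTrivialization.congr {X : VField M} {γ γ' : ℝ → M} {T : ℝ} {τ : NormalMap M}
    (h : IsNormalTrivialization X γ T τ) (hγ : ∀ t ∈ Icc 0 T, γ t = γ' t) :
    IsNormalTrivialization X γ' T τ where
  surj t ht := by rw [← hγ t ht]; exact h.surj t ht
  ker t ht := by rw [← hγ t ht]; exact h.ker t ht
  smooth x := by
    have hs : Icc 0 T ∩ γ' ⁻¹' (chartAt E3 x).source = Icc 0 T ∩ γ ⁻¹' (chartAt E3 x).source := by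
      ext t
      constructor
      · rintro ⟨h1, h2⟩; refine ⟨h1, ?_⟩; rw [mem_preimage, hγ t h1]; exact h2
      · rintro ⟨h1, h2⟩; refine ⟨h1, ?_⟩; rw [mem_preimage, ← hγ t h1]; exact h2
    rw [hs]
    refine (h.smooth x).congr fun t ht => ?_
    rw [hγ t ht.1]

/-- By dimension: were the field zero, the kernel of `τ` would be trivial and `ℝ³` would inject into
`ℝ²`. -/
theorem IsNormalTrivialization.ne_zero {X : VField M} {γ : ℝ → M} {T : ℝ} {τ : NormalMap M}
    (h : IsNormalTrivialization X γ T τ) {t : ℝ} (ht : t ∈ Icc 0 T) : X (γ t) ≠ 0 := by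
  intro h0
  obtain ⟨L, hL⟩ : ∃ L : E3 →L[ℝ] E2, L = τ (γ t) := ⟨_, rfl⟩
  have hi : Injective (L : E3 →ₗ[ℝ] E2) := by
    rw [← LinearMap.ker_eq_bot, LinearMap.ker_eq_bot']
    intro v hv
    obtain ⟨s, hs⟩ := (h.ker t ht v).1 (by rw [← hL]; exact hv)
    rw [h0, smul_zero] at hs
    exact hs
  have := LinearMap.finrank_le_finrank_of_injective hi
  simp at this

theorem IsNormalTrivialization.tau_self {X : VField M} {γ : ℝ → M} {T : ℝ} {τ : NormalMap M}
    (h : IsNormalTrivialization X γ T τ) {t : ℝ} (ht : t ∈ Icc 0 T) : τ (γ t) (X (γ t)) = 0 :=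
  (h.ker t ht _).2 ⟨1, (one_smul ℝ _).symm⟩

theorem mem_nhdsWithin_preimage_source {γ : ℝ → M} (hγ : Continuous γ) {T t : ℝ} (ht : t ∈ Icc 0 T)
    {x : M} (hx : γ t ∈ (extChartAt (𝓡 3) x).source) :
    Icc 0 T ∩ γ ⁻¹' (chartAt E3 x).source ∈ 𝓝[Icc 0 T] t := by
  rw [extChartAt_source] at hx
  exact inter_mem self_mem_nhdsWithin
    (mem_nhdsWithin_of_mem_nhds (((chartAt E3 x).open_source.preimage hγ).mem_nhds hx))

theorem IsNormalTrivialization.hasDerivWithinAt {X : VField M} {γ : ℝ → M} {T : ℝ}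
    {τ : NormalMap M} (h : IsNormalTrivialization X γ T τ) (hγ : Continuous γ) {t : ℝ}
    (ht : t ∈ Icc 0 T) {x : M} (hx : γ t ∈ (extChartAt (𝓡 3) x).source) :
    HasDerivWithinAt (tauC τ γ x) (derivWithin (tauC τ γ x) (Icc 0 T) t) (Icc 0 T) t := by
  have h1 := mem_nhdsWithin_preimage_source hγ ht hx
  have h2 : ContDiffWithinAt ℝ ∞ (tauC τ γ x) (Icc 0 T) t :=
    ((h.smooth x) t (mem_of_mem_nhdsWithin ht h1)).mono_of_mem_nhdsWithin h1
  exact (h2.differentiableWithinAt (by simp)).hasDerivWithinAt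

/-- The linearized equation along a curve seen through a trivialization. -/
noncomputable def linOp (τ : NormalMap M) (γ : ℝ → M) (T : ℝ) (Y : VField M) (x : M) (t : ℝ) :
    E3 →L[ℝ] E2 :=
  derivWithin (tauC τ γ x) (Icc 0 T) t +
    (tauC τ γ x t).comp (fderiv ℝ (fieldInChart Y x) (extChartAt (𝓡 3) x (γ t)))

theorem fieldInChart_add (X Y : VField M) (x : M) :
    fieldInChart (X + Y) x = fieldInChart X x + fieldInChart Y x := by
  funext u
  simp only [fieldInChart, Pi.add_apply, map_add]

theorem linOp_add {k : ℕ∞} {X Z : VField M} (hX : IsCkField k X) (hZ : IsCkField k Z) (hk : 1 ≤ k)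
    (τ : NormalMap M) (γ : ℝ → M) (T : ℝ) {x : M} {t : ℝ}
    (hx : γ t ∈ (extChartAt (𝓡 3) x).source) (v : E3) :
    linOp τ γ T (X + Z) x t v = linOp τ γ T X x t v +
      tauC τ γ x t (fderiv ℝ (fieldInChart Z x) (extChartAt (𝓡 3) x (γ t)) v) := by
  rw [linOp, fieldInChart_add, fderiv_add (hX.differentiableAt hk hx) (hZ.differentiableAt hk hx)]
  simp only [linOp, add_apply, ContinuousLinearMap.comp_apply, map_add]
  abel

theorem IsFlow.continuous {X : VField M} {φ : ℝ → M → M} (hφ : IsFlow X φ) (p : M) :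
    Continuous fun t => φ t p := (hφ p).2.continuous

theorem IsFlow.hasDerivAt_chart {X : VField M} {φ : ℝ → M → M} (hφ : IsFlow X φ) (p : M) {x : M}
    {t : ℝ} (hx : φ t p ∈ (extChartAt (𝓡 3) x).source) :
    HasDerivAt (fun s => extChartAt (𝓡 3) x (φ s p)) (toChart x (φ t p) (X (φ t p))) t :=
  hasDerivAt_chart_of_hasMFDerivAt (γ := fun t => φ t p) hx ((hφ p).2 t)

/-- The linearized equation kills the direction of the field. -/
theorem linOp_self {k : ℕ∞} {X : VField M} (hX : IsCkField k X) (hk : 1 ≤ k) {φ : ℝ → M → M}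
    (hφ : IsFlow X φ) {p : M} {T : ℝ} (hT : 0 < T) {τ : NormalMap M}
    (hτ : IsNormalTrivialization X (fun t => φ t p) T τ) {t : ℝ} (ht : t ∈ Icc 0 T) {x : M}
    (hx : φ t p ∈ (extChartAt (𝓡 3) x).source) :
    linOp τ (fun t => φ t p) T X x t (toChart x (φ t p) (X (φ t p))) = 0 := by
  have h1 := hτ.hasDerivWithinAt (hφ.continuous p) ht hx
  have h2 := ((hX.differentiableAt hk hx).hasFDerivAt.comp_hasDerivAt t
    (hφ.hasDerivAt_chart p hx)).hasDerivWithinAt (s := Icc 0 T)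
  have h3 := h1.clm_apply h2
  -- The identity `τ X = 0` along the orbit is differentiated in time; the product rule gives
  -- `linOp` on the direction of the field.
  have h4 : (fun s => tauC τ (fun t => φ t p) x s
      ((fieldInChart X x ∘ fun s => extChartAt (𝓡 3) x (φ s p)) s)) =ᶠ[𝓝[Icc 0 T] t] fun _ => 0 := by
    filter_upwards [mem_nhdsWithin_preimage_source (hφ.continuous p) ht hx] with s hs
    have hs' : φ s p ∈ (extChartAt (𝓡 3) x).source := by rw [extChartAt_source]; exact hs.2
    rw [comp_apply, fieldInChart_apply X hs', tauC_toChart τ (fun t => φ t p) hs']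
    exact hτ.tau_self hs.1
  have h5 := (hasDerivWithinAt_const t (Icc 0 T) (0 : E2)).congr_of_eventuallyEq_of_mem h4 ht
  have h6 := (uniqueDiffOn_Icc hT t ht).eq_deriv (Icc 0 T) h3 h5
  rw [← h6]
  simp only [linOp, add_apply, ContinuousLinearMap.comp_apply, comp_apply]
  rw [fieldInChart_apply X hx]

/-- The product rule for `τ` applied to `Dψ v`: the variational equation differentiates the vector,
and the time derivative of `τ` in the chart is the other summand of `linOp`. -/
theorem hasDerivWithinAt_tau_mfderiv [T2Space M] [CompactSpace M] {k : ℕ∞} {X Y : VField M}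
    (hY : IsCkField k Y) (hk : 1 ≤ k) {ψ : ℝ → M → M} (hψ : IsFlow Y ψ) {p : M} {T : ℝ}
    {τ : NormalMap M} (hτ : IsNormalTrivialization X (fun t => ψ t p) T τ) {t : ℝ}
    (ht : t ∈ Icc 0 T) {x : M} (hx : ψ t p ∈ (extChartAt (𝓡 3) x).source)
    (v : TangentSpace (𝓡 3) p) :
    HasDerivWithinAt (fun s => (τ (ψ s p) (mfderiv (𝓡 3) (𝓡 3) (ψ s) p v) : E2))
      (linOp τ (fun t => ψ t p) T Y x t (toChart x (ψ t p) (mfderiv (𝓡 3) (𝓡 3) (ψ t) p v)))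
      (Icc 0 T) t := by
  have h1 := hτ.hasDerivWithinAt (hψ.continuous p) ht hx
  have h2 := (hψ.hasDerivAt_mfderiv hY hk p v t hx).hasDerivWithinAt (s := Icc 0 T)
  have h3 := h1.clm_apply h2
  have h4 : (fun s => (τ (ψ s p) (mfderiv (𝓡 3) (𝓡 3) (ψ s) p v) : E2)) =ᶠ[𝓝[Icc 0 T] t]
      fun s => tauC τ (fun t => ψ t p) x s (toChart x (ψ s p) (mfderiv (𝓡 3) (𝓡 3) (ψ s) p v)) := by
    filter_upwards [mem_nhdsWithin_preimage_source (hψ.continuous p) ht hx] with s hs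
    have hs' : ψ s p ∈ (extChartAt (𝓡 3) x).source := by rw [extChartAt_source]; exact hs.2
    exact (tauC_toChart τ (fun t => ψ t p) hs' _).symm
  exact h3.congr_of_eventuallyEq_of_mem h4 ht

/-- If the linearized equation is `v ↦ a τ v`, then `A' = a A`. -/
theorem hasDerivWithinAt_transverseLin [T2Space M] [CompactSpace M] {k : ℕ∞} {X Y : VField M}
    (hY : IsCkField k Y) (hk : 1 ≤ k) {ψ : ℝ → M → M} (hψ : IsFlow Y ψ) {p : M} {T : ℝ}
    {τ : NormalMap M} (hτ : IsNormalTrivialization X (fun t => ψ t p) T τ) {t : ℝ}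
    (ht : t ∈ Icc 0 T) {x : M} (hx : ψ t p ∈ (extChartAt (𝓡 3) x).source)
    {a : Matrix (Fin 2) (Fin 2) ℝ} (ha : ∀ v i, linOp τ (fun t => ψ t p) T Y x t v i =
      ∑ j, a i j * tauC τ (fun t => ψ t p) x t v j) :
    HasDerivWithinAt (transverseLin τ ψ p) (a * transverseLin τ ψ p t) (Icc 0 T) t := by
  refine hasDerivWithinAt_pi.2 fun i => hasDerivWithinAt_pi.2 fun j => ?_
  have h1 := hasDerivWithinAt_tau_mfderiv hY hk hψ hτ ht hx
    (invFun (τ p) (EuclideanSpace.single j 1))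
  have h2 := ((EuclideanSpace.proj i : E2 →L[ℝ] ℝ).hasFDerivAt).comp_hasDerivWithinAt t h1
  refine h2.congr_deriv ?_
  show linOp τ (fun t => ψ t p) T Y x t _ i = (a * transverseLin τ ψ p t) i j
  rw [ha, Matrix.mul_apply]
  refine Finset.sum_congr rfl fun l _ => ?_
  rw [tauC_toChart τ (fun t => ψ t p) hx]
  rfl

theorem transverseLin_zero {X Y : VField M} {ψ : ℝ → M → M} (hψ : IsFlow Y ψ) {p : M} {T : ℝ}
    (hT : 0 < T) {τ : NormalMap M} (hτ : IsNormalTrivialization X (fun t => ψ t p) T τ) :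
    transverseLin τ ψ p 0 = 1 := by
  have h0 : ψ 0 = id := funext fun q => (hψ q).1
  have hs : Surjective (τ p) := by
    have := hτ.surj 0 (left_mem_Icc.2 hT.le)
    have key : ∀ q, q = p → Surjective (τ q) → Surjective (τ p) := by rintro _ rfl h; exact h
    exact key _ (hψ p).1 this
  ext i j
  simp only [transverseLin, Matrix.of_apply]
  rw [h0, mfderiv_id]
  show (τ p (invFun (τ p) (EuclideanSpace.single j 1)) : E2) i = _
  rw [invFun_eq (hs _), PiLp.single_apply, Matrix.one_apply]

/-- Liouville's formula in dimension two. -/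
theorem hasDerivWithinAt_det {A : ℝ → Matrix (Fin 2) (Fin 2) ℝ} {a : Matrix (Fin 2) (Fin 2) ℝ}
    {s : Set ℝ} {t : ℝ} (h : HasDerivWithinAt A (a * A t) s t) :
    HasDerivWithinAt (fun t => (A t).det) (a.trace * (A t).det) s t := by
  have h' : ∀ i j, HasDerivWithinAt (fun t => A t i j) ((a * A t) i j) s t := fun i j =>
    hasDerivWithinAt_pi.1 (hasDerivWithinAt_pi.1 h i) j
  simp only [Matrix.det_fin_two]
  refine (((h' 0 0).mul (h' 1 1)).sub ((h' 0 1).mul (h' 1 0))).congr_deriv ?_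
  simp only [Matrix.mul_apply, Fin.sum_univ_two, Matrix.trace_fin_two]
  ring

/-- The linearized equation in terms of the infinitesimal transverse linearization. -/
theorem linOp_eq [T2Space M] [CompactSpace M] {k : ℕ∞} {X : VField M}
    (hX : IsCkField k X) (hk : 1 ≤ k) {φ : ℝ → M → M}
    (hφ : IsFlow X φ) {p : M} {T : ℝ} (hT : 0 < T) {τ : NormalMap M}
    (hτ : IsNormalTrivialization X (fun t => φ t p) T τ)
    (hSL : ∀ t ∈ Icc 0 T, (transverseLin τ φ p t).det = 1) {t : ℝ} (ht : t ∈ Icc 0 T) {x : M}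
    (hx : φ t p ∈ (extChartAt (𝓡 3) x).source) (v : E3) (i : Fin 2) :
    linOp τ (fun t => φ t p) T X x t v i =
      ∑ j, infinitesimalLin τ φ p T t i j * tauC τ (fun t => φ t p) x t v j := by
  have hs : Surjective (tauC τ (fun t => φ t p) x t) := fun y => by
    obtain ⟨w, hw⟩ := hτ.surj t ht y
    exact ⟨toChart x (φ t p) w, by rw [← hw]; exact tauC_toChart τ (fun t => φ t p) hx w⟩
  choose w hw using fun j : Fin 2 => hs (EuclideanSpace.single j 1)
  -- `linOp` kills the direction of the field, which is the kernel of `τ`, so it factors through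
  -- `τ`; `a` is the factor, computed on lifts `w j` of the standard basis. The equation `A' = a A`
  -- then identifies it with the infinitesimal linearization.
  let a : Matrix (Fin 2) (Fin 2) ℝ := Matrix.of fun i j => linOp τ (fun t => φ t p) T X x t (w j) i
  have ha : ∀ v i, linOp τ (fun t => φ t p) T X x t v i =
      ∑ j, a i j * tauC τ (fun t => φ t p) x t v j := by
    intro v i
    obtain ⟨y, hy⟩ : ∃ y, y = tauC τ (fun t => φ t p) x t v := ⟨_, rfl⟩
    have h1 : tauC τ (fun t => φ t p) x t (v - (y 0 • w 0 + y 1 • w 1)) = 0 := by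
      rw [map_sub, map_add, map_smul, map_smul, hw, hw, ← hy]
      ext j
      fin_cases j <;> simp
    obtain ⟨r, hr⟩ := (hτ.ker t ht _).1 h1
    have h2 : v - (y 0 • w 0 + y 1 • w 1) = r • toChart x (φ t p) (X (φ t p)) := by
      rw [← map_smul, ← hr]
      exact (toChart_fromChart hx _).symm
    have h3 : linOp τ (fun t => φ t p) T X x t (v - (y 0 • w 0 + y 1 • w 1)) = 0 := by
      rw [h2, map_smul, linOp_self hX hk hφ hT hτ ht hx, smul_zero]
    rw [map_sub, sub_eq_zero, map_add, map_smul, map_smul] at h3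
    rw [h3, ← hy, Fin.sum_univ_two]
    simp only [a, Matrix.of_apply, PiLp.add_apply, PiLp.smul_apply, smul_eq_mul]
    ring
  have hd := hasDerivWithinAt_transverseLin hX hk hφ hτ ht hx ha
  have : infinitesimalLin τ φ p T t = a := by
    have h1 : derivWithin (transverseLin τ φ p) (Icc 0 T) t = a * transverseLin τ φ p t :=
      hd.derivWithin (uniqueDiffOn_Icc hT t ht)
    rw [infinitesimalLin, h1, Matrix.mul_assoc,
      Matrix.mul_nonsing_inv _ (by rw [hSL t ht]; exact isUnit_one), Matrix.mul_one]
  rw [this, ha]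

/-- Liouville's formula applied to a determinant that is constantly `1`. -/
theorem infinitesimalLin_trace [T2Space M] [CompactSpace M] {k : ℕ∞} {X : VField M}
    (hX : IsCkField k X) (hk : 1 ≤ k) {φ : ℝ → M → M}
    (hφ : IsFlow X φ) {p : M} {T : ℝ} (hT : 0 < T) {τ : NormalMap M}
    (hτ : IsNormalTrivialization X (fun t => φ t p) T τ)
    (hSL : ∀ t ∈ Icc 0 T, (transverseLin τ φ p t).det = 1) {t : ℝ} (ht : t ∈ Icc 0 T) :
    (infinitesimalLin τ φ p T t).trace = 0 := by
  have h1 := hasDerivWithinAt_det (hasDerivWithinAt_transverseLin hX hk hφ hτ ht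
    (mem_extChartAt_source _) (linOp_eq hX hk hφ hT hτ hSL ht (mem_extChartAt_source _)))
  have h2 : HasDerivWithinAt (fun t => (transverseLin τ φ p t).det) 0 (Icc 0 T) t :=
    (hasDerivWithinAt_const t _ (1 : ℝ)).congr hSL (hSL t ht)
  have h3 := (uniqueDiffOn_Icc hT t ht).eq_deriv (Icc 0 T) h1 h2
  rwa [hSL t ht, mul_one] at h3

/-- The transverse linearization of a perturbed field. -/
theorem transverseLin_perturb [T2Space M] [CompactSpace M] {k : ℕ∞} {X Z : VField M}
    (hX : IsCkField k X) (hZ : IsCkField k Z) (hk : 1 ≤ k) {φ ψ : ℝ → M → M}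
    (hφ : IsFlow X φ) (hψ : IsFlow (X + Z) ψ) (hY : IsCkField k (X + Z))
    {p : M} {T : ℝ} (hT : 0 < T) {τ : NormalMap M}
    (hτ : IsNormalTrivialization X (fun t => φ t p) T τ)
    (hSL : ∀ t ∈ Icc 0 T, (transverseLin τ φ p t).det = 1)
    (hφψ : ∀ t ∈ Icc 0 T, φ t p = ψ t p) {c : ℝ → Matrix (Fin 2) (Fin 2) ℝ}
    (hsl : ∀ t ∈ Icc 0 T, (c t).trace = 0)
    (hc : ∀ t ∈ Icc 0 T, ∃ x : M, φ t p ∈ (extChartAt (𝓡 3) x).source ∧ ∀ v i,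
      tauC τ (fun t => φ t p) x t
        (fderiv ℝ (fieldInChart Z x) (extChartAt (𝓡 3) x (φ t p)) v) i =
      ∑ j, (c t - infinitesimalLin τ φ p T t) i j * tauC τ (fun t => φ t p) x t v j)
    {t : ℝ} (ht : t ∈ Icc 0 T) :
    DifferentiableWithinAt ℝ (transverseLin τ ψ p) (Icc 0 T) t ∧
      (transverseLin τ ψ p t).det = 1 ∧ infinitesimalLin τ ψ p T t = c t := by
  have hτ' : IsNormalTrivialization X (fun t => ψ t p) T τ := hτ.congr hφψ
  have htau : ∀ x : M, ∀ t ∈ Icc 0 T, tauC τ (fun t => φ t p) x t = tauC τ (fun t => ψ t p) x t :=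
    fun x t ht => by
      have key : ∀ q q' : M, q = q' → ((τ q).comp (fromChart x q) : E3 →L[ℝ] E2) =
          (τ q').comp (fromChart x q') := by rintro q _ rfl; rfl
      exact key _ _ (hφψ t ht)
  have hlin : ∀ x : M, ∀ t ∈ Icc 0 T, ∀ W : VField M,
      linOp τ (fun t => φ t p) T W x t = linOp τ (fun t => ψ t p) T W x t := fun x t ht W => by
    rw [linOp, linOp, htau x t ht, derivWithin_congr (htau x) (htau x t ht), hφψ t ht]
  have hd : ∀ t ∈ Icc 0 T,
      HasDerivWithinAt (transverseLin τ ψ p) (c t * transverseLin τ ψ p t) (Icc 0 T) t := by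
    intro t ht
    obtain ⟨x, hx, hxc⟩ := hc t ht
    have hx' := hx
    rw [hφψ t ht] at hx'
    refine hasDerivWithinAt_transverseLin hY hk hψ hτ' ht hx' fun v i => ?_
    rw [← hlin x t ht, linOp_add hX hZ hk τ (fun t => φ t p) T hx, PiLp.add_apply,
      linOp_eq hX hk hφ hT hτ hSL ht hx, hxc, ← Finset.sum_add_distrib, ← htau x t ht]
    refine Finset.sum_congr rfl fun j _ => ?_
    rw [Matrix.sub_apply]; ring
  -- Since `c` is traceless, Liouville's formula makes the determinant constant; its value at time
  -- `0` is `1`. So `A` is invertible and `A' A⁻¹` can be read off.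
  have hdet0 : ∀ t ∈ Icc 0 T, HasDerivWithinAt (fun t => (transverseLin τ ψ p t).det) 0
      (Icc 0 T) t := fun t ht => by
    have := hasDerivWithinAt_det (hd t ht)
    rwa [hsl t ht, zero_mul] at this
  have hdet : (transverseLin τ ψ p t).det = 1 := by
    have := constant_of_derivWithin_zero (f := fun t => (transverseLin τ ψ p t).det)
      (fun t ht => (hdet0 t ht).differentiableWithinAt)
      (fun t ht => (hdet0 t (Ico_subset_Icc_self ht)).derivWithin
        (uniqueDiffOn_Icc hT t (Ico_subset_Icc_self ht))) t ht
    rw [this, transverseLin_zero hψ hT hτ', Matrix.det_one]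
  refine ⟨(hd t ht).differentiableWithinAt, hdet, ?_⟩
  have h1 : derivWithin (transverseLin τ ψ p) (Icc 0 T) t = c t * transverseLin τ ψ p t :=
    (hd t ht).derivWithin (uniqueDiffOn_Icc hT t ht)
  rw [infinitesimalLin, h1, Matrix.mul_assoc,
    Matrix.mul_nonsing_inv _ (by rw [hdet]; exact isUnit_one), Matrix.mul_one]

end Franks
-- Algebra of fields and forms; extension by zero from a chart.
namespace Franks

open Filter Topology

/-- Smoothness of a form on `ℝ³` can be tested on constant vectors. -/
theorem contDiffAt_alternating {n : ℕ} {k : WithTop ℕ∞} {F : E3 → E3 [⋀^Fin n]→L[ℝ] ℝ} {u : E3}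
    (h : ∀ v : Fin n → E3, ContDiffAt ℝ k (fun x => F x v) u) : ContDiffAt ℝ k F u := by
  let e := (EuclideanSpace.basisFun (Fin 3) ℝ).toBasis
  -- Evaluation on tuples of basis vectors is injective and linear on a finite-dimensional space, so
  -- a linear left inverse recovers the form smoothly from its coefficients.
  let Ψ : (E3 [⋀^Fin n]→L[ℝ] ℝ) →ₗ[ℝ] ((Fin n → Fin 3) → ℝ) :=
    { toFun := fun η s => η fun i => e (s i)
      map_add' := fun _ _ => rfl
      map_smul' := fun _ _ => rfl }
  have hΨ : LinearMap.ker Ψ = ⊥ := by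
    rw [LinearMap.ker_eq_bot]
    intro η η' hη
    refine ContinuousAlternatingMap.toAlternatingMap_injective
      (Module.Basis.ext_alternating e fun s _ => congrFun hη s)
  obtain ⟨L, hL⟩ := Ψ.exists_leftInverse_of_injective hΨ
  have h1 : ContDiffAt ℝ k (fun x => Ψ (F x)) u := contDiffAt_pi.2 fun s => h _
  have h2 := (LinearMap.toContinuousLinearMap L).contDiff.contDiffAt.comp u h1
  refine h2.congr_of_eventuallyEq (Eventually.of_forall fun x => ?_)
  exact (LinearMap.congr_fun hL (F x)).symm

variable {M : Type*} [TopologicalSpace M] [ChartedSpace E3 M] [IsManifold (𝓡 3) ∞ M]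

theorem formInChart_apply {n : ℕ} (η : DForm M n) {x q : M} (hx : q ∈ (extChartAt (𝓡 3) x).source)
    (v : Fin n → E3) :
    formInChart η x (extChartAt (𝓡 3) x q) v = η q fun i => fromChart x q (v i) := by
  simp only [formInChart, ContinuousAlternatingMap.compContinuousLinearMap_apply]
  rw [(extChartAt (𝓡 3) x).left_inv hx]
  rfl

theorem IsCkForm.differentiableAt {n : ℕ} {k : ℕ∞} {η : DForm M n} (hη : IsCkForm k η)
    (hk : 1 ≤ k) {x q : M} (hx : q ∈ (extChartAt (𝓡 3) x).source) :
    DifferentiableAt ℝ (formInChart η x) (extChartAt (𝓡 3) x q) :=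
  ((hη x).contDiffAt ((isOpen_extChartAt_target x).mem_nhds
    ((extChartAt (𝓡 3) x).map_source hx))).differentiableAt (by
      have : (1 : ℕ∞) ≤ k := hk
      rintro h
      simp_all)

theorem IsCkForm.of_le {n : ℕ} {k l : ℕ∞} {η : DForm M n} (hη : IsCkForm l η) (hk : k ≤ l) :
    IsCkForm k η := fun x => (hη x).of_le (by exact_mod_cast hk)

theorem IsCkForm.add {n : ℕ} {k : ℕ∞} {η η' : DForm M n} (hη : IsCkForm k η)
    (hη' : IsCkForm k η') : IsCkForm k (η + η') := fun x => (hη x).add (hη' x)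

theorem IsCkField.of_le {k l : ℕ∞} {X : VField M} (hX : IsCkField l X) (hk : k ≤ l) :
    IsCkField k X := ContMDiff.of_le hX (by exact_mod_cast hk)

theorem IsCkField.add {k : ℕ∞} {X Z : VField M} (hX : IsCkField k X) (hZ : IsCkField k Z) :
    IsCkField k (X + Z) := isCkField_iff.2 fun x => by
  rw [fieldInChart_add]
  exact (isCkField_iff.1 hX x).add (isCkField_iff.1 hZ x)

theorem extD_add {n : ℕ} {k : ℕ∞} (hk : 1 ≤ k) {η η' : DForm M n} (hη : IsCkForm k η)
    (hη' : IsCkForm k η') : extD (η + η') = extD η + extD η' := by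
  funext q
  have hq := mem_extChartAt_source (I := 𝓡 3) q
  exact extDeriv_add (hη.differentiableAt hk hq) (hη'.differentiableAt hk hq)

theorem contract_add {n : ℕ} (X Z : VField M) (μ : DForm M (n + 1)) :
    contract (X + Z) μ = contract X μ + contract Z μ := by
  funext q
  exact map_add (ContinuousAlternatingMap.curryLeft (E := E3) (μ q)) (X q) (Z q)

theorem contract_apply {n : ℕ} (X : VField M) (μ : DForm M (n + 1)) (q : M)
    (v : Fin n → TangentSpace (𝓡 3) q) : contract X μ q v = μ q (Matrix.vecCons (X q) v) := rfl

theorem formInChart_contract {n : ℕ} (X : VField M) (μ : DForm M (n + 1)) {x q : M}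
    (hx : q ∈ (extChartAt (𝓡 3) x).source) :
    formInChart (contract X μ) x (extChartAt (𝓡 3) x q) =
      (formInChart μ x (extChartAt (𝓡 3) x q)).curryLeft
        (fieldInChart X x (extChartAt (𝓡 3) x q)) := by
  ext v
  rw [formInChart_apply _ hx, ContinuousAlternatingMap.curryLeft_apply_apply,
    formInChart_apply _ hx, contract_apply]
  congr 1
  funext i
  refine Fin.cases ?_ (fun j => ?_) i
  · simp only [Matrix.cons_val_zero]
    rw [fieldInChart_apply X hx, fromChart_toChart hx]
  · simp only [Matrix.cons_val_succ]

theorem IsCkForm.contract {n : ℕ} {k : ℕ∞} {X : VField M} {μ : DForm M (n + 1)}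
    (hμ : IsCkForm k μ) (hX : IsCkField k X) : IsCkForm k (contract X μ) := by
  intro x
  have h1 := (LinearIsometry.contDiff (F := E3 →L[ℝ] E3 [⋀^Fin n]→L[ℝ] ℝ) (n := k)
    (ContinuousAlternatingMap.curryLeftLI (𝕜 := ℝ))).comp_contDiffOn (hμ x)
  refine (h1.clm_apply (isCkField_iff.1 hX x)).congr fun u hu => ?_
  have h2 := formInChart_contract X μ ((extChartAt (𝓡 3) x).map_target hu)
  rwa [(extChartAt (𝓡 3) x).right_inv hu] at h2

/-- The vector field with the expression `z` in the chart at `x`, extended by zero. -/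
noncomputable def pieceField (x : M) (z : E3 → E3) : VField M := fun q =>
  open Classical in
  if q ∈ (extChartAt (𝓡 3) x).source then fromChart x q (z (extChartAt (𝓡 3) x q)) else 0

/-- The one-form with the expression `a` in the chart at `x`, extended by zero. -/
noncomputable def pieceForm (x : M) (a : E3 → E3 →L[ℝ] ℝ) : DForm M 1 := fun q =>
  open Classical in
  if q ∈ (extChartAt (𝓡 3) x).source then
    ContinuousAlternatingMap.ofSubsingleton ℝ E3 ℝ (0 : Fin 1)
      ((a (extChartAt (𝓡 3) x q)).comp (toChart x q : E3 →L[ℝ] E3))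
  else 0

theorem pieceField_of_mem {x q : M} (hx : q ∈ (extChartAt (𝓡 3) x).source) (z : E3 → E3) :
    pieceField x z q = fromChart x q (z (extChartAt (𝓡 3) x q)) := if_pos hx

theorem fieldInChart_pieceField {x : M} {u : E3} (hu : u ∈ (extChartAt (𝓡 3) x).target)
    (z : E3 → E3) : fieldInChart (pieceField x z) x u = z u := by
  have hx := (extChartAt (𝓡 3) x).map_target hu
  have := fieldInChart_apply (pieceField x z) hx
  rwa [(extChartAt (𝓡 3) x).right_inv hu, pieceField_of_mem hx, toChart_fromChart hx,
    (extChartAt (𝓡 3) x).right_inv hu] at this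

theorem pieceField_eq_zero {x : M} {z : E3 → E3} {S : Set E3} (hz : ∀ u ∉ S, z u = 0) {q : M}
    (hq : q ∉ (extChartAt (𝓡 3) x).symm '' S) : pieceField x z q = 0 := by
  by_cases hx : q ∈ (extChartAt (𝓡 3) x).source
  · rw [pieceField_of_mem hx, hz _ fun h => hq ⟨_, h, (extChartAt (𝓡 3) x).left_inv hx⟩, map_zero]
  · exact if_neg hx

theorem pieceForm_eq_zero {x : M} {a : E3 → E3 →L[ℝ] ℝ} {S : Set E3} (ha : ∀ u ∉ S, a u = 0)
    {q : M} (hq : q ∉ (extChartAt (𝓡 3) x).symm '' S) : pieceForm x a q = 0 := by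
  by_cases hx : q ∈ (extChartAt (𝓡 3) x).source
  · refine (if_pos hx).trans ?_
    rw [ha _ fun h => hq ⟨_, h, (extChartAt (𝓡 3) x).left_inv hx⟩]
    ext v
    rfl
  · exact if_neg hx

theorem isClosed_symm_image [T2Space M] {x : M} {S : Set E3} (hS : IsCompact S)
    (hSt : S ⊆ (extChartAt (𝓡 3) x).target) : IsClosed ((extChartAt (𝓡 3) x).symm '' S) :=
  (hS.image_of_continuousOn ((continuousOn_extChartAt_symm x).mono hSt)).isClosed

theorem symm_image_subset_source {x : M} {S : Set E3} (hSt : S ⊆ (extChartAt (𝓡 3) x).target) :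
    (extChartAt (𝓡 3) x).symm '' S ⊆ (extChartAt (𝓡 3) x).source := by
  rintro _ ⟨u, hu, rfl⟩
  exact (extChartAt (𝓡 3) x).map_target (hSt hu)

theorem eventually_chart_symm {x q : M} (hx : q ∈ (extChartAt (𝓡 3) x).source) {P : M → Prop}
    (h : ∀ᶠ q' in 𝓝 q, P q') :
    ∀ᶠ u in 𝓝 (extChartAt (𝓡 3) x q), P ((extChartAt (𝓡 3) x).symm u) := by
  have hc := chg_continuousAt_symm ((extChartAt (𝓡 3) x).map_source hx)
  exact hc.eventually (by rw [(extChartAt (𝓡 3) x).left_inv hx]; exact h)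

theorem contDiffAt_of_fieldInChart_zero {k : ℕ∞} {Z : VField M} {y q : M}
    (hy : q ∈ (extChartAt (𝓡 3) y).source) (h : ∀ᶠ q' in 𝓝 q, Z q' = 0) :
    ContDiffAt ℝ k (fieldInChart Z y) (extChartAt (𝓡 3) y q) := by
  refine (contDiffAt_const (c := (0 : E3))).congr_of_eventuallyEq ?_
  filter_upwards [eventually_chart_symm hy h] with u hu
  rw [fieldInChart, hu, map_zero]

theorem formInChart_eventually_zero {n : ℕ} {η : DForm M n} {y q : M}
    (hy : q ∈ (extChartAt (𝓡 3) y).source) (h : ∀ᶠ q' in 𝓝 q, η q' = 0) :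
    formInChart η y =ᶠ[𝓝 (extChartAt (𝓡 3) y q)] fun _ => 0 := by
  filter_upwards [eventually_chart_symm hy h] with u hu
  rw [formInChart, hu]
  rfl

theorem extD_eq_zero {n : ℕ} {η : DForm M n} {q : M} (h : ∀ᶠ q' in 𝓝 q, η q' = 0) :
    extD η q = 0 := by
  have h1 := (formInChart_eventually_zero (mem_extChartAt_source (I := 𝓡 3) q) h).extDeriv_eq
  refine Eq.trans h1 ?_
  have h2 := extDeriv_fun_smul (x := extChartAt (𝓡 3) q q) (0 : ℝ)
    (fun _ : E3 => (0 : E3 [⋀^Fin n]→L[ℝ] ℝ))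
  simp only [zero_smul] at h2
  exact h2

/-- On the chart domain the field is transported by a smooth transition map, at no loss of
regularity. Every other point has a neighbourhood disjoint from the image of `S`, which is compact
and hence closed in a Hausdorff space, and there the field is zero. -/
theorem isCkField_pieceField [T2Space M] {k : ℕ∞} {x : M} {z : E3 → E3} (hz : ContDiff ℝ k z)
    {S : Set E3} (hS : IsCompact S) (hSt : S ⊆ (extChartAt (𝓡 3) x).target)
    (hzS : ∀ u ∉ S, z u = 0) : IsCkField k (pieceField x z) := by
  refine isCkField_iff.2 fun y u hu => ContDiffAt.contDiffWithinAt ?_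
  obtain ⟨q, hq⟩ : ∃ q, q = (extChartAt (𝓡 3) y).symm u := ⟨_, rfl⟩
  have hy : q ∈ (extChartAt (𝓡 3) y).source := by rw [hq]; exact (extChartAt (𝓡 3) y).map_target hu
  have hu' : u = extChartAt (𝓡 3) y q := by rw [hq, (extChartAt (𝓡 3) y).right_inv hu]
  rw [hu']
  by_cases hx : q ∈ (extChartAt (𝓡 3) x).source
  · have h1 : ContDiffAt ℝ k (fun u => fderiv ℝ (chg x y) u (z u)) (extChartAt (𝓡 3) x q) :=
      (((chg_contDiffAt hx hy).fderiv_right (m := ∞) (by simp)).of_le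
        (by exact_mod_cast le_top)).clm_apply hz.contDiffAt
    have h2 : ContDiffAt ℝ k (chg y x) (extChartAt (𝓡 3) y q) :=
      (chg_contDiffAt hy hx).of_le (by exact_mod_cast le_top)
    have h3 := ContDiffAt.comp (extChartAt (𝓡 3) y q) (by rw [chg_apply hy]; exact h1) h2
    refine h3.congr_of_eventuallyEq ?_
    filter_upwards [eventually_mem_target_source hy hx] with v hv
    have hvy := (extChartAt (𝓡 3) y).map_target hv.1
    have h4 := fieldInChart_chg (pieceField x z) hv.2 hvy
    rw [chg_apply hv.2, (extChartAt (𝓡 3) y).right_inv hv.1,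
      fieldInChart_pieceField ((extChartAt (𝓡 3) x).map_source hv.2)] at h4
    exact h4
  · refine contDiffAt_of_fieldInChart_zero hy ?_
    filter_upwards [(isClosed_symm_image hS hSt).isOpen_compl.mem_nhds fun h =>
      hx (symm_image_subset_source hSt h)] with q' hq'
    exact pieceField_eq_zero hzS hq'

theorem formInChart_pieceForm {x : M} {u : E3} (hu : u ∈ (extChartAt (𝓡 3) x).target)
    (a : E3 → E3 →L[ℝ] ℝ) : formInChart (pieceForm x a) x u =
      ContinuousAlternatingMap.ofSubsingleton ℝ E3 ℝ (0 : Fin 1) (a u) := by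
  have hx := (extChartAt (𝓡 3) x).map_target hu
  ext v
  have := formInChart_apply (pieceForm x a) hx v
  rw [(extChartAt (𝓡 3) x).right_inv hu] at this
  have h2 : pieceForm x a ((extChartAt (𝓡 3) x).symm u) = _ := if_pos hx
  rw [this, h2]
  show a (extChartAt (𝓡 3) x ((extChartAt (𝓡 3) x).symm u))
    (toChart x _ (fromChart x ((extChartAt (𝓡 3) x).symm u) (v 0))) = a u (v 0)
  rw [toChart_fromChart hx, (extChartAt (𝓡 3) x).right_inv hu]

theorem isCkForm_pieceForm [T2Space M] {k : ℕ∞} {x : M} {a : E3 → E3 →L[ℝ] ℝ}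
    (ha : ContDiff ℝ k a) {S : Set E3} (hS : IsCompact S)
    (hSt : S ⊆ (extChartAt (𝓡 3) x).target) (haS : ∀ u ∉ S, a u = 0) :
    IsCkForm k (pieceForm x a) := by
  refine fun y u hu => ContDiffAt.contDiffWithinAt ?_
  obtain ⟨q, hq⟩ : ∃ q, q = (extChartAt (𝓡 3) y).symm u := ⟨_, rfl⟩
  have hy : q ∈ (extChartAt (𝓡 3) y).source := by rw [hq]; exact (extChartAt (𝓡 3) y).map_target hu
  have hu' : u = extChartAt (𝓡 3) y q := by rw [hq, (extChartAt (𝓡 3) y).right_inv hu]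
  rw [hu']
  by_cases hx : q ∈ (extChartAt (𝓡 3) x).source
  · refine contDiffAt_alternating fun v => ?_
    have h2 : ContDiffAt ℝ k (chg y x) (extChartAt (𝓡 3) y q) :=
      (chg_contDiffAt hy hx).of_le (by exact_mod_cast le_top)
    have h1 : ContDiffAt ℝ k (fderiv ℝ (chg y x)) (extChartAt (𝓡 3) y q) :=
      ((chg_contDiffAt hy hx).fderiv_right (m := ∞) (by simp)).of_le (by exact_mod_cast le_top)
    have h3 := (ha.contDiffAt.comp _ h2).clm_apply (h1.clm_apply (contDiffAt_const (c := v 0)))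
    refine h3.congr_of_eventuallyEq ?_
    filter_upwards [formInChart_chg (pieceForm x a) hy hx, eventually_mem_target_source hy hx]
      with w hw hv
    have h5 : chg y x w ∈ (extChartAt (𝓡 3) x).target := by
      have := (extChartAt (𝓡 3) x).map_source hv.2
      rwa [← chg_apply ((extChartAt (𝓡 3) y).map_target hv.1) (y := x),
        (extChartAt (𝓡 3) y).right_inv hv.1] at this
    rw [hw, ContinuousAlternatingMap.compContinuousLinearMap_apply, formInChart_pieceForm h5]
    rfl
  · refine (contDiffAt_const (c := (0 : E3 [⋀^Fin 1]→L[ℝ] ℝ))).congr_of_eventuallyEq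
      (formInChart_eventually_zero hy ?_)
    filter_upwards [(isClosed_symm_image hS hSt).isOpen_compl.mem_nhds fun h =>
      hx (symm_image_subset_source hSt h)] with q' hq'
    exact pieceForm_eq_zero haS hq'

end Franks
-- Hamiltonian fields in coordinates adapted to a curve.
namespace Franks

open Filter Topology

/-- The coordinates with respect to a basis of `ℝ³`. -/
noncomputable def co (e : Module.Basis (Fin 3) ℝ E3) (i : Fin 3) : E3 →L[ℝ] ℝ :=
  LinearMap.toContinuousLinearMap (e.coord i)

theorem co_apply (e : Module.Basis (Fin 3) ℝ E3) (i : Fin 3) (v : E3) : co e i v = e.repr v i := rfl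

theorem co_basis (e : Module.Basis (Fin 3) ℝ E3) (i j : Fin 3) :
    co e i (e j) = if j = i then 1 else 0 := by
  rw [co_apply, e.repr_self, Finsupp.single_apply]

theorem sum_co (e : Module.Basis (Fin 3) ℝ E3) (v : E3) :
    v = co e 0 v • e 0 + co e 1 v • e 1 + co e 2 v • e 2 := by
  conv_lhs => rw [← e.sum_repr v]
  rw [Fin.sum_univ_three]
  rfl

/-- A top-degree form is `η e` times the determinant of the basis. With `L = dK` the contraction is
`b (η e) dK ∧ e⁰`, so dividing `b` by the density `η e` leaves a coefficient that can be a function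
of `s` alone. -/
theorem alternating_curryLeft_basis (e : Module.Basis (Fin 3) ℝ E3) (η : E3 [⋀^Fin 3]→L[ℝ] ℝ)
    (L : E3 →L[ℝ] ℝ) (b : ℝ) (v : Fin 2 → E3) :
    η.curryLeft (b • (L (e 2) • e 1 - L (e 1) • e 2)) v =
      b * η e * (L (v 0) * co e 0 (v 1) - L (v 1) * co e 0 (v 0)) := by
  have h1 := AlternatingMap.eq_smul_basis_det e η.toAlternatingMap
  rw [ContinuousAlternatingMap.curryLeft_apply_apply]
  have h2 : ∀ w : Fin 3 → E3, η w = η e * e.det w := fun w => by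
    have := congrArg (fun f => f w) h1
    exact this
  have hL : ∀ w : E3, L w = co e 0 w * L (e 0) + co e 1 w * L (e 1) + co e 2 w * L (e 2) := by
    intro w
    conv_lhs => rw [sum_co e w]
    simp only [map_add, map_smul, smul_eq_mul]
  rw [h2, Module.Basis.det_apply, Matrix.det_fin_three]
  simp only [Module.Basis.toMatrix_apply, ← co_apply]
  have h3 : ∀ i, co e i (b • (L (e 2) • e 1 - L (e 1) • e 2)) =
      b * (L (e 2) * (if (1 : Fin 3) = i then 1 else 0) -
        L (e 1) * (if (2 : Fin 3) = i then 1 else 0)) := fun i => by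
    rw [map_smul, map_sub, map_smul, map_smul, co_basis, co_basis]
    rfl
  have hv : ∀ z : E3, Matrix.vecCons z v 0 = z ∧ Matrix.vecCons z v 1 = v 0 ∧
      Matrix.vecCons z v 2 = v 1 := fun z => ⟨rfl, rfl, rfl⟩
  simp only [hv, h3]
  rw [hL (v 0), hL (v 1)]
  simp
  ring

/-- `d(β K L) = β dK ∧ L`: the derivative of `β (L u)` is a multiple of `L`, and disappears in the
wedge product with `L`. -/
theorem extDeriv_smul_covector {β : ℝ → ℝ} {K : E3 → ℝ} {L : E3 →L[ℝ] ℝ} {u : E3}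
    (hβ : ContDiff ℝ 1 β) (hK : ContDiff ℝ ∞ K) (v : Fin 2 → E3) :
    extDeriv (fun u => ContinuousAlternatingMap.ofSubsingleton ℝ E3 ℝ (0 : Fin 1)
      ((β (L u) * K u) • L)) u v =
      β (L u) * (fderiv ℝ K u (v 0) * L (v 1) - fderiv ℝ K u (v 1) * L (v 0)) := by
  have hr : ContDiff ℝ 1 fun u => β (L u) * K u :=
    (hβ.comp L.contDiff).mul (hK.of_le (by exact_mod_cast le_top))
  have hd : DifferentiableAt ℝ (fun u => ContinuousAlternatingMap.ofSubsingleton ℝ E3 ℝ (0 : Fin 1)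
      ((β (L u) * K u) • L)) u := by
    refine ContDiffAt.differentiableAt (n := 1) (contDiffAt_alternating fun w => ?_) one_ne_zero
    exact (hr.mul contDiff_const (g := fun _ => L (w 0))).contDiffAt
  rw [extDeriv_apply hd, Fin.sum_univ_two]
  have hβ' : HasFDerivAt (fun u => β (L u)) (deriv β (L u) • L) u :=
    ((hβ.differentiable one_ne_zero _).hasDerivAt.comp_hasFDerivAt u L.hasFDerivAt)
  have hK' : HasFDerivAt K (fderiv ℝ K u) u := (hK.differentiable (by simp) u).hasFDerivAt
  have h1 : ∀ c : ℝ, HasFDerivAt (fun u => β (L u) * K u * c)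
      (c • (β (L u) • fderiv ℝ K u + K u • deriv β (L u) • L)) u := fun c =>
    (hβ'.mul hK').mul_const c
  have h2 : ∀ w : Fin 1 → E3, (fun u => ContinuousAlternatingMap.ofSubsingleton ℝ E3 ℝ (0 : Fin 1)
      ((β (L u) * K u) • L) w) = fun u => β (L u) * K u * L (w 0) := fun w => rfl
  have hrm : ((0 : Fin 2).removeNth v 0 = v 1) ∧ ((1 : Fin 2).removeNth v 0 = v 0) := ⟨rfl, rfl⟩
  simp only [h2, (h1 _).fderiv, hrm.1, hrm.2]
  simp only [add_apply, smul_apply, smul_eq_mul, Fin.val_zero, Fin.val_one]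
  ring

/-- In `d(β dK ∧ L)` the term with `β'` contains `L ∧ L`, and the remaining one vanishes by symmetry
of the Hessian of `K`. The direct computation needs `β` only of class `C¹`, for which the primitive
`β K L` is too rough to invoke `d ∘ d = 0`. -/
theorem extDeriv_eq_zero_of_eq {β : ℝ → ℝ} {K : E3 → ℝ} {L : E3 →L[ℝ] ℝ} {u : E3}
    (hβ : ContDiff ℝ 1 β) (hK : ContDiff ℝ ∞ K) {F : E3 → E3 [⋀^Fin 2]→L[ℝ] ℝ}
    (hF : DifferentiableAt ℝ F u) (h : ∀ᶠ u in 𝓝 u, ∀ v, F u v =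
      β (L u) * (fderiv ℝ K u (v 0) * L (v 1) - fderiv ℝ K u (v 1) * L (v 0))) :
    extDeriv F u = 0 := by
  ext v
  have hβ' : HasFDerivAt (fun u => β (L u)) (deriv β (L u) • L) u :=
    ((hβ.differentiable one_ne_zero _).hasDerivAt.comp_hasFDerivAt u L.hasFDerivAt)
  have hK2 : HasFDerivAt (fderiv ℝ K) (fderiv ℝ (fderiv ℝ K) u) u :=
    ((hK.fderiv_right (m := ∞) (by simp)).differentiable (by simp) u).hasFDerivAt
  have hK' : ∀ w : E3, HasFDerivAt (fun u => fderiv ℝ K u w) ((fderiv ℝ (fderiv ℝ K) u).flip w) u :=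
    fun w => by simpa using hK2.clm_apply (hasFDerivAt_const w u)
  have hs : ∀ a b, fderiv ℝ (fderiv ℝ K) u a b = fderiv ℝ (fderiv ℝ K) u b a := fun a b =>
    (hK.contDiffAt.isSymmSndFDerivAt (by
      rw [minSmoothness_of_isRCLikeNormedField]; exact_mod_cast ENat.LEInfty.out)) a b
  have h1 : ∀ w : Fin 2 → E3, fderiv ℝ (fun u => F u w) u =
      β (L u) • (L (w 1) • (fderiv ℝ (fderiv ℝ K) u).flip (w 0) -
        L (w 0) • (fderiv ℝ (fderiv ℝ K) u).flip (w 1)) +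
      (fderiv ℝ K u (w 0) * L (w 1) - fderiv ℝ K u (w 1) * L (w 0)) • deriv β (L u) • L := by
    intro w
    have h2 : (fun u => F u w) =ᶠ[𝓝 u] fun u =>
      β (L u) * (fderiv ℝ K u (w 0) * L (w 1) - fderiv ℝ K u (w 1) * L (w 0)) := by
      filter_upwards [h] with u hu using hu w
    rw [h2.fderiv_eq]
    exact (hβ'.mul (((hK' (w 0)).mul_const _).sub ((hK' (w 1)).mul_const _))).fderiv
  rw [extDeriv_apply hF, Fin.sum_univ_three, h1, h1, h1]
  have hrm : ((0 : Fin 3).removeNth v 0 = v 1) ∧ ((0 : Fin 3).removeNth v 1 = v 2) ∧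
    ((1 : Fin 3).removeNth v 0 = v 0) ∧ ((1 : Fin 3).removeNth v 1 = v 2) ∧
    ((2 : Fin 3).removeNth v 0 = v 0) ∧ ((2 : Fin 3).removeNth v 1 = v 1) :=
    ⟨rfl, rfl, rfl, rfl, rfl, rfl⟩
  simp only [hrm, add_apply, sub_apply, smul_apply, smul_eq_mul,
    ContinuousLinearMap.flip_apply]
  rw [hs (v 1) (v 0), hs (v 2) (v 0), hs (v 2) (v 1)]
  simp
  ring

/-- Transverse coordinates around the curve with coordinates `(s, ζ₁ s, ζ₂ s)`. -/
noncomputable def wmap (e : Module.Basis (Fin 3) ℝ E3) (ζ₁ ζ₂ : ℝ → ℝ) (u : E3) : ℝ × ℝ :=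
  (co e 1 u - ζ₁ (co e 0 u), co e 2 u - ζ₂ (co e 0 u))

noncomputable def dwmap (e : Module.Basis (Fin 3) ℝ E3) (ζ₁ ζ₂ : ℝ → ℝ) (u : E3) : E3 →L[ℝ] ℝ × ℝ :=
  (co e 1 - deriv ζ₁ (co e 0 u) • co e 0).prod (co e 2 - deriv ζ₂ (co e 0 u) • co e 0)

theorem dwmap_one (e : Module.Basis (Fin 3) ℝ E3) (ζ₁ ζ₂ : ℝ → ℝ) (u : E3) :
    dwmap e ζ₁ ζ₂ u (e 1) = (1, 0) := by
  simp [dwmap, co_basis]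

theorem dwmap_two (e : Module.Basis (Fin 3) ℝ E3) (ζ₁ ζ₂ : ℝ → ℝ) (u : E3) :
    dwmap e ζ₁ ζ₂ u (e 2) = (0, 1) := by
  simp [dwmap, co_basis]

theorem contDiff_wmap (e : Module.Basis (Fin 3) ℝ E3) {ζ₁ ζ₂ : ℝ → ℝ} (h₁ : ContDiff ℝ ∞ ζ₁)
    (h₂ : ContDiff ℝ ∞ ζ₂) : ContDiff ℝ ∞ (wmap e ζ₁ ζ₂) :=
  ((co e 1).contDiff.sub (h₁.comp (co e 0).contDiff)).prodMk
    ((co e 2).contDiff.sub (h₂.comp (co e 0).contDiff))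

theorem hasFDerivAt_wmap (e : Module.Basis (Fin 3) ℝ E3) {ζ₁ ζ₂ : ℝ → ℝ} (h₁ : ContDiff ℝ ∞ ζ₁)
    (h₂ : ContDiff ℝ ∞ ζ₂) (u : E3) : HasFDerivAt (wmap e ζ₁ ζ₂) (dwmap e ζ₁ ζ₂ u) u := by
  have key : ∀ {ζ : ℝ → ℝ}, ContDiff ℝ ∞ ζ →
      HasFDerivAt (fun u => ζ (co e 0 u)) (deriv ζ (co e 0 u) • co e 0) u := fun h =>
    (h.differentiable (by simp) _).hasDerivAt.comp_hasFDerivAt u (co e 0).hasFDerivAt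
  exact (((co e 1).hasFDerivAt).sub (key h₁)).prodMk (((co e 2).hasFDerivAt).sub (key h₂))

/-- The Hamiltonian `δ² h(w/δ)`. -/
noncomputable def ham (h : ℝ × ℝ → ℝ) (δ : ℝ) (w : E3 → ℝ × ℝ) (u : E3) : ℝ :=
  δ ^ 2 * h (δ⁻¹ • w u)

theorem contDiff_ham {h : ℝ × ℝ → ℝ} (hh : ContDiff ℝ ∞ h) (δ : ℝ) {w : E3 → ℝ × ℝ}
    (hw : ContDiff ℝ ∞ w) : ContDiff ℝ ∞ (ham h δ w) :=
  contDiff_const.mul (hh.comp (hw.const_smul δ⁻¹))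

/-- Of the factor `δ²`, each differentiation consumes one power of `δ`. The first derivative is
`O(δ)`, and the second is that of `h`, independent of `δ` in size. -/
theorem fderiv_ham {h : ℝ × ℝ → ℝ} (hh : ContDiff ℝ ∞ h) {δ : ℝ} (hδ : 0 < δ) {w : E3 → ℝ × ℝ}
    {u : E3} {w' : E3 →L[ℝ] ℝ × ℝ} (hw : HasFDerivAt w w' u) (v : E3) :
    fderiv ℝ (ham h δ w) u v = δ * fderiv ℝ h (δ⁻¹ • w u) (w' v) := by
  have h1 : HasFDerivAt (ham h δ w)
      (δ ^ 2 • (fderiv ℝ h (δ⁻¹ • w u)).comp (δ⁻¹ • w')) u :=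
    ((hh.differentiable (by simp) (δ⁻¹ • w u)).hasFDerivAt.comp u (hw.const_smul δ⁻¹)).const_mul _
  rw [h1.fderiv]
  simp only [smul_apply, ContinuousLinearMap.comp_apply, smul_eq_mul, map_smul]
  field_simp

/-- The field `b X_K`, where `X_K` is the Hamiltonian field of `K` in the planes of `e₁`, `e₂`. -/
noncomputable def hamField (e : Module.Basis (Fin 3) ℝ E3) (b K : E3 → ℝ) (u : E3) : E3 :=
  b u • (fderiv ℝ K u (e 2) • e 1 - fderiv ℝ K u (e 1) • e 2)

theorem contDiffAt_hamField (e : Module.Basis (Fin 3) ℝ E3) {k : ℕ∞} {b K : E3 → ℝ} {u : E3}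
    (hb : ContDiffAt ℝ k b u) (hK : ContDiff ℝ ∞ K) : ContDiffAt ℝ k (hamField e b K) u := by
  have h1 : ContDiffAt ℝ k (fderiv ℝ K) u :=
    ((hK.fderiv_right (m := ∞) (by simp)).of_le (by exact_mod_cast le_top)).contDiffAt
  exact hb.smul (((h1.clm_apply contDiffAt_const).smul contDiffAt_const).sub
    ((h1.clm_apply contDiffAt_const).smul contDiffAt_const))

section Ham

variable {e : Module.Basis (Fin 3) ℝ E3} {ζ₁ ζ₂ : ℝ → ℝ} {h : ℝ × ℝ → ℝ} {δ : ℝ}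

theorem hamField_ham (h₁ : ContDiff ℝ ∞ ζ₁) (h₂ : ContDiff ℝ ∞ ζ₂)
    (hh : ContDiff ℝ ∞ h) (hδ : 0 < δ) (b : E3 → ℝ) (u : E3) :
    hamField e b (ham h δ (wmap e ζ₁ ζ₂)) u =
      b u • ((δ * fderiv ℝ h (δ⁻¹ • wmap e ζ₁ ζ₂ u) (0, 1)) • e 1 -
        (δ * fderiv ℝ h (δ⁻¹ • wmap e ζ₁ ζ₂ u) (1, 0)) • e 2) := by
  have hw := hasFDerivAt_wmap e h₁ h₂ u
  rw [hamField, fderiv_ham hh hδ hw, fderiv_ham hh hδ hw, dwmap_one, dwmap_two]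

/-- The derivative of the coefficient `b` comes with a factor `δ`, whereas the second derivatives of
`h` are multiplied by `b` itself. Hence only the supremum of `b` matters as `δ` tends to `0`. -/
theorem fderiv_hamField_ham (h₁ : ContDiff ℝ ∞ ζ₁) (h₂ : ContDiff ℝ ∞ ζ₂)
    (hh : ContDiff ℝ ∞ h) (hδ : 0 < δ) {b : E3 → ℝ} {u : E3} (hb : DifferentiableAt ℝ b u) (v : E3) :
    fderiv ℝ (hamField e b (ham h δ (wmap e ζ₁ ζ₂))) u v =
      fderiv ℝ b u v • ((δ * fderiv ℝ h (δ⁻¹ • wmap e ζ₁ ζ₂ u) (0, 1)) • e 1 -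
        (δ * fderiv ℝ h (δ⁻¹ • wmap e ζ₁ ζ₂ u) (1, 0)) • e 2) +
      b u • (fderiv ℝ (fderiv ℝ h) (δ⁻¹ • wmap e ζ₁ ζ₂ u) (dwmap e ζ₁ ζ₂ u v) (0, 1) • e 1 -
        fderiv ℝ (fderiv ℝ h) (δ⁻¹ • wmap e ζ₁ ζ₂ u) (dwmap e ζ₁ ζ₂ u v) (1, 0) • e 2) := by
  have hw := hasFDerivAt_wmap e h₁ h₂ u
  rw [funext (hamField_ham h₁ h₂ hh hδ b)]
  have h1 : HasFDerivAt (fderiv ℝ h) (fderiv ℝ (fderiv ℝ h) (δ⁻¹ • wmap e ζ₁ ζ₂ u))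
      (δ⁻¹ • wmap e ζ₁ ζ₂ u) :=
    ((hh.fderiv_right (m := ∞) (by simp)).differentiable (by simp) _).hasFDerivAt
  have h2 := h1.comp u (hw.const_smul δ⁻¹)
  have h3 : ∀ y : ℝ × ℝ, HasFDerivAt (fun u => δ * fderiv ℝ h (δ⁻¹ • wmap e ζ₁ ζ₂ u) y)
      ((((fderiv ℝ (fderiv ℝ h) (δ⁻¹ • wmap e ζ₁ ζ₂ u)).flip y).comp (dwmap e ζ₁ ζ₂ u))) u := by
    intro y
    have h4 := (h2.clm_apply (hasFDerivAt_const y u)).const_mul δ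
    refine h4.congr_fderiv ?_
    ext v
    simp only [smul_apply, add_apply, ContinuousLinearMap.comp_apply,
      ContinuousLinearMap.flip_apply, map_smul, smul_eq_mul, zero_apply, map_zero, comp_apply]
    field_simp
    simp
  have h5 := hb.hasFDerivAt.smul (((h3 (0, 1)).smul_const (e 1)).sub ((h3 (1, 0)).smul_const (e 2)))
  have h6 := h5.fderiv
  refine (congrArg (fun L : E3 →L[ℝ] E3 => L v) h6).trans ?_
  simp only [add_apply, sub_apply, smul_apply, ContinuousLinearMap.smulRight_apply,
    ContinuousLinearMap.comp_apply, ContinuousLinearMap.flip_apply]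
  abel

end Ham

end Franks
-- Cut-off quadratic Hamiltonians and estimates in the metric.
namespace Franks

open Filter Topology

/-- A compactly supported function on the plane with prescribed Hessian at the origin. -/
structure IsBumpJet (h : ℝ × ℝ → ℝ) (H : ℝ × ℝ →L[ℝ] ℝ × ℝ →L[ℝ] ℝ) (Q : ℝ) : Prop where
  smooth : ContDiff ℝ ∞ h
  supp : ∀ y, 1 < ‖y‖ → h y = 0
  d1 : ∀ y, ‖fderiv ℝ h y‖ ≤ Q
  d2 : ∀ y, ‖fderiv ℝ (fderiv ℝ h) y‖ ≤ Q
  crit : fderiv ℝ h 0 = 0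
  hess : fderiv ℝ (fderiv ℝ h) 0 = H

theorem exists_bound_fderiv {E F : Type*} [NormedAddCommGroup E] [NormedSpace ℝ E]
    [NormedAddCommGroup F] [NormedSpace ℝ F] {f : E → F} (hf : ContDiff ℝ ∞ f)
    (hc : HasCompactSupport f) : ∃ Q, ∀ y, ‖fderiv ℝ f y‖ ≤ Q :=
  (hc.fderiv ℝ).exists_bound_of_continuous (hf.continuous_fderiv (by simp))

/-- A bump function times `H y y / 2`; symmetry of `H` makes the derivative of the quadratic form
equal to `H y`. -/
theorem exists_isBumpJet (H : ℝ × ℝ →L[ℝ] ℝ × ℝ →L[ℝ] ℝ) (hH : ∀ a b, H a b = H b a) :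
    ∃ h Q, IsBumpJet h H Q := by
  obtain ⟨q, hq, hqd⟩ : ∃ q : ℝ × ℝ → ℝ, ContDiff ℝ ∞ q ∧ ∀ y, fderiv ℝ q y = H y := by
    refine ⟨fun y => 1 / 2 * H y y, contDiff_const.mul (H.contDiff.clm_apply contDiff_id),
      fun y => ?_⟩
    have h1 := ((H.hasFDerivAt (x := y)).clm_apply (hasFDerivAt_id y)).const_mul (1 / 2 : ℝ)
    have h2 : HasFDerivAt (fun y => 1 / 2 * H y y) (H y) y := by
      refine h1.congr_fderiv (ContinuousLinearMap.ext fun v => ?_)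
      simp only [smul_apply, add_apply, ContinuousLinearMap.comp_apply, smul_eq_mul,
        ContinuousLinearMap.flip_apply, ContinuousLinearMap.id_apply, hH v y, id]
      ring
    exact h2.fderiv
  obtain ⟨h, hh, hc, hs, h0⟩ : ∃ h : ℝ × ℝ → ℝ, ContDiff ℝ ∞ h ∧ HasCompactSupport h ∧
      (∀ y, 1 < ‖y‖ → h y = 0) ∧ h =ᶠ[𝓝 0] q := by
    let χ : ContDiffBump (0 : ℝ × ℝ) := ⟨1 / 2, 1, by norm_num, by norm_num⟩
    refine ⟨fun y => χ y * q y, χ.contDiff.mul hq, χ.hasCompactSupport.mul_right, fun y hy => ?_, ?_⟩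
    · show χ y * q y = 0
      rw [χ.zero_of_le_dist (by rw [dist_zero_right]; exact hy.le), zero_mul]
    · filter_upwards [χ.eventuallyEq_one] with y hy
      show χ y * q y = q y
      rw [hy, Pi.one_apply, one_mul]
  have hh1 : ContDiff ℝ ∞ (fderiv ℝ h) := hh.fderiv_right (m := ∞) (by simp)
  obtain ⟨Q₁, hQ₁⟩ := exists_bound_fderiv hh hc
  obtain ⟨Q₂, hQ₂⟩ := exists_bound_fderiv hh1 (hc.fderiv ℝ)
  have h1 : fderiv ℝ h =ᶠ[𝓝 0] fun y => H y := by
    filter_upwards [h0.fderiv (𝕜 := ℝ)] with y hy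
    rw [hy, hqd]
  refine ⟨h, max Q₁ Q₂, { smooth := hh, supp := hs, d1 := ?_, d2 := ?_, crit := ?_, hess := ?_ }⟩
  · exact fun y => (hQ₁ y).trans (le_max_left _ _)
  · exact fun y => (hQ₂ y).trans (le_max_right _ _)
  · have : fderiv ℝ h 0 = H 0 := h1.eq_of_nhds
    rw [this, ContinuousLinearMap.map_zero]
  · rw [h1.fderiv_eq]
    exact H.fderiv

section Norm

variable {B : E3 →L[ℝ] E3 →L[ℝ] ℝ}

theorem bilin_cauchy_schwarz (hB : ∀ V W, B V W = B W V) (h0 : ∀ V, 0 ≤ B V V) (V W : E3) :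
    |B V W| ≤ √(B V V) * √(B W W) := by
  rw [← Real.sqrt_mul (h0 V)]
  refine Real.abs_le_sqrt ?_
  have h1 : ∀ t : ℝ, 0 ≤ B W W * (t * t) + 2 * B V W * t + B V V := fun t => by
    have := h0 (V + t • W)
    simp only [map_add, map_smul, add_apply, smul_apply, smul_eq_mul, hB W V] at this
    linarith
  have := discrim_le_zero h1
  rw [discrim] at this
  nlinarith

theorem bilin_sqrt_smul (a : ℝ) (V : E3) : √(B (a • V) (a • V)) = |a| * √(B V V) := by
  rw [map_smul, map_smul, smul_apply, smul_eq_mul, smul_eq_mul, ← mul_assoc, ← pow_two,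
    Real.sqrt_mul (sq_nonneg a), Real.sqrt_sq_eq_abs]

theorem bilin_sqrt_add (hB : ∀ V W, B V W = B W V) (h0 : ∀ V, 0 ≤ B V V) (V W : E3) :
    √(B (V + W) (V + W)) ≤ √(B V V) + √(B W W) := by
  refine Real.sqrt_le_iff.2 ⟨by positivity, ?_⟩
  have h1 := (abs_le.1 (bilin_cauchy_schwarz hB h0 V W)).2
  have h2 := Real.sq_sqrt (h0 V)
  have h3 := Real.sq_sqrt (h0 W)
  simp only [map_add, add_apply, hB W V]
  nlinarith

/-- The shape `a (b V - d W)` is that of a Hamiltonian field and of both summands of its derivative.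
-/
theorem bilin_sqrt_comb (hB : ∀ V W, B V W = B W V) (h0 : ∀ V, 0 ≤ B V V) {C p r : ℝ}
    {V W : E3} (hV : √(B V V) ≤ C) (hW : √(B W W) ≤ C) {a b d : ℝ} (hp : |a| ≤ p) (hr : |b| ≤ r)
    (hr' : |d| ≤ r) :
    √(B (a • (b • V - d • W)) (a • (b • V - d • W))) ≤ p * (r * (2 * C)) := by
  have hC : 0 ≤ C := (Real.sqrt_nonneg _).trans hV
  have hp0 : 0 ≤ p := (abs_nonneg _).trans hp
  have hr0 : 0 ≤ r := (abs_nonneg _).trans hr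
  rw [bilin_sqrt_smul]
  refine mul_le_mul hp ?_ (Real.sqrt_nonneg _) hp0
  rw [sub_eq_add_neg, ← neg_smul]
  refine (bilin_sqrt_add hB h0 _ _).trans ?_
  rw [bilin_sqrt_smul, bilin_sqrt_smul, abs_neg]
  have h1 := mul_le_mul hr hV (Real.sqrt_nonneg _) hr0
  have h2 := mul_le_mul hr' hW (Real.sqrt_nonneg _) hr0
  linarith

end Norm

-- The derivative of `Z` is measured in the metric, where constants matter. The three Christoffel
-- terms are linear in `Z`, which will be `O(δ)`, so crude Euclidean bounds suffice for them; they
-- give the factor `3 / 2`.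
set_option maxSynthPendingDepth 5 in
theorem nablaIn_le {G : E3 → E3 →L[ℝ] E3 →L[ℝ] ℝ} {Z : E3 → E3} {u : E3} {R c d r : ℝ}
    (hB : ∀ V W, G u V W = G u W V) (h0 : ∀ V, 0 ≤ G u V V) (hR : ‖fderiv ℝ G u‖ ≤ R)
    (hc : ∀ V, ‖V‖ ≤ c * √(G u V V)) (hZ : ‖Z u‖ ≤ d)
    (hD : ∀ V, √(G u V V) ≤ 1 → √(G u (fderiv ℝ Z u V) (fderiv ℝ Z u V)) ≤ r)
    {V W : E3} (hV : √(G u V V) ≤ 1) (hW : √(G u W W) ≤ 1) (hc0 : 0 ≤ c) :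
    |nablaIn G Z u V W| ≤ r + 3 / 2 * (R * d * c ^ 2) := by
  have hd : 0 ≤ d := (norm_nonneg _).trans hZ
  have hR0 : 0 ≤ R := (norm_nonneg _).trans hR
  have hV' : ‖V‖ ≤ c := (hc V).trans (mul_le_of_le_one_right hc0 hV)
  have hW' : ‖W‖ ≤ c := (hc W).trans (mul_le_of_le_one_right hc0 hW)
  have h1 : |G u (fderiv ℝ Z u V) W| ≤ r := by
    refine (bilin_cauchy_schwarz hB h0 _ _).trans ?_
    have := mul_le_mul (hD V hV) hW (Real.sqrt_nonneg _) ((Real.sqrt_nonneg _).trans (hD V hV))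
    linarith
  have h2 : ∀ x y z : E3, |fderiv ℝ G u x y z| ≤ R * ‖x‖ * ‖y‖ * ‖z‖ := fun x y z => by
    rw [← Real.norm_eq_abs]
    refine ((fderiv ℝ G u x).le_opNorm₂ y z).trans ?_
    gcongr
    exact (fderiv ℝ G u).le_of_opNorm_le hR x
  have h3 : ∀ {x y : ℝ}, 0 ≤ x → 0 ≤ y → x ≤ c → y ≤ c → R * d * (x * y) ≤ R * d * c ^ 2 := by
    intro x y hx hy hxc hyc
    rw [pow_two]
    gcongr
  have ha := h2 (Z u) V W
  have hb := h2 V (Z u) W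
  have hc' := h2 W (Z u) V
  have hVW := h3 (norm_nonneg V) (norm_nonneg W) hV' hW'
  have ha' : |fderiv ℝ G u (Z u) V W| ≤ R * d * c ^ 2 := ha.trans (le_trans (by
    rw [mul_assoc (R * ‖Z u‖)]; gcongr) hVW)
  have hb' : |fderiv ℝ G u V (Z u) W| ≤ R * d * c ^ 2 := hb.trans (le_trans (by
    rw [show R * ‖V‖ * ‖Z u‖ * ‖W‖ = R * ‖Z u‖ * (‖V‖ * ‖W‖) by ring]; gcongr) hVW)
  have hc'' : |fderiv ℝ G u W (Z u) V| ≤ R * d * c ^ 2 := hc'.trans (le_trans (by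
    rw [show R * ‖W‖ * ‖Z u‖ * ‖V‖ = R * ‖Z u‖ * (‖V‖ * ‖W‖) by ring]; gcongr) hVW)
  rw [nablaIn]
  rw [abs_le] at *
  constructor <;> linarith [h1.1, h1.2, ha'.1, ha'.2, hb'.1, hb'.2, hc''.1, hc''.2]

end Franks
-- Exactness of Hamiltonian fields in a chart.
namespace Franks

open Filter Topology

variable {M : Type*} [TopologicalSpace M] [ChartedSpace E3 M] [IsManifold (𝓡 3) ∞ M]

/-- A `C^k` exact divergence-free field, supported in `F` and of `C¹` size `r`. -/
structure IsPiece (g : RMetric M) (μ : DForm M 3) (k : ℕ∞) (F : Set M) (r : ℝ) (Z : VField M) :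
    Prop where
  field : IsCkField k Z
  volumePreserving : IsVolumePreserving μ Z
  exact : IsExactField k μ Z
  eq_zero : ∀ q ∉ F, Z q = 0
  len_le : ∀ q, len g (Z q) ≤ r
  nabla_le : ∀ q (V W : TangentSpace (𝓡 3) q), len g V ≤ 1 → len g W ≤ 1 →
    |nablaInner g Z q V W| ≤ r

/-- A Hamiltonian field in a chart defines an exact divergence-free field. -/
theorem hamField_exact [T2Space M] {μ : DForm M 3} (hμ : IsCkForm ⊤ μ) {k : ℕ∞} (hk : 1 ≤ k)
    {x : M} {e : Module.Basis (Fin 3) ℝ E3} {β : ℝ → ℝ} (hβ : ContDiff ℝ k β) {K : E3 → ℝ}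
    (hK : ContDiff ℝ ∞ K) {S : Set E3} (hS : IsCompact S) (hSt : S ⊆ (extChartAt (𝓡 3) x).target)
    (hSK : ∀ u ∉ S, β (co e 0 u) * K u = 0)
    (hSz : ∀ u ∉ S, hamField e (fun u => β (co e 0 u) / formInChart μ x u e) K u = 0)
    (hm : ∀ u ∈ S, formInChart μ x u e ≠ 0)
    (hz : ContDiff ℝ k (hamField e (fun u => β (co e 0 u) / formInChart μ x u e) K)) :
    IsCkField k (pieceField x (hamField e (fun u => β (co e 0 u) / formInChart μ x u e) K)) ∧
    IsVolumePreserving μ (pieceField x (hamField e (fun u => β (co e 0 u) / formInChart μ x u e) K))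
    ∧ IsExactField k μ
      (pieceField x (hamField e (fun u => β (co e 0 u) / formInChart μ x u e) K)) := by
  obtain ⟨z, hzdef⟩ : ∃ z, z = hamField e (fun u => β (co e 0 u) / formInChart μ x u e) K :=
    ⟨_, rfl⟩
  rw [← hzdef] at hz hSz ⊢
  have hZ := isCkField_pieceField hz hS hSt hSz
  have hβ1 : ContDiff ℝ 1 β := hβ.of_le (by exact_mod_cast hk)
  have ha : ContDiff ℝ k fun u => (β (co e 0 u) * K u) • co e 0 :=
    ((hβ.comp (co e 0).contDiff).mul (hK.of_le (by exact_mod_cast le_top))).smul contDiff_const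
  have haS : ∀ u ∉ S, (β (co e 0 u) * K u) • co e 0 = 0 := fun u hu => by rw [hSK u hu, zero_smul]
  have hα := isCkForm_pieceForm ha hS hSt haS
  have hsupp : IsClosed ((extChartAt (𝓡 3) x).symm '' S) := isClosed_symm_image hS hSt
  have hω := (hμ.of_le (le_top : k ≤ ⊤)).contract hZ
  -- the contraction in the chart
  have hc : ∀ u ∈ (extChartAt (𝓡 3) x).target, ∀ v : Fin 2 → E3,
      formInChart (contract (pieceField x z) μ) x u v =
        β (co e 0 u) * (fderiv ℝ K u (v 0) * co e 0 (v 1) - fderiv ℝ K u (v 1) * co e 0 (v 0)) := by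
    intro u hu v
    have h1 := formInChart_contract (pieceField x z) μ ((extChartAt (𝓡 3) x).map_target hu)
    rw [(extChartAt (𝓡 3) x).right_inv hu, fieldInChart_pieceField hu] at h1
    rw [h1]
    have h2 := alternating_curryLeft_basis e (formInChart μ x u) (fderiv ℝ K u)
      (β (co e 0 u) / formInChart μ x u e) v
    by_cases huS : u ∈ S
    · rw [div_mul_cancel₀ _ (hm u huS)] at h2
      rw [← h2, hzdef]
      rfl
    -- Off `S` the density may vanish, so no division is possible. There `β K` is locally zero,
    -- hence `β dK` equals minus `K dβ`, a multiple of `e⁰`, and its wedge product with `e⁰` is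
    -- zero, as is the field.
    · have h3 : β (co e 0 u) * fderiv ℝ K u (v 0) * co e 0 (v 1) -
          β (co e 0 u) * fderiv ℝ K u (v 1) * co e 0 (v 0) = 0 := by
        have h4 : (fun u => (β (co e 0 u) * K u)) =ᶠ[𝓝 u] fun _ => 0 := by
          filter_upwards [hS.isClosed.isOpen_compl.mem_nhds huS] with u' hu' using hSK u' hu'
        have h5 : HasFDerivAt (fun u => β (co e 0 u)) (deriv β (co e 0 u) • co e 0) u :=
          ((hβ1.differentiable one_ne_zero _).hasDerivAt.comp_hasFDerivAt u (co e 0).hasFDerivAt)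
        have h6 := h5.mul (hK.differentiable (by simp) u).hasFDerivAt
        have h7 : ∀ w, β (co e 0 u) * fderiv ℝ K u w + K u * (deriv β (co e 0 u) * co e 0 w) = 0 := by
          intro w
          have h8 := h6.fderiv.symm.trans (h4.fderiv_eq.trans (hasFDerivAt_const 0 u).fderiv)
          have h9 := congrArg (fun L : E3 →L[ℝ] ℝ => L w) h8
          simpa using h9
        have h10 : ∀ w, β (co e 0 u) * fderiv ℝ K u w = - (K u * (deriv β (co e 0 u) * co e 0 w)) :=
          fun w => eq_neg_of_add_eq_zero_left (h7 w)
        rw [h10, h10]; ring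
      rw [hSz u huS, map_zero]
      show (0 : ℝ) = _
      linarith
  have hd : ∀ q ∈ (extChartAt (𝓡 3) x).source, DifferentiableAt ℝ
      (formInChart (contract (pieceField x z) μ) x) (extChartAt (𝓡 3) x q) := fun q hq =>
    hω.differentiableAt hk hq
  refine ⟨hZ, ?_, pieceForm x (fun u => (β (co e 0 u) * K u) • co e 0), hα, ?_⟩
  · funext q
    by_cases hq : q ∈ (extChartAt (𝓡 3) x).source
    · rw [extD_eq _ hq (hd q hq), extDeriv_eq_zero_of_eq (L := co e 0) hβ1 hK (hd q hq)]
      · rfl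
      · filter_upwards [(isOpen_extChartAt_target x).mem_nhds ((extChartAt (𝓡 3) x).map_source hq)]
          with u hu v using hc u hu v
    · refine extD_eq_zero ?_
      filter_upwards [hsupp.isOpen_compl.mem_nhds fun h => hq (symm_image_subset_source hSt h)]
        with q' hq'
      have : pieceField x z q' = 0 := pieceField_eq_zero hSz hq'
      ext v
      rw [contract_apply, this]
      exact (μ q').map_coord_zero 0 rfl
  · funext q
    by_cases hq : q ∈ (extChartAt (𝓡 3) x).source
    · have hu := (extChartAt (𝓡 3) x).map_source hq
      rw [extD_eq _ hq (hα.differentiableAt hk hq)]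
      ext v
      have h1 := formInChart_apply (contract (pieceField x z) μ) hq (fun i => toChart x q (v i))
      have h3 : (fun i => fromChart x q (toChart x q (v i))) = v :=
        funext fun i => fromChart_toChart hq (v i)
      refine Eq.trans ?_ (h1.trans (congrArg (contract (pieceField x z) μ q) h3))
      show extDeriv _ _ (fun i => (toChart x q (v i) : E3)) = _
      rw [hc _ hu]
      have h2 : formInChart (pieceForm x fun u => (β (co e 0 u) * K u) • co e 0) x
          =ᶠ[𝓝 (extChartAt (𝓡 3) x q)] fun u => ContinuousAlternatingMap.ofSubsingleton ℝ E3 ℝ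
            (0 : Fin 1) ((β (co e 0 u) * K u) • co e 0) := by
        filter_upwards [(isOpen_extChartAt_target x).mem_nhds hu] with u hu
        exact formInChart_pieceForm hu _
      rw [h2.extDeriv_eq]
      exact extDeriv_smul_covector hβ1 hK fun i => toChart x q (v i)
    · rw [extD_eq_zero]
      · ext v
        rw [contract_apply, pieceField_eq_zero hSz fun h => hq (symm_image_subset_source hSt h)]
        exact ((μ q).map_coord_zero 0 rfl).symm
      · filter_upwards [hsupp.isOpen_compl.mem_nhds fun h => hq (symm_image_subset_source hSt h)]
          with q' hq'
        exact pieceForm_eq_zero haS hq'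

end Franks
-- A single small piece supported in a thin tube.
namespace Franks

open Filter Topology

variable {M : Type*} [TopologicalSpace M] [ChartedSpace E3 M] [IsManifold (𝓡 3) ∞ M]

theorem metricForm_nonneg (g : RMetric M) (x : M) (u V : E3) : 0 ≤ metricForm g x u V V := by
  rw [metricForm_apply, metricInChart]
  obtain ⟨W, hW⟩ : ∃ W, W = fromChart x ((extChartAt (𝓡 3) x).symm u) V := ⟨_, rfl⟩
  rw [← hW]
  by_cases h : W = 0
  · rw [h, map_zero]
  · exact (g.pos _ W h).le

theorem len_eq (g : RMetric M) {x q : M} (hx : q ∈ (extChartAt (𝓡 3) x).source)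
    (V : TangentSpace (𝓡 3) q) : len g V =
      √(metricForm g x (extChartAt (𝓡 3) x q) (toChart x q V) (toChart x q V)) := by
  rw [metricForm_toChart g hx, len]

theorem contDiffOn_formInChart_apply {n : ℕ} {k : ℕ∞} {η : DForm M n} (hη : IsCkForm k η) (x : M)
    (v : Fin n → E3) :
    ContDiffOn ℝ k (fun u => formInChart η x u v) (extChartAt (𝓡 3) x).target :=
  (ContinuousAlternatingMap.apply ℝ E3 ℝ v).contDiff.comp_contDiffOn (hη x)

/-- The coordinates `(w, s)` have the explicit global inverse `Φ`, so a tube is the image of a ball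
times `A`, and compactness of `A` pushes thin tubes into `O`. -/
theorem exists_compact_tube (e : Module.Basis (Fin 3) ℝ E3) {ζ₁ ζ₂ : ℝ → ℝ} (h₁ : Continuous ζ₁)
    (h₂ : Continuous ζ₂) {A : Set ℝ} (hA : IsCompact A) {O : Set E3} (hO : IsOpen O)
    (hAO : ∀ s ∈ A, ∃ u ∈ O, co e 0 u = s ∧ wmap e ζ₁ ζ₂ u = 0) :
    ∃ δ > 0, ∀ δ' ≤ δ, IsCompact {u | co e 0 u ∈ A ∧ ‖wmap e ζ₁ ζ₂ u‖ ≤ δ'} ∧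
      {u | co e 0 u ∈ A ∧ ‖wmap e ζ₁ ζ₂ u‖ ≤ δ'} ⊆ O := by
  let Φ : (ℝ × ℝ) × ℝ → E3 := fun p =>
    p.2 • e 0 + (p.1.1 + ζ₁ p.2) • e 1 + (p.1.2 + ζ₂ p.2) • e 2
  have hΦ : Continuous Φ := by fun_prop
  have hΦu : ∀ u, Φ (wmap e ζ₁ ζ₂ u, co e 0 u) = u := fun u => by
    simp only [Φ, wmap, sub_add_cancel]
    exact (sum_co e u).symm
  have hco : ∀ p, co e 0 (Φ p) = p.2 := fun p => by simp [Φ, co_basis]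
  have hw : ∀ p, wmap e ζ₁ ζ₂ (Φ p) = p.1 := fun p => by
    simp only [wmap, hco]
    simp [Φ, co_basis]
  have h0 : ∀ s ∈ A, Φ (0, s) ∈ O := fun s hs => by
    obtain ⟨u, hu, hus, huw⟩ := hAO s hs
    rw [← huw, ← hus, hΦu]; exact hu
  have h3 : ∀ᶠ y in 𝓝 (0 : ℝ × ℝ), ∀ s ∈ A, Φ (y, s) ∈ O :=
    hA.eventually_forall_of_forall_eventually fun s hs =>
      hΦ.continuousAt.eventually (hO.mem_nhds (h0 s hs))
  obtain ⟨δ, hδ, hδO⟩ := Metric.nhds_basis_closedBall.eventually_iff.1 h3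
  refine ⟨δ, hδ, fun δ' hδ' => ⟨?_, fun u hu => ?_⟩⟩
  · have : {u | co e 0 u ∈ A ∧ ‖wmap e ζ₁ ζ₂ u‖ ≤ δ'} = Φ '' (Metric.closedBall 0 δ' ×ˢ A) := by
      ext u
      constructor
      · rintro ⟨h4, h5⟩
        exact ⟨(wmap e ζ₁ ζ₂ u, co e 0 u), ⟨by rwa [mem_closedBall_zero_iff], h4⟩, hΦu u⟩
      · rintro ⟨p, ⟨h4, h5⟩, rfl⟩
        refine ⟨by rw [hco]; exact h5, ?_⟩
        rw [hw]
        exact mem_closedBall_zero_iff.1 h4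
    rw [this]
    exact ((isCompact_closedBall _ _).prod hA).image hΦ
  · rw [← hΦu u]
    exact hδO (mem_closedBall_zero_iff.2 (hu.2.trans hδ')) _ hu.1

theorem norm_zero_one : ‖((0 : ℝ), (1 : ℝ))‖ = 1 := by simp [Prod.norm_def]
theorem norm_one_zero : ‖((1 : ℝ), (0 : ℝ))‖ = 1 := by simp [Prod.norm_def]

theorem IsBumpJet.fderiv_apply_le {h : ℝ × ℝ → ℝ} {H : ℝ × ℝ →L[ℝ] ℝ × ℝ →L[ℝ] ℝ} {Q : ℝ}
    (hh : IsBumpJet h H Q) {δ : ℝ} (hδ : 0 < δ) (y : ℝ × ℝ) {v : ℝ × ℝ} (hv : ‖v‖ = 1) :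
    |δ * fderiv ℝ h y v| ≤ δ * Q := by
  rw [abs_mul, abs_of_pos hδ]
  have := (fderiv ℝ h y).le_of_opNorm_le (hh.d1 y) v
  rw [hv, mul_one] at this
  exact mul_le_mul_of_nonneg_left this hδ.le

theorem IsBumpJet.fderiv_fderiv_apply_le {h : ℝ × ℝ → ℝ} {H : ℝ × ℝ →L[ℝ] ℝ × ℝ →L[ℝ] ℝ} {Q : ℝ}
    (hh : IsBumpJet h H Q) (y : ℝ × ℝ) {v w : ℝ × ℝ} (hv : ‖v‖ = 1) {b : ℝ} (hw : ‖w‖ ≤ b) :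
    |fderiv ℝ (fderiv ℝ h) y w v| ≤ Q * b := by
  have h1 := (fderiv ℝ (fderiv ℝ h) y).le_opNorm₂ w v
  rw [hv, mul_one] at h1
  exact h1.trans (mul_le_mul (hh.d2 y) hw (norm_nonneg _) ((norm_nonneg (fderiv ℝ (fderiv ℝ h) y)).trans (hh.d2 y)))

theorem IsBumpJet.fderiv_eq_zero {h : ℝ × ℝ → ℝ} {H : ℝ × ℝ →L[ℝ] ℝ × ℝ →L[ℝ] ℝ} {Q : ℝ}
    (hh : IsBumpJet h H Q) {y : ℝ × ℝ} (hy : 1 < ‖y‖) : fderiv ℝ h y = 0 := by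
  have h1 : h =ᶠ[𝓝 y] fun _ => 0 := by
    filter_upwards [(isOpen_lt continuous_const continuous_norm).mem_nhds hy] with y hy
    exact hh.supp y hy
  rw [h1.fderiv_eq]
  exact (hasFDerivAt_const 0 y).fderiv

set_option maxHeartbeats 1000000 in
set_option maxSynthPendingDepth 5 in
/-- A small divergence-free field with prescribed derivative along a curve in a chart. -/
theorem exists_isPiece [T2Space M] {g : RMetric M} {μ : DForm M 3} (hμ : IsCkForm ⊤ μ) {k : ℕ∞}
    (hk : 1 ≤ k) {x : M} {e : Module.Basis (Fin 3) ℝ E3} {ζ₁ ζ₂ : ℝ → ℝ} (h₁ : ContDiff ℝ ∞ ζ₁)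
    (h₂ : ContDiff ℝ ∞ ζ₂) {β : ℝ → ℝ} (hβ : ContDiff ℝ k β) (hβc : HasCompactSupport β)
    {N : Set E3} (hN : IsOpen N) (hNt : N ⊆ (extChartAt (𝓡 3) x).target)
    (hm : ∀ u ∈ N, formInChart μ x u e ≠ 0) {C ε R c Q : ℝ} (hC : 0 < C) (hε : 0 < ε) (hc0 : 0 ≤ c)
    (hQ : 0 < Q) (hb : ∀ u ∈ N, |β (co e 0 u) / formInChart μ x u e| ≤ ε)
    (hR : ∀ u ∈ N, ‖fderiv ℝ (metricForm g x) u‖ ≤ R)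
    (hc : ∀ u ∈ N, ∀ V, ‖V‖ ≤ c * √(metricForm g x u V V))
    (he₁ : ∀ u ∈ N, √(metricForm g x u (e 1) (e 1)) ≤ 2 * C)
    (he₂ : ∀ u ∈ N, √(metricForm g x u (e 2) (e 2)) ≤ 2 * C)
    (hd : ∀ u ∈ N, ∀ V, ‖dwmap e ζ₁ ζ₂ u V‖ ≤ 2 * C * √(metricForm g x u V V))
    {O : Set M} (hO : IsOpen O) (haxis : ∀ s ∈ tsupport β, ∃ u ∈ N,
      (extChartAt (𝓡 3) x).symm u ∈ O ∧ co e 0 u = s ∧ wmap e ζ₁ ζ₂ u = 0)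
    {h : ℝ × ℝ → ℝ} {H : ℝ × ℝ →L[ℝ] ℝ × ℝ →L[ℝ] ℝ} (hh : IsBumpJet h H Q) :
    ∃ F Z, IsClosed F ∧ F ⊆ O ∧ IsPiece g μ k F (9 * Q * C ^ 2 * ε) Z ∧
      ∀ u ∈ N, wmap e ζ₁ ζ₂ u = 0 → fieldInChart Z x u = 0 ∧
        ∀ v, fderiv ℝ (fieldInChart Z x) u v = (β (co e 0 u) / formInChart μ x u e) •
          (H (dwmap e ζ₁ ζ₂ u v) (0, 1) • e 1 - H (dwmap e ζ₁ ζ₂ u v) (1, 0) • e 2) := by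
  obtain ⟨b, hbdef⟩ : ∃ b : E3 → ℝ, b = fun u => β (co e 0 u) / formInChart μ x u e := ⟨_, rfl⟩
  have hbC : ContDiffOn ℝ k b N := by
    rw [hbdef]
    exact (hβ.comp (co e 0).contDiff).contDiffOn.div
      (((contDiffOn_formInChart_apply hμ x e).mono hNt).of_le (by exact_mod_cast le_top)) hm
  have hbA : ∀ u ∈ N, ContDiffAt ℝ k b u := fun u hu => hbC.contDiffAt (hN.mem_nhds hu)
  have hbD : ∀ u ∈ N, DifferentiableAt ℝ b u := fun u hu =>
    ((hbA u hu).of_le (by exact_mod_cast hk : ((1 : ℕ∞) : WithTop ℕ∞) ≤ k)).differentiableAt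
      one_ne_zero
  have hO1 : IsOpen (N ∩ ((extChartAt (𝓡 3) x).target ∩ (extChartAt (𝓡 3) x).symm ⁻¹' O)) :=
    hN.inter ((continuousOn_extChartAt_symm x).isOpen_inter_preimage (isOpen_extChartAt_target x) hO)
  obtain ⟨δ₀, hδ₀, hδ₀S⟩ := exists_compact_tube e h₁.continuous h₂.continuous hβc.isCompact hO1
    (fun s hs => by
      obtain ⟨u, hu, huO, h3⟩ := haxis s hs
      exact ⟨u, ⟨hu, hNt hu, huO⟩, h3⟩)
  -- `R'` bounds the derivative of `b` on the thickest tube. It is not controlled by `ε`, but is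
  -- fixed before `δ` is chosen and enters only multiplied by `δ`.
  obtain ⟨R', hR'⟩ := (hδ₀S δ₀ le_rfl).1.exists_bound_of_continuousOn
    (((hbC.of_le (by exact_mod_cast hk : ((1 : ℕ∞) : WithTop ℕ∞) ≤ k)).continuousOn_fderiv_of_isOpen
      hN le_rfl).mono fun u hu => ((hδ₀S δ₀ le_rfl).2 hu).1)
  -- `A` collects the coefficients of `δ` in the bound of `∇Z`: the derivative of `b` and the
  -- Christoffel terms. The main term is `8 Q C² ε`, and `δ A ≤ Q C² ε` raises it to `9 Q C² ε`; the
  -- bound `δ ≤ C` takes care of the length of the field.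
  obtain ⟨A, hA⟩ : ∃ A, A = |4 * |R'| * c * Q * C + 3 / 2 * (|R| * (ε * Q * (‖e 1‖ + ‖e 2‖)) * c ^ 2)| :=
    ⟨_, rfl⟩
  obtain ⟨δ, hδ, hδδ₀, hδC, hδA⟩ : ∃ δ > 0, δ ≤ δ₀ ∧ δ ≤ C ∧ δ * A ≤ Q * C ^ 2 * ε := by
    have hA0 : 0 ≤ A := hA ▸ abs_nonneg _
    refine ⟨min δ₀ (min C (Q * C ^ 2 * ε / (A + 1))), by positivity, min_le_left _ _,
      (min_le_right _ _).trans (min_le_left _ _), ?_⟩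
    have h3 : min δ₀ (min C (Q * C ^ 2 * ε / (A + 1))) ≤ Q * C ^ 2 * ε / (A + 1) :=
      (min_le_right _ _).trans (min_le_right _ _)
    refine (mul_le_mul_of_nonneg_right h3 hA0).trans ?_
    rw [div_mul_eq_mul_div]
    exact div_le_of_le_mul₀ (by positivity) (by positivity)
      (mul_le_mul_of_nonneg_left (by linarith) (by positivity))
  obtain ⟨S, hSdef⟩ : ∃ S, S = {u | co e 0 u ∈ tsupport β ∧ ‖wmap e ζ₁ ζ₂ u‖ ≤ δ} := ⟨_, rfl⟩
  have hScpt : IsCompact S := hSdef ▸ (hδ₀S δ hδδ₀).1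
  have hSO : S ⊆ N ∩ ((extChartAt (𝓡 3) x).target ∩ (extChartAt (𝓡 3) x).symm ⁻¹' O) :=
    hSdef ▸ (hδ₀S δ hδδ₀).2
  have hSb : ∀ u ∈ S, ‖fderiv ℝ b u‖ ≤ |R'| := fun u hu => by
    rw [hSdef] at hu
    exact (hR' u ⟨hu.1, hu.2.trans hδδ₀⟩).trans (le_abs_self _)
  obtain ⟨K, hKdef⟩ : ∃ K, K = ham h δ (wmap e ζ₁ ζ₂) := ⟨_, rfl⟩
  have hK : ContDiff ℝ ∞ K := hKdef ▸ contDiff_ham hh.smooth δ (contDiff_wmap e h₁ h₂)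
  have hzf : ∀ u, hamField e b K u = b u • ((δ * fderiv ℝ h (δ⁻¹ • wmap e ζ₁ ζ₂ u) (0, 1)) • e 1 -
      (δ * fderiv ℝ h (δ⁻¹ • wmap e ζ₁ ζ₂ u) (1, 0)) • e 2) := fun u => by
    rw [hKdef]; exact hamField_ham h₁ h₂ hh.smooth hδ b u
  have hout : ∀ u ∉ S, β (co e 0 u) = 0 ∨ 1 < ‖δ⁻¹ • wmap e ζ₁ ζ₂ u‖ := by
    intro u hu
    by_contra! hcon
    refine hu ?_
    rw [hSdef]
    refine ⟨subset_tsupport _ hcon.1, ?_⟩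
    have := hcon.2
    rwa [norm_smul, norm_inv, Real.norm_of_nonneg hδ.le, inv_mul_le_iff₀ hδ, mul_one] at this
  have hSK : ∀ u ∉ S, β (co e 0 u) * K u = 0 := fun u hu => by
    rcases hout u hu with h3 | h3
    · rw [h3, zero_mul]
    · rw [hKdef, ham, hh.supp _ h3, mul_zero, mul_zero]
  have hSz : ∀ u ∉ S, hamField e b K u = 0 := fun u hu => by
    rw [hzf]
    rcases hout u hu with h3 | h3
    · rw [hbdef]; simp only [h3, zero_div, zero_smul]
    · rw [hh.fderiv_eq_zero h3]; simp
  have hz : ContDiff ℝ k (hamField e b K) := by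
    refine contDiff_iff_contDiffAt.2 fun u => ?_
    by_cases hu : u ∈ S
    · exact contDiffAt_hamField e (hbA u (hSO hu).1) hK
    · refine (contDiffAt_const (c := (0 : E3))).congr_of_eventuallyEq ?_
      filter_upwards [hScpt.isClosed.isOpen_compl.mem_nhds hu] with u' hu' using hSz u' hu'
  have hSt : S ⊆ (extChartAt (𝓡 3) x).target := fun u hu => (hSO hu).2.1
  have hex := hamField_exact hμ hk hβ hK hScpt hSt hSK (by rw [← hbdef]; exact hSz)
    (fun u hu => hm u (hSO hu).1) (by rw [← hbdef]; exact hz)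
  rw [← hbdef] at hex
  have hF : IsClosed ((extChartAt (𝓡 3) x).symm '' S) := isClosed_symm_image hScpt hSt
  have hch : ∀ u ∈ (extChartAt (𝓡 3) x).target,
      fieldInChart (pieceField x (hamField e b K)) x =ᶠ[𝓝 u] hamField e b K := fun u hu => by
    filter_upwards [(isOpen_extChartAt_target x).mem_nhds hu] with u hu
    exact fieldInChart_pieceField hu _
  have hsm : ∀ u V W, metricForm g x u V W = metricForm g x u W V := metricForm_symm g x
  have hnn : ∀ u V, 0 ≤ metricForm g x u V V := metricForm_nonneg g x
  have hr0 : 0 ≤ 9 * Q * C ^ 2 * ε := by positivity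
  have hbε : ∀ u ∈ N, |b u| ≤ ε := by rw [hbdef]; exact hb
  have hlen : ∀ u ∈ S, √(metricForm g x u (hamField e b K u) (hamField e b K u)) ≤
      9 * Q * C ^ 2 * ε := fun u hu => by
    have huN := (hSO hu).1
    rw [hzf]
    refine (bilin_sqrt_comb (hsm u) (hnn u) (he₁ u huN) (he₂ u huN) (hbε u huN)
      (hh.fderiv_apply_le hδ _ norm_zero_one) (hh.fderiv_apply_le hδ _ norm_one_zero)).trans ?_
    have : ε * (δ * Q * (2 * (2 * C))) = 4 * (Q * C * ε) * δ := by ring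
    rw [this]
    have h4 := mul_le_mul_of_nonneg_left hδC (by positivity : 0 ≤ 4 * (Q * C * ε))
    nlinarith [mul_pos (mul_pos hQ (mul_pos hC hC)) hε]
  have hnorm : ∀ u ∈ S, ‖hamField e b K u‖ ≤ δ * (ε * Q * (‖e 1‖ + ‖e 2‖)) := fun u hu => by
    rw [hzf, norm_smul]
    have h4 := hbε u (hSO hu).1
    have h5 := hh.fderiv_apply_le hδ (δ⁻¹ • wmap e ζ₁ ζ₂ u) norm_zero_one
    have h6 := hh.fderiv_apply_le hδ (δ⁻¹ • wmap e ζ₁ ζ₂ u) norm_one_zero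
    have h7 := norm_sub_le ((δ * fderiv ℝ h (δ⁻¹ • wmap e ζ₁ ζ₂ u) (0, 1)) • e 1)
      ((δ * fderiv ℝ h (δ⁻¹ • wmap e ζ₁ ζ₂ u) (1, 0)) • e 2)
    rw [norm_smul, norm_smul, Real.norm_eq_abs, Real.norm_eq_abs] at h7
    have h8 := mul_le_mul_of_nonneg_right h5 (norm_nonneg (e 1))
    have h9 := mul_le_mul_of_nonneg_right h6 (norm_nonneg (e 2))
    calc _ ≤ ε * (δ * Q * ‖e 1‖ + δ * Q * ‖e 2‖) :=
          mul_le_mul h4 (by linarith) (norm_nonneg _) hε.le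
      _ = _ := by ring
  have hD : ∀ u ∈ S, ∀ V, √(metricForm g x u V V) ≤ 1 →
      √(metricForm g x u (fderiv ℝ (hamField e b K) u V) (fderiv ℝ (hamField e b K) u V)) ≤
        4 * |R'| * c * Q * C * δ + 8 * Q * C ^ 2 * ε := fun u hu V hV => by
    have huN := (hSO hu).1
    have h4 := fderiv_hamField_ham (e := e) h₁ h₂ hh.smooth hδ (hbD u huN) V
    rw [← hKdef] at h4
    rw [h4]
    have hVn : ‖V‖ ≤ c := (hc u huN V).trans (mul_le_of_le_one_right hc0 hV)
    have h5 : |fderiv ℝ b u V| ≤ |R'| * c := by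
      rw [← Real.norm_eq_abs]
      exact ((fderiv ℝ b u).le_of_opNorm_le (hSb u hu) V).trans
        (mul_le_mul_of_nonneg_left hVn (abs_nonneg _))
    have h6 : ‖dwmap e ζ₁ ζ₂ u V‖ ≤ 2 * C :=
      (hd u huN V).trans (mul_le_of_le_one_right (by positivity) hV)
    refine (bilin_sqrt_add (hsm u) (hnn u) _ _).trans ((add_le_add
      (bilin_sqrt_comb (hsm u) (hnn u) (he₁ u huN) (he₂ u huN) h5
        (hh.fderiv_apply_le hδ _ norm_zero_one) (hh.fderiv_apply_le hδ _ norm_one_zero))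
      (bilin_sqrt_comb (hsm u) (hnn u) (he₁ u huN) (he₂ u huN) (hbε u huN)
        (hh.fderiv_fderiv_apply_le _ norm_zero_one h6)
        (hh.fderiv_fderiv_apply_le _ norm_one_zero h6))).trans (le_of_eq ?_))
    ring
  refine ⟨_, pieceField x (hamField e b K), hF, ?_, ⟨hex.1, hex.2.1, hex.2.2, fun q hq =>
    pieceField_eq_zero hSz hq, fun q => ?_, fun q V W hV hW => ?_⟩, fun u hu huw => ?_⟩
  · rintro _ ⟨u, hu, rfl⟩
    exact (hSO hu).2.2
  · by_cases hq : q ∈ (extChartAt (𝓡 3) x).symm '' S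
    · have hqs := symm_image_subset_source hSt hq
      obtain ⟨u, hu, rfl⟩ := hq
      have h4 := fieldInChart_apply (pieceField x (hamField e b K)) hqs
      rw [fieldInChart_pieceField ((extChartAt (𝓡 3) x).map_source hqs)] at h4
      rw [len_eq g hqs, ← h4, (extChartAt (𝓡 3) x).right_inv (hSt hu)]
      exact hlen u hu
    · rw [pieceField_eq_zero hSz hq, len, map_zero, Real.sqrt_zero]
      exact hr0
  · by_cases hq : q ∈ (extChartAt (𝓡 3) x).symm '' S
    · have hqs := symm_image_subset_source hSt hq
      rw [nablaInner_eq_chart hex.1 hk hqs]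
      rw [len_eq g hqs] at hV hW
      obtain ⟨u, hu, rfl⟩ := hq
      rw [(extChartAt (𝓡 3) x).right_inv (hSt hu)] at hV hW ⊢
      have h4 := hch u (hSt hu)
      have huN := (hSO hu).1
      rw [nablaIn, h4.fderiv_eq, h4.eq_of_nhds]
      refine (nablaIn_le (Z := hamField e b K) (hsm u) (hnn u) ((hR u huN).trans (le_abs_self R))
        (hc u huN) (hnorm u hu) (hD u hu) hV hW hc0).trans ?_
      have h5 := le_abs_self (4 * |R'| * c * Q * C +
        3 / 2 * (|R| * (ε * Q * (‖e 1‖ + ‖e 2‖)) * c ^ 2))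
      rw [← hA] at h5
      have h6 := (mul_le_mul_of_nonneg_left h5 hδ.le).trans hδA
      linarith
    · rw [nablaInner_eq_zero, abs_zero]
      · exact hr0
      · filter_upwards [hF.isOpen_compl.mem_nhds hq] with q' hq'
        exact pieceField_eq_zero hSz hq'
  · have h4 := hch u (hNt hu)
    rw [h4.eq_of_nhds, h4.fderiv_eq]
    refine ⟨?_, fun v => ?_⟩
    · rw [hzf, huw, smul_zero, hh.crit]; simp
    · have h5 := fderiv_hamField_ham (e := e) h₁ h₂ hh.smooth hδ (hbD u hu) v
      rw [← hKdef, huw, smul_zero, hh.crit, hh.hess] at h5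
      rw [h5, hbdef]; simp

end Franks
-- Adapted frames and straightening of the orbit.
namespace Franks

open Filter Topology

theorem exists_norm_le_bilin {B : E3 →L[ℝ] E3 →L[ℝ] ℝ} (h0 : ∀ V, V ≠ 0 → 0 < B V V) :
    ∃ c > 0, ∀ V, ‖V‖ ≤ c * √(B V V) := by
  have hcont : Continuous fun V => B V V := B.continuous.clm_apply continuous_id
  obtain ⟨V₀, hV₀, hmin⟩ := (isCompact_sphere (0 : E3) 1).exists_isMinOn
    (NormedSpace.sphere_nonempty.2 zero_le_one) hcont.continuousOn
  have hV₀' : V₀ ≠ 0 := by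
    rintro rfl
    simp at hV₀
  have hm := h0 V₀ hV₀'
  refine ⟨(√(B V₀ V₀))⁻¹, by positivity, fun V => ?_⟩
  by_cases hV : V = 0
  · simp [hV]
  have hVn : 0 < ‖V‖ := norm_pos_iff.2 hV
  have h1 : B V₀ V₀ ≤ B (‖V‖⁻¹ • V) (‖V‖⁻¹ • V) :=
    hmin (by simp [norm_smul, hVn.ne'])
  have h2 := Real.sqrt_le_sqrt h1
  rw [bilin_sqrt_smul, abs_of_pos (inv_pos.2 hVn), inv_mul_eq_div, le_div_iff₀ hVn] at h2
  rwa [inv_mul_eq_div, le_div_iff₀ (Real.sqrt_pos.2 hm), mul_comm]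

/-- Bounds for linear maps at a point hold nearby up to a factor `2`. -/
theorem eventually_clm_le {F : Type*} [NormedAddCommGroup F] [NormedSpace ℝ F]
    {T : E3 → E3 →L[ℝ] F} {G : E3 → E3 →L[ℝ] E3 →L[ℝ] ℝ} {u₀ : E3} (hT : ContinuousAt T u₀)
    (hG : ContinuousAt G u₀) (h0 : ∀ V, V ≠ 0 → 0 < G u₀ V V) {C : ℝ} (hC : 0 < C)
    (h : ∀ V, ‖T u₀ V‖ ≤ C * √(G u₀ V V)) :
    ∀ᶠ u in 𝓝 u₀, ∀ V, ‖T u V‖ ≤ 2 * C * √(G u V V) := by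
  -- With `2 * C` in place of `C` the squared inequality is strict at `u₀`, so it persists nearby,
  -- uniformly over the compact unit sphere; homogeneity extends it to all vectors.
  have key : ∀ᶠ u in 𝓝 u₀, ∀ V ∈ Metric.sphere (0 : E3) 1,
      ‖T u V‖ ^ 2 < (2 * C) ^ 2 * G u V V := by
    refine (isCompact_sphere (0 : E3) 1).eventually_forall_of_forall_eventually fun V hV => ?_
    have hV' : V ≠ 0 := by
      rintro rfl
      simp at hV
    have h1 : ContinuousAt (fun p : E3 × E3 => T p.1 p.2) (u₀, V) :=
      (hT.comp (x := (u₀, V)) continuousAt_fst).clm_apply continuousAt_snd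
    have h2 : ContinuousAt (fun p : E3 × E3 => G p.1 p.2 p.2) (u₀, V) :=
      ((hG.comp (x := (u₀, V)) continuousAt_fst).clm_apply continuousAt_snd).clm_apply
        continuousAt_snd
    refine (h1.norm.pow 2).eventually_lt (h2.const_mul _) ?_
    have h3 := pow_le_pow_left₀ (norm_nonneg _) (h V) 2
    rw [mul_pow, Real.sq_sqrt (h0 V hV').le] at h3
    have := mul_pos (pow_pos hC 2) (h0 V hV')
    show ‖T u₀ V‖ ^ 2 < (2 * C) ^ 2 * G u₀ V V
    nlinarith
  filter_upwards [key] with u hu V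
  by_cases hV : V = 0
  · simp [hV]
  have hVn : 0 < ‖V‖ := norm_pos_iff.2 hV
  have h1 := hu (‖V‖⁻¹ • V) (by simp [norm_smul, hVn.ne'])
  have h2 := Real.sqrt_le_sqrt h1.le
  rw [Real.sqrt_sq (norm_nonneg _), Real.sqrt_mul (by positivity), Real.sqrt_sq (by positivity),
    bilin_sqrt_smul, map_smul, norm_smul, norm_inv, norm_norm, abs_of_pos (inv_pos.2 hVn)] at h2
  have h3 := mul_le_mul_of_nonneg_left h2 hVn.le
  rw [mul_inv_cancel_left₀ hVn.ne'] at h3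
  calc ‖T u V‖ ≤ _ := h3
    _ = (‖V‖ * ‖V‖⁻¹) * (2 * C * √(G u V V)) := by ring
    _ = _ := by rw [mul_inv_cancel₀ hVn.ne', one_mul]

/-- An adapted frame for a linear surjection `T` with one-dimensional kernel. -/
theorem exists_frame {B : E3 →L[ℝ] E3 →L[ℝ] ℝ} (hB : ∀ V W, B V W = B W V)
    (h0 : ∀ V, V ≠ 0 → 0 < B V V) {T : E3 →L[ℝ] E2} (hT : Surjective T) {X₀ : E3} (hX₀ : X₀ ≠ 0)
    (hTX : T X₀ = 0) {C : ℝ} (hC : ∀ v, B v X₀ = 0 → ‖T v‖ ≤ C * √(B v v) ∧ √(B v v) ≤ C * ‖T v‖) :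
    ∃ e : Module.Basis (Fin 3) ℝ E3, e 0 = X₀ ∧ (∀ v, T v 0 = co e 1 v ∧ T v 1 = co e 2 v) ∧
      0 < C ∧ √(B (e 1) (e 1)) ≤ C ∧ √(B (e 2) (e 2)) ≤ C ∧
      ∀ V, |co e 1 V| ≤ C * √(B V V) ∧ |co e 2 V| ≤ C * √(B V V) := by
  have hXX := h0 X₀ hX₀
  -- The orthogonal projection along `X₀` preserves `T` and does not increase length. Projected
  -- lifts of the standard basis complete `X₀` to the frame: `hC` bounds their length, and it bounds
  -- the coordinates `1` and `2`, which are the components of `T`.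
  let π : E3 → E3 := fun v => v - (B v X₀ / B X₀ X₀) • X₀
  have hπ : ∀ v, B (π v) X₀ = 0 := fun v => by
    simp only [π, map_sub, map_smul, sub_apply, smul_apply, smul_eq_mul]
    rw [div_mul_cancel₀ _ hXX.ne', sub_self]
  have hTπ : ∀ v, T (π v) = T v := fun v => by
    simp only [π, map_sub, map_smul, hTX, smul_zero, sub_zero]
  have hπle : ∀ v, B (π v) (π v) ≤ B v v := fun v => by
    have h1 : B (π v) (π v) = B v v - B v X₀ ^ 2 / B X₀ X₀ := by
      have h2 : B (π v) (π v) = B (π v) v - (B v X₀ / B X₀ X₀) * B (π v) X₀ := by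
        simp only [π, map_sub, map_smul, smul_eq_mul]
      rw [h2, hπ, mul_zero, sub_zero]
      simp only [π, map_sub, map_smul, sub_apply, smul_apply, smul_eq_mul, hB X₀ v]
      ring
    rw [h1]
    have : 0 ≤ B v X₀ ^ 2 / B X₀ X₀ := by positivity
    linarith
  choose w hw using fun j : Fin 2 => hT (EuclideanSpace.single j 1)
  let f : Fin 2 → E3 := fun j => π (w j)
  have hTf : ∀ j, T (f j) = EuclideanSpace.single j 1 := fun j => (hTπ _).trans (hw j)
  have hf : ∀ j, √(B (f j) (f j)) ≤ C := fun j => by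
    have := (hC (f j) (hπ _)).2
    rw [hTf] at this
    simpa using this
  have hfne : f 0 ≠ 0 := fun h => by
    have h1 := hTf 0
    rw [h, map_zero] at h1
    have := congrArg (fun y : E2 => y 0) h1
    simp at this
  have hC0 : 0 < C := (Real.sqrt_pos.2 (h0 _ hfne)).trans_le (hf 0)
  have hli : LinearIndependent ℝ ![X₀, f 0, f 1] := by
    rw [Fintype.linearIndependent_iff]
    intro a ha
    rw [Fin.sum_univ_three] at ha
    change a 0 • X₀ + a 1 • f 0 + a 2 • f 1 = 0 at ha
    have h1 := congrArg T ha
    simp only [map_add, map_smul, hTX, hTf, map_zero, smul_zero, zero_add] at h1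
    have h2 := congrArg (fun y : E2 => y 0) h1
    have h3 := congrArg (fun y : E2 => y 1) h1
    simp at h2 h3
    rw [h2, h3, zero_smul, zero_smul, add_zero, add_zero] at ha
    have h4 := (smul_eq_zero.1 ha).resolve_right hX₀
    intro i
    fin_cases i
    · exact h4
    · exact h2
    · exact h3
  let e : Module.Basis (Fin 3) ℝ E3 :=
    basisOfLinearIndependentOfCardEqFinrank hli (by simp)
  have he : ⇑e = ![X₀, f 0, f 1] := coe_basisOfLinearIndependentOfCardEqFinrank hli _
  have he0 : e 0 = X₀ := by rw [he]; rfl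
  have he1 : e 1 = f 0 := by rw [he]; rfl
  have he2 : e 2 = f 1 := by rw [he]; rfl
  have hTe : ∀ v, T v 0 = co e 1 v ∧ T v 1 = co e 2 v := fun v => by
    have h1 : T v = co e 1 v • EuclideanSpace.single 0 1 + co e 2 v • EuclideanSpace.single 1 1 := by
      conv_lhs => rw [sum_co e v]
      rw [map_add, map_add, map_smul, map_smul, map_smul, he0, he1, he2, hTX, hTf, hTf, smul_zero,
        zero_add]
    rw [h1]
    constructor <;> simp
  have hT2 : ∀ V, ‖T V‖ ≤ C * √(B V V) := fun V => by
    rw [← hTπ]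
    exact (hC _ (hπ V)).1.trans (mul_le_mul_of_nonneg_left (Real.sqrt_le_sqrt (hπle V)) hC0.le)
  refine ⟨e, he0, hTe, hC0, he1 ▸ hf 0, he2 ▸ hf 1, fun V => ⟨?_, ?_⟩⟩
  · rw [← (hTe V).1]
    exact (PiLp.norm_apply_le (T V) 0).trans (hT2 V)
  · rw [← (hTe V).2]
    exact (PiLp.norm_apply_le (T V) 1).trans (hT2 V)

/-- Multiplication by a bump function. It lets coordinate functions defined near a point be replaced
by globally smooth ones. -/
theorem exists_contDiff_eventuallyEq {F : Type*} [NormedAddCommGroup F] [NormedSpace ℝ F]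
    {f : ℝ → F} {J : Set ℝ} (hJ : IsOpen J) {t₀ : ℝ} (ht₀ : t₀ ∈ J) (hf : ContDiffOn ℝ ∞ f J) :
    ∃ f' : ℝ → F, ContDiff ℝ ∞ f' ∧ f' =ᶠ[𝓝 t₀] f := by
  obtain ⟨r, hr, hrJ⟩ := Metric.nhds_basis_closedBall.mem_iff.1 (hJ.mem_nhds ht₀)
  let χ : ContDiffBump t₀ := ⟨r / 2, r, by positivity, by linarith⟩
  refine ⟨fun t => χ t • f t, contDiff_iff_contDiffAt.2 fun t => ?_, ?_⟩
  · by_cases ht : t ∈ tsupport χ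
    · rw [χ.tsupport_eq] at ht
      exact χ.contDiff.contDiffAt.smul (hf.contDiffAt (hJ.mem_nhds (hrJ ht)))
    · refine (contDiffAt_const (c := (0 : F))).congr_of_eventuallyEq ?_
      filter_upwards [(isClosed_tsupport χ).isOpen_compl.mem_nhds ht] with s hs
      rw [image_eq_zero_of_notMem_tsupport hs, zero_smul]
  · filter_upwards [χ.eventuallyEq_one] with t ht
    rw [ht, Pi.one_apply, one_smul]

/-- A curve transverse to the planes of `e₁`, `e₂` can be parametrized by the first coordinate. -/
theorem exists_straightening (e : Module.Basis (Fin 3) ℝ E3) {c : ℝ → E3} {t₀ : ℝ} {J : Set ℝ}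
    (hJ : IsOpen J) (ht₀ : t₀ ∈ J) (hc : ContDiffOn ℝ ∞ c J) (hd : HasDerivAt c (e 0) t₀) :
    ∃ (κ : ℝ → ℝ) (c' : ℝ → E3), ContDiff ℝ ∞ κ ∧ ContDiff ℝ ∞ c' ∧
      (∀ᶠ t in 𝓝 t₀, c' t = c t ∧ κ (co e 0 (c t)) = t) ∧
      ∀ᶠ s in 𝓝 (co e 0 (c t₀)), co e 0 (c' (κ s)) = s := by
  obtain ⟨c', hc', hcc⟩ := exists_contDiff_eventuallyEq hJ ht₀ hc
  let σ : ℝ → ℝ := fun t => co e 0 (c' t)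
  have hσ : ContDiff ℝ ∞ σ := (co e 0).contDiff.comp hc'
  -- The velocity at `t₀` is `e 0`, so the first coordinate has derivative `1` there and the inverse
  -- function theorem applies.
  have hσd : HasDerivAt σ 1 t₀ := by
    have h1 := (co e 0).hasFDerivAt.comp_hasDerivAt t₀ (hd.congr_of_eventuallyEq hcc)
    rwa [co_basis, if_pos rfl] at h1
  have hσd' : HasFDerivAt σ ((ContinuousLinearEquiv.refl ℝ ℝ : ℝ ≃L[ℝ] ℝ) : ℝ →L[ℝ] ℝ) t₀ := by
    refine hσd.hasFDerivAt.congr_fderiv ?_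
    ext
    simp
  let h := ContDiffAt.toOpenPartialHomeomorph σ hσ.contDiffAt hσd' (by simp)
  have hcoe : ⇑h = σ := ContDiffAt.toOpenPartialHomeomorph_coe hσ.contDiffAt hσd' (by simp)
  have hmem : t₀ ∈ h.source := ContDiffAt.mem_toOpenPartialHomeomorph_source hσ.contDiffAt hσd' (by simp)
  -- The inverse is smooth where the derivative of `σ` is nonzero, an open condition that holds at
  -- the base point.
  let J' : Set ℝ := h.target ∩ h.symm ⁻¹' {t | deriv σ t ≠ 0}
  have hJ' : IsOpen J' := h.isOpen_inter_preimage_symm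
    (isOpen_ne_fun (hσ.continuous_deriv (by simp)) continuous_const)
  have hs0 : co e 0 (c t₀) = h t₀ := by rw [hcoe, ← hcc.eq_of_nhds]
  have hs0J : h t₀ ∈ J' := by
    refine ⟨h.map_source hmem, ?_⟩
    show deriv σ (h.symm (h t₀)) ≠ 0
    rw [h.left_inv hmem, hσd.deriv]
    exact one_ne_zero
  have hsymm : ContDiffOn ℝ ∞ h.symm J' := fun s hs => by
    refine (h.contDiffAt_symm_deriv (f₀' := deriv σ (h.symm s)) hs.2 hs.1 ?_ ?_).contDiffWithinAt
    · rw [hcoe]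
      exact (hσ.differentiable (by simp) _).hasDerivAt
    · rw [hcoe]
      exact hσ.contDiffAt
  obtain ⟨κ, hκ, hκs⟩ := exists_contDiff_eventuallyEq hJ' hs0J hsymm
  refine ⟨κ, c', hκ, hc', ?_, ?_⟩
  · have h1 : ∀ᶠ t in 𝓝 t₀, κ (h t) = h.symm (h t) :=
      (h.continuousAt hmem).eventually hκs
    filter_upwards [hcc, h1, h.open_source.mem_nhds hmem] with t ht ht1 hts
    refine ⟨ht, ?_⟩
    have h2 : co e 0 (c t) = h t := by rw [hcoe, ← ht]
    rw [h2, ht1, h.left_inv hts]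
  · rw [hs0]
    filter_upwards [hκs, h.open_target.mem_nhds hs0J.1] with s hs hst
    have h2 : co e 0 (c' (κ s)) = h (κ s) := by rw [hcoe]
    rw [h2, hs, h.right_inv hst]

variable {M : Type*} [TopologicalSpace M] [ChartedSpace E3 M] [IsManifold (𝓡 3) ∞ M]

/-- Bootstrapping: if the curve is `C^n`, so is its velocity, the smooth field evaluated along it,
and the curve is `C^(n+1)`. -/
theorem IsFlow.contDiffOn_chart {X : VField M} (hX : IsCkField ⊤ X) {φ : ℝ → M → M}
    (hφ : IsFlow X φ) (p x : M) :
    ContDiffOn ℝ ∞ (fun t => extChartAt (𝓡 3) x (φ t p))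
      ((fun t => φ t p) ⁻¹' (extChartAt (𝓡 3) x).source) := by
  have hJ : IsOpen ((fun t => φ t p) ⁻¹' (extChartAt (𝓡 3) x).source) :=
    (isOpen_extChartAt_source x).preimage (hφ.continuous p)
  have hd : ∀ t ∈ (fun t => φ t p) ⁻¹' (extChartAt (𝓡 3) x).source,
      HasDerivAt (fun t => extChartAt (𝓡 3) x (φ t p))
        (fieldInChart X x (extChartAt (𝓡 3) x (φ t p))) t := fun t ht => by
    rw [fieldInChart_apply X ht]
    exact hφ.hasDerivAt_chart p ht
  refine contDiffOn_infty.2 fun n => ?_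
  induction n with
  | zero =>
    exact contDiffOn_zero.2 fun t ht => (hd t ht).continuousAt.continuousWithinAt
  | succ n ih =>
    push_cast
    refine (contDiffOn_succ_iff_deriv_of_isOpen hJ).2
      ⟨fun t ht => (hd t ht).differentiableAt.differentiableWithinAt, by simp, ?_⟩
    refine ContDiffOn.congr (f := fun t => fieldInChart X x (extChartAt (𝓡 3) x (φ t p))) ?_
      fun t ht => (hd t ht).deriv
    exact ((isCkField_iff.1 hX x).of_le (by exact_mod_cast le_top)).comp ih
      fun t ht => (extChartAt (𝓡 3) x).map_source ht

end Franks
-- The matrix `c - 𝔞` in a constant frame.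
namespace Franks

open Filter Topology

variable {M : Type*} [TopologicalSpace M] [ChartedSpace E3 M] [IsManifold (𝓡 3) ∞ M]

/-- The data of the perturbation problem. -/
structure IsFranksData (g : RMetric M) (μ : DForm M 3) (X : VField M) (φ : ℝ → M → M) (p : M)
    (T : ℝ) (τ : NormalMap M) (C ε : ℝ) (k : ℕ∞) (c : ℝ → Matrix (Fin 2) (Fin 2) ℝ) : Prop where
  vol : IsMetricVolumeForm g μ
  field : IsCkField ⊤ X
  flow : IsFlow X φ
  pos : 0 < T
  triv : IsNormalTrivialization X (fun t => φ t p) T τ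
  det : ∀ t ∈ Icc 0 T, (transverseLin τ φ p t).det = 1
  const : IsTrivializationConstant g X (fun t => φ t p) T τ C
  eps : 0 < ε
  one_le : 1 ≤ k
  smooth : ContDiffOn ℝ k c (Icc 0 T)
  trace : ∀ t ∈ Icc 0 T, (c t).trace = 0
  close : ∀ t ∈ Icc 0 T, ‖infinitesimalLin τ φ p T t - c t‖ < ε

/-- The time `t₀` may be an endpoint of `[0, T]`; the extension of coefficients requires a
nondegenerate closed interval on which they are defined. -/
theorem exists_Icc_subset {T t₀ : ℝ} (hT : 0 < T) (ht₀ : t₀ ∈ Icc 0 T) {S : Set ℝ}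
    (hS : S ∈ 𝓝[Icc 0 T] t₀) : ∃ a b, a < b ∧ t₀ ∈ Icc a b ∧ Icc a b ⊆ S ∩ Icc 0 T ∧
      Icc a b ∈ 𝓝[Icc 0 T] t₀ := by
  obtain ⟨r, hr, hrS⟩ := Metric.mem_nhdsWithin_iff.1 hS
  have h1 : Icc (max 0 (t₀ - r / 2)) (min T (t₀ + r / 2)) ⊆ Icc 0 T := fun t ht =>
    ⟨(le_max_left _ _).trans ht.1, ht.2.trans (min_le_left _ _)⟩
  refine ⟨max 0 (t₀ - r / 2), min T (t₀ + r / 2), ?_, ⟨?_, ?_⟩, fun t ht => ⟨hrS ⟨?_, h1 ht⟩, h1 ht⟩, ?_⟩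
  · rw [max_lt_iff, lt_min_iff, lt_min_iff]
    exact ⟨⟨hT, by linarith [ht₀.1]⟩, by linarith [ht₀.2], by linarith⟩
  · exact max_le ht₀.1 (by linarith)
  · exact le_min ht₀.2 (by linarith)
  · have h2 := (le_max_right _ _).trans ht.1
    have h3 := ht.2.trans (min_le_right _ _)
    rw [Metric.mem_ball, Real.dist_eq, abs_lt]
    constructor <;> linarith
  · refine Metric.mem_nhdsWithin_iff.2 ⟨r / 2, by positivity, fun t ht => ?_⟩
    have h2 := ht.1
    rw [Metric.mem_ball, Real.dist_eq, abs_lt] at h2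
    exact ⟨max_le ht.2.1 (by linarith), le_min ht.2.2 (by linarith)⟩

theorem contDiffOn_tauC {X : VField M} {γ : ℝ → M} {T : ℝ} {τ : NormalMap M}
    (h : IsNormalTrivialization X γ T τ) {x : M} {I : Set ℝ}
    (hI : I ⊆ Icc 0 T ∩ γ ⁻¹' (chartAt E3 x).source) : ContDiffOn ℝ ∞ (tauC τ γ x) I :=
  (h.smooth x).mono hI

/-- The infinitesimal linearization is defined through the differential of the flow. In contrast
`linOp` is built from `X`, `τ` and the curve, so its smoothness in time is visible. -/
theorem contDiffOn_linOp {X : VField M} (hX : IsCkField ⊤ X) {φ : ℝ → M → M} (hφ : IsFlow X φ)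
    {p : M} {T : ℝ} {τ : NormalMap M} (hτ : IsNormalTrivialization X (fun t => φ t p) T τ) {x : M}
    {a b : ℝ} (hab : a < b) (hI : Icc a b ⊆ Icc 0 T ∩ (fun t => φ t p) ⁻¹' (chartAt E3 x).source) :
    ContDiffOn ℝ ∞ (linOp τ (fun t => φ t p) T X x) (Icc a b) := by
  have hu := uniqueDiffOn_Icc hab
  have hs : ∀ t ∈ Icc a b, φ t p ∈ (extChartAt (𝓡 3) x).source := fun t ht => by
    rw [extChartAt_source]; exact (hI ht).2
  have h1 : ContDiffOn ℝ ∞ (derivWithin (tauC τ (fun t => φ t p) x) (Icc 0 T)) (Icc a b) := by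
    refine ((contDiffOn_tauC hτ hI).derivWithin hu (m := ∞) (by simp)).congr fun t ht => ?_
    have h2 := hτ.hasDerivWithinAt (hφ.continuous p) (hI ht).1 (hs t ht)
    exact ((h2.mono fun s hs => (hI hs).1).derivWithin (hu t ht)).symm
  have h2 : ContDiffOn ℝ ∞ (fun t => fderiv ℝ (fieldInChart X x) (extChartAt (𝓡 3) x (φ t p)))
      (Icc a b) :=
    ((isCkField_iff.1 hX x).fderiv_of_isOpen (isOpen_extChartAt_target x) (m := ∞)
      (by exact_mod_cast le_top)).comp ((hφ.contDiffOn_chart hX p x).mono hs)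
      fun t ht => (extChartAt (𝓡 3) x).map_source (hs t ht)
  exact h1.add ((contDiffOn_tauC hτ hI).clm_comp h2)

/-- The perturbation of the infinitesimal linearization, in a moving frame. -/
theorem IsFranksData.exists_coeff [T2Space M] [CompactSpace M] {g : RMetric M} {μ : DForm M 3}
    {X : VField M} {φ : ℝ → M → M} {p : M} {T : ℝ} {τ : NormalMap M} {C ε : ℝ} {k : ℕ∞}
    {c : ℝ → Matrix (Fin 2) (Fin 2) ℝ} (h : IsFranksData g μ X φ p T τ C ε k c) {t₀ : ℝ}
    (ht₀ : t₀ ∈ Icc 0 T) {x : M} (hx : φ t₀ p ∈ (extChartAt (𝓡 3) x).source)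
    {e : Module.Basis (Fin 3) ℝ E3} (he : ∀ v, tauC τ (fun t => φ t p) x t₀ v 0 = co e 1 v ∧
      tauC τ (fun t => φ t p) x t₀ v 1 = co e 2 v) :
    ∃ B : Fin 2 → Fin 2 → ℝ → ℝ, (∀ i j, ContDiff ℝ k (B i j)) ∧ (∀ i j, |B i j t₀| < ε) ∧
      ∀ᶠ t in 𝓝[Icc 0 T] t₀, B 0 0 t + B 1 1 t = 0 ∧ ∀ i j,
        ∑ l, tauC τ (fun t => φ t p) x t (e l.succ) i * B l j t =
          ∑ l, (c t - infinitesimalLin τ φ p T t) i l * tauC τ (fun t => φ t p) x t (e j.succ) l := by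
  have hS := mem_nhdsWithin_preimage_source (h.flow.continuous p) ht₀ hx
  -- `P` is the matrix of `τ` on the fixed vectors `e 1`, `e 2`, the identity at `t₀`. The
  -- coefficients sought are the conjugate `B = P⁻¹ (c - 𝔞) P`: it is traceless, and equals `c - 𝔞`
  -- at `t₀`, whence the strict bound by `ε` there.
  obtain ⟨P, hP⟩ : ∃ P : Fin 2 → Fin 2 → ℝ → ℝ,
    P = fun i j t => tauC τ (fun t => φ t p) x t (e j.succ) i := ⟨_, rfl⟩
  have hPC : ∀ {I : Set ℝ}, I ⊆ Icc 0 T ∩ (fun t => φ t p) ⁻¹' (chartAt E3 x).source →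
      ∀ i j, ContDiffOn ℝ ∞ (P i j) I := fun hI i j => by
    rw [hP]
    exact (EuclideanSpace.proj i : E2 →L[ℝ] ℝ).contDiff.comp_contDiffOn
      ((contDiffOn_tauC h.triv hI).clm_apply contDiffOn_const)
  have hP0 : ∀ i j, P i j t₀ = if i = j then 1 else 0 := by
    intro i j
    rw [hP]
    fin_cases i
    · refine (he _).1.trans ?_
      rw [co_basis]
      fin_cases j <;> rfl
    · refine (he _).2.trans ?_
      rw [co_basis]
      fin_cases j <;> rfl
  have hdet : ∀ᶠ t in 𝓝[Icc 0 T] t₀, P 0 0 t * P 1 1 t - P 0 1 t * P 1 0 t ≠ 0 := by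
    have h1 : ∀ i j, ContinuousWithinAt (P i j) (Icc 0 T) t₀ := fun i j =>
      ((hPC subset_rfl i j).continuousOn t₀ (mem_of_mem_nhdsWithin ht₀ hS)).mono_of_mem_nhdsWithin hS
    refine (((h1 0 0).mul (h1 1 1)).sub ((h1 0 1).mul (h1 1 0))).eventually_ne ?_
    simp [hP0]
  obtain ⟨a, b, hab, hat, hI, hIn⟩ := exists_Icc_subset h.pos ht₀ (inter_mem hS hdet)
  have hI' : Icc a b ⊆ Icc 0 T ∩ (fun t => φ t p) ⁻¹' (chartAt E3 x).source :=
    fun t ht => (hI ht).1.1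
  -- `N = (c - 𝔞) P`, with `𝔞 P` written through `linOp` so that it is visibly `C^k`.
  obtain ⟨N, hN⟩ : ∃ N : Fin 2 → Fin 2 → ℝ → ℝ, N = fun i j t =>
    ∑ l, c t i l * P l j t - linOp τ (fun t => φ t p) T X x t (e j.succ) i := ⟨_, rfl⟩
  have hNC : ∀ i j, ContDiffOn ℝ k (N i j) (Icc a b) := fun i j => by
    have h1 : ∀ i j, ContDiffOn ℝ k (P i j) (Icc a b) := fun i j =>
      (hPC hI' i j).of_le (by exact_mod_cast le_top)
    have h2 : ContDiffOn ℝ k (fun t => linOp τ (fun t => φ t p) T X x t (e j.succ) i) (Icc a b) :=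
      ((EuclideanSpace.proj i : E2 →L[ℝ] ℝ).contDiff.comp_contDiffOn
        ((contDiffOn_linOp h.field h.flow h.triv hab hI').clm_apply contDiffOn_const)).of_le
        (by exact_mod_cast le_top)
    have h3 : ∀ i j, ContDiffOn ℝ k (fun t => c t i j) (Icc a b) := fun i j =>
      contDiffOn_pi.1 (contDiffOn_pi.1 (h.smooth.mono fun t ht => (hI' ht).1) i) j
    rw [hN]
    exact (ContDiffOn.sum fun l _ => (h3 i l).mul (h1 l j)).sub h2
  have hNb : ∀ t ∈ Icc a b, ∀ i j, N i j t =
      ∑ l, (c t - infinitesimalLin τ φ p T t) i l * P l j t := fun t ht i j => by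
    have h1 := linOp_eq h.field le_top h.flow h.pos h.triv h.det (hI' ht).1
      (by rw [extChartAt_source]; exact (hI' ht).2 : φ t p ∈ (extChartAt (𝓡 3) x).source) (e j.succ) i
    rw [hN]
    simp only [h1]
    rw [← Finset.sum_sub_distrib]
    refine Finset.sum_congr rfl fun l _ => ?_
    rw [Matrix.sub_apply, hP]
    ring
  have hdI : ∀ t ∈ Icc a b, P 0 0 t * P 1 1 t - P 0 1 t * P 1 0 t ≠ 0 := fun t ht => (hI ht).1.2
  have hPk : ∀ i j, ContDiffOn ℝ k (P i j) (Icc a b) := fun i j =>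
    (hPC hI' i j).of_le (by exact_mod_cast le_top)
  have hD : ContDiffOn ℝ k (fun t => P 0 0 t * P 1 1 t - P 0 1 t * P 1 0 t) (Icc a b) :=
    ((hPk 0 0).mul (hPk 1 1)).sub ((hPk 0 1).mul (hPk 1 0))
  -- Cramer's rule for `P B = N`. The entries are extended to the line, as they become factors of
  -- globally defined functions.
  choose B₀ hB₀ hB₀e using fun j => exists_contDiff_extension hab
    ((((hPk 1 1).mul (hNC 0 j)).sub ((hPk 0 1).mul (hNC 1 j))).div hD hdI)
  choose B₁ hB₁ hB₁e using fun j => exists_contDiff_extension hab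
    ((((hPk 0 0).mul (hNC 1 j)).sub ((hPk 1 0).mul (hNC 0 j))).div hD hdI)
  have hB₀e' : ∀ j, ∀ t ∈ Icc a b, B₀ j t = (P 1 1 t * N 0 j t - P 0 1 t * N 1 j t) /
      (P 0 0 t * P 1 1 t - P 0 1 t * P 1 0 t) := fun j t ht => hB₀e j ht
  have hB₁e' : ∀ j, ∀ t ∈ Icc a b, B₁ j t = (P 0 0 t * N 1 j t - P 1 0 t * N 0 j t) /
      (P 0 0 t * P 1 1 t - P 0 1 t * P 1 0 t) := fun j t ht => hB₁e j ht
  have htr : ∀ t ∈ Icc a b, (c t - infinitesimalLin τ φ p T t).trace = 0 := fun t ht => by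
    rw [Matrix.trace_sub, h.trace t (hI' ht).1, infinitesimalLin_trace h.field le_top h.flow h.pos
      h.triv h.det (hI' ht).1, sub_zero]
  refine ⟨![B₀, B₁], ?_, ?_, ?_⟩
  · intro i j
    fin_cases i
    · exact hB₀ j
    · exact hB₁ j
  · have hb : ∀ i j, |(c t₀ - infinitesimalLin τ φ p T t₀) i j| < ε := fun i j => by
      refine lt_of_le_of_lt ?_ (h.close t₀ ht₀)
      rw [norm_sub_rev]
      exact Matrix.norm_entry_le_entrywise_sup_norm (c t₀ - infinitesimalLin τ φ p T t₀)
    intro i j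
    fin_cases i
    · show |B₀ j t₀| < ε
      rw [hB₀e' j t₀ hat]
      have := hb 0 j
      simp only [hNb t₀ hat, hP0, Fin.sum_univ_two]
      fin_cases j <;> simpa using this
    · show |B₁ j t₀| < ε
      rw [hB₁e' j t₀ hat]
      have := hb 1 j
      simp only [hNb t₀ hat, hP0, Fin.sum_univ_two]
      fin_cases j <;> simpa using this
  · filter_upwards [hIn] with t ht
    have hd := hdI t ht
    have h3 := htr t ht
    rw [Matrix.trace_fin_two] at h3
    obtain ⟨d, hddef⟩ : ∃ d, d = c t - infinitesimalLin τ φ p T t := ⟨_, rfl⟩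
    rw [← hddef] at h3 ⊢
    have e0 : ∀ j, B₀ j t = (P 1 1 t * (d 0 0 * P 0 j t + d 0 1 * P 1 j t) -
        P 0 1 t * (d 1 0 * P 0 j t + d 1 1 * P 1 j t)) /
        (P 0 0 t * P 1 1 t - P 0 1 t * P 1 0 t) := fun j => by
      rw [hB₀e' j t ht, hNb t ht, hNb t ht, Fin.sum_univ_two, Fin.sum_univ_two, hddef]
    have e1 : ∀ j, B₁ j t = (P 0 0 t * (d 1 0 * P 0 j t + d 1 1 * P 1 j t) -
        P 1 0 t * (d 0 0 * P 0 j t + d 0 1 * P 1 j t)) /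
        (P 0 0 t * P 1 1 t - P 0 1 t * P 1 0 t) := fun j => by
      rw [hB₁e' j t ht, hNb t ht, hNb t ht, Fin.sum_univ_two, Fin.sum_univ_two, hddef]
    refine ⟨?_, fun i j => ?_⟩
    · show B₀ 0 t + B₁ 1 t = 0
      rw [e0, e1, ← add_div, div_eq_zero_iff]
      left
      linear_combination (P 0 0 t * P 1 1 t - P 0 1 t * P 1 0 t) * h3
    · have h4 : ∀ i j, tauC τ (fun t => φ t p) x t (e (Fin.succ j)) i = P i j t := fun i j => by
        rw [hP]
      simp only [h4, Fin.sum_univ_two]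
      show P i 0 t * B₀ j t + P i 1 t * B₁ j t = _
      rw [e0, e1, ← mul_div_assoc, ← mul_div_assoc, ← add_div, div_eq_iff hd]
      fin_cases i
      · show P 0 0 t * _ + P 0 1 t * _ = (d 0 0 * _ + d 0 1 * _) * _
        ring
      · show P 1 0 t * _ + P 1 1 t * _ = (d 1 0 * _ + d 1 1 * _) * _
        ring

end Franks
-- Flow boxes with quantitative bounds.
namespace Franks

open Filter Topology

variable {M : Type*} [TopologicalSpace M] [ChartedSpace E3 M] [IsManifold (𝓡 3) ∞ M]

set_option maxSynthPendingDepth 5 in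
/-- Coordinates near `φ t₀ p` in which the orbit of `p` is straightened, with the bounds that make
the perturbations small. -/
structure IsFlowBox (g : RMetric M) (μ : DForm M 3) (X : VField M) (φ : ℝ → M → M) (p : M)
    (τ : NormalMap M) (C t₀ : ℝ) (x : M) (e : Module.Basis (Fin 3) ℝ E3) (ζ₁ ζ₂ κ : ℝ → ℝ)
    (γ : ℝ → E3) (R a : ℝ) : Prop where
  mem : φ t₀ p ∈ (extChartAt (𝓡 3) x).source
  smooth₁ : ContDiff ℝ ∞ ζ₁
  smooth₂ : ContDiff ℝ ∞ ζ₂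
  smooth : ContDiff ℝ ∞ κ
  smooth_curve : ContDiff ℝ ∞ γ
  pos : 0 < C
  nonneg : 0 ≤ a
  frame : ∀ v, tauC τ (fun t => φ t p) x t₀ v 0 = co e 1 v ∧
    tauC τ (fun t => φ t p) x t₀ v 1 = co e 2 v
  curve : ∀ᶠ t in 𝓝 t₀, γ t = extChartAt (𝓡 3) x (φ t p) ∧ κ (co e 0 (γ t)) = t ∧
    wmap e ζ₁ ζ₂ (γ t) = 0
  inv : ∀ᶠ s in 𝓝 (co e 0 (γ t₀)), co e 0 (γ (κ s)) = s ∧ wmap e ζ₁ ζ₂ (γ (κ s)) = 0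
  bounds : ∀ᶠ u in 𝓝 (γ t₀), u ∈ (extChartAt (𝓡 3) x).target ∧ formInChart μ x u e ≠ 0 ∧
    ‖fderiv ℝ (metricForm g x) u‖ ≤ R ∧ (∀ V, ‖V‖ ≤ a * √(metricForm g x u V V)) ∧
    √(metricForm g x u (e 1) (e 1)) ≤ 2 * C ∧ √(metricForm g x u (e 2) (e 2)) ≤ 2 * C ∧
    ∀ V, ‖dwmap e ζ₁ ζ₂ u V‖ ≤ 2 * C * √(metricForm g x u V V)

theorem metricForm_pos (g : RMetric M) {x q : M} (hx : q ∈ (extChartAt (𝓡 3) x).source) {V : E3}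
    (hV : V ≠ 0) : 0 < metricForm g x (extChartAt (𝓡 3) x q) V V := by
  have h1 := metricForm_toChart g hx (fromChart x q V) (fromChart x q V)
  rw [toChart_fromChart hx] at h1
  rw [h1]
  refine g.pos q _ fun h => hV ?_
  rw [← toChart_fromChart hx V, h, map_zero]

/-- If the density vanished, the Gram matrix of the basis would be singular, and a vector in its
kernel would give a nonzero combination of the basis of length zero. -/
theorem IsMetricVolumeForm.ne_zero {g : RMetric M} {μ : DForm M 3} (h : IsMetricVolumeForm g μ)
    {x q : M} (hx : q ∈ (extChartAt (𝓡 3) x).source) (e : Module.Basis (Fin 3) ℝ E3) :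
    formInChart μ x (extChartAt (𝓡 3) x q) e ≠ 0 := by
  rw [formInChart_apply μ hx]
  intro h0
  have h1 := h.2 q fun i => fromChart x q (e i)
  rw [h0, zero_pow two_ne_zero] at h1
  obtain ⟨G, hG⟩ : ∃ G, G = metricForm g x (extChartAt (𝓡 3) x q) := ⟨_, rfl⟩
  have h2 : ∀ V W, g.inner q (fromChart x q V) (fromChart x q W) = G V W := fun V W => by
    rw [← metricForm_toChart g hx, toChart_fromChart hx, toChart_fromChart hx, hG]
  simp only [h2] at h1
  obtain ⟨v, hv, hv0⟩ := Matrix.exists_mulVec_eq_zero_iff.2 h1.symm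
  have h3 : ∀ i, G (e i) (∑ j, v j • e j) = 0 := fun i => by
    have := congrFun hv0 i
    rw [map_sum]
    simp only [map_smul, smul_eq_mul]
    simpa [Matrix.mulVec, dotProduct, mul_comm] using this
  have h4 : G (∑ j, v j • e j) (∑ j, v j • e j) = 0 := by
    rw [map_sum]
    refine Finset.sum_eq_zero fun i _ => ?_
    rw [map_smul, hG, metricForm_symm, ← hG, h3, smul_zero]
  by_cases h5 : ∑ j, v j • e j = 0
  · exact hv (funext (Fintype.linearIndependent_iff.1 e.linearIndependent v h5))
  · exact (hG ▸ metricForm_pos g hx h5).ne' h4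

theorem wmap_eq_zero {e : Module.Basis (Fin 3) ℝ E3} {ζ₁ ζ₂ : ℝ → ℝ} {u : E3}
    (h₁ : ζ₁ (co e 0 u) = co e 1 u) (h₂ : ζ₂ (co e 0 u) = co e 2 u) : wmap e ζ₁ ζ₂ u = 0 := by
  rw [wmap, h₁, h₂, sub_self, sub_self]
  rfl

-- The frame is adapted at the point `φ t₀ p` itself, where all bounds hold with `C`; continuity
-- gives them nearby with `2 * C`. At that point the orbit has velocity `e 0` and satisfies `w = 0`,
-- so `dw` kills `e 0`, reduces to the coordinates `1` and `2`, and inherits the bound of the frame.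
set_option maxSynthPendingDepth 5 in
theorem IsFranksData.exists_flowBox {g : RMetric M} {μ : DForm M 3}
    {X : VField M} {φ : ℝ → M → M} {p : M} {T : ℝ} {τ : NormalMap M} {C ε : ℝ} {k : ℕ∞}
    {c : ℝ → Matrix (Fin 2) (Fin 2) ℝ} (h : IsFranksData g μ X φ p T τ C ε k c) {t₀ : ℝ}
    (ht₀ : t₀ ∈ Icc 0 T) {x : M} (hx : φ t₀ p ∈ (extChartAt (𝓡 3) x).source) :
    ∃ e ζ₁ ζ₂ κ γ R a, IsFlowBox g μ X φ p τ C t₀ x e ζ₁ ζ₂ κ γ R a := by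
  obtain ⟨u₀, hu₀⟩ : ∃ u₀, u₀ = extChartAt (𝓡 3) x (φ t₀ p) := ⟨_, rfl⟩
  have hpos : ∀ V, V ≠ 0 → 0 < metricForm g x u₀ V V := fun V hV => hu₀ ▸ metricForm_pos g hx hV
  have hT : ∀ v, tauC τ (fun t => φ t p) x t₀ v = τ (φ t₀ p) (fromChart x (φ t₀ p) v) := fun v => rfl
  obtain ⟨e, he0, hef, hC, he1, he2, hco⟩ := exists_frame (B := metricForm g x u₀)
    (metricForm_symm g x u₀) hpos (T := tauC τ (fun t => φ t p) x t₀)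
    (X₀ := toChart x (φ t₀ p) (X (φ t₀ p))) (C := C)
    (fun w => by
      obtain ⟨v, hv⟩ := h.triv.surj t₀ ht₀ w
      exact ⟨toChart x (φ t₀ p) v, (tauC_toChart τ (fun t => φ t p) hx v).trans hv⟩)
    (fun h0 => h.triv.ne_zero ht₀ (by
      rw [← fromChart_toChart hx (X (φ t₀ p)), h0, map_zero]))
    ((tauC_toChart τ (fun t => φ t p) hx _).trans (h.triv.tau_self ht₀))
    (fun v hv => by
      have h1 : ∀ W, metricForm g x u₀ v (toChart x (φ t₀ p) W) =
          g.inner (φ t₀ p) (fromChart x (φ t₀ p) v) W := fun W => by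
        rw [← metricForm_toChart g hx, toChart_fromChart hx, hu₀]
      have h2 := h.const t₀ ht₀ (fromChart x (φ t₀ p) v) ((h1 _).symm.trans hv)
      have h3 : len g (fromChart x (φ t₀ p) v) = √(metricForm g x u₀ v v) := by
        rw [len_eq g hx, toChart_fromChart hx, hu₀]
      rwa [h3] at h2)
  obtain ⟨κ, γ, hκ, hγ, hγe, hinv⟩ := exists_straightening e
    ((isOpen_extChartAt_source x).preimage (h.flow.continuous p)) hx
    (h.flow.contDiffOn_chart h.field p x) (by
      rw [he0]
      exact h.flow.hasDerivAt_chart p hx)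
  have hγ0 : γ t₀ = u₀ := hγe.self_of_nhds.1.trans hu₀.symm
  have hκ0 : κ (co e 0 u₀) = t₀ := hu₀ ▸ hγe.self_of_nhds.2
  obtain ⟨ζ₁, hζ₁⟩ : ∃ ζ₁, ζ₁ = fun s => co e 1 (γ (κ s)) := ⟨_, rfl⟩
  obtain ⟨ζ₂, hζ₂⟩ : ∃ ζ₂, ζ₂ = fun s => co e 2 (γ (κ s)) := ⟨_, rfl⟩
  have hs₁ : ContDiff ℝ ∞ ζ₁ := hζ₁ ▸ (co e 1).contDiff.comp (hγ.comp hκ)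
  have hs₂ : ContDiff ℝ ∞ ζ₂ := hζ₂ ▸ (co e 2).contDiff.comp (hγ.comp hκ)
  have hcurve : ∀ᶠ t in 𝓝 t₀, γ t = extChartAt (𝓡 3) x (φ t p) ∧ κ (co e 0 (γ t)) = t ∧
      wmap e ζ₁ ζ₂ (γ t) = 0 := by
    filter_upwards [hγe] with t ht
    have h1 : κ (co e 0 (γ t)) = t := ht.1 ▸ ht.2
    refine ⟨ht.1, h1, wmap_eq_zero ?_ ?_⟩
    · rw [hζ₁]; simp only [h1]
    · rw [hζ₂]; simp only [h1]
  have hdw0 : dwmap e ζ₁ ζ₂ u₀ (e 0) = 0 := by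
    have h1 := h.flow.hasDerivAt_chart p hx
    rw [← he0] at h1
    have h2 : HasDerivAt γ (e 0) t₀ := h1.congr_of_eventuallyEq (hγe.mono fun t ht => ht.1)
    have h3 := (hasFDerivAt_wmap e hs₁ hs₂ (γ t₀)).comp_hasDerivAt t₀ h2
    rw [hγ0] at h3
    exact h3.unique ((hasDerivAt_const t₀ (0 : ℝ × ℝ)).congr_of_eventuallyEq
      (hcurve.mono fun t ht => ht.2.2))
  have hdw : ∀ V, dwmap e ζ₁ ζ₂ u₀ V = (co e 1 V, co e 2 V) := fun V => by
    have h1 := hdw0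
    simp only [dwmap, ContinuousLinearMap.prod_apply, sub_apply, smul_apply, co_basis,
      Prod.mk_eq_zero, smul_eq_mul] at h1 ⊢
    simp at h1
    rw [h1.1, h1.2]
    simp
  have hGc : ContinuousAt (metricForm g x) u₀ :=
    hu₀ ▸ (differentiableAt_metricForm g hx).continuousAt
  have htgt : (extChartAt (𝓡 3) x).target ∈ 𝓝 u₀ :=
    (isOpen_extChartAt_target x).mem_nhds (hu₀ ▸ (extChartAt (𝓡 3) x).map_source hx)
  obtain ⟨a, ha, hab⟩ := exists_norm_le_bilin hpos
  have b1 := eventually_clm_le (T := fun _ => ContinuousLinearMap.id ℝ E3) continuousAt_const hGc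
    hpos ha hab
  have b2 := eventually_clm_le (T := dwmap e ζ₁ ζ₂) (C := C) (by
      have h1 : Continuous (deriv ζ₁) := hs₁.continuous_deriv (by simp)
      have h2 : Continuous (deriv ζ₂) := hs₂.continuous_deriv (by simp)
      have h3 : Continuous (dwmap e ζ₁ ζ₂) := by
        unfold dwmap
        exact ((ContinuousLinearMap.prodL ℝ).continuous.comp ((continuous_const.sub ((h1.comp (co e 0).continuous).smul
          continuous_const)).prodMk
          (continuous_const.sub ((h2.comp (co e 0).continuous).smul continuous_const))))
      exact h3.continuousAt) hGc hpos hC (fun V => by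
        rw [hdw, Prod.norm_def]
        exact max_le (hco V).1 (hco V).2)
  have b3 : ∀ v : E3, √(metricForm g x u₀ v v) ≤ C →
      ∀ᶠ u in 𝓝 u₀, √(metricForm g x u v v) ≤ 2 * C := fun v hv => by
    have h1 : ContinuousAt (fun u => √(metricForm g x u v v)) u₀ :=
      ((hGc.clm_apply continuousAt_const).clm_apply continuousAt_const).sqrt
    exact (h1.eventually_lt continuousAt_const (by linarith)).mono fun u hu => hu.le
  refine ⟨e, ζ₁, ζ₂, κ, γ, ‖fderiv ℝ (metricForm g x) u₀‖ + 1, 2 * a, ⟨hx, hs₁, hs₂, hκ, hγ, hC,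
    by positivity, hef, hcurve, ?_, ?_⟩⟩
  · rw [hγ0, hu₀]
    filter_upwards [hinv] with s hs
    refine ⟨hs, wmap_eq_zero ?_ ?_⟩
    · rw [hs, hζ₁]
    · rw [hs, hζ₂]
  · rw [hγ0]
    have b4 : ∀ᶠ u in 𝓝 u₀, ‖fderiv ℝ (metricForm g x) u‖ ≤ ‖fderiv ℝ (metricForm g x) u₀‖ + 1 := by
      have h1 : ContinuousAt (fderiv ℝ (metricForm g x)) u₀ :=
        ((contDiffOn_metricForm g x).continuousOn_fderiv_of_isOpen (isOpen_extChartAt_target x)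
          (by simp)).continuousAt htgt
      exact (h1.norm.eventually_lt continuousAt_const (lt_add_one _)).mono fun u hu => hu.le
    filter_upwards [htgt, b1, b2, b3 _ he1, b3 _ he2, b4] with u h0 h1 h2 h3 h4 h5
    refine ⟨h0, ?_, h5, h1, h3, h4, h2⟩
    have h6 := h.vol.ne_zero ((extChartAt (𝓡 3) x).map_target h0) e
    rwa [(extChartAt (𝓡 3) x).right_inv h0] at h6

end Franks
-- Pieces localized in time, with prescribed Hessian along the orbit.
namespace Franks

open Filter Topology

variable {M : Type*} [TopologicalSpace M] [ChartedSpace E3 M] [IsManifold (𝓡 3) ∞ M]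

/-- The local perturbation with prescribed Hessian `H`, localized in time by `θ`. -/
theorem IsFlowBox.exists_isPiece [T2Space M] {g : RMetric M} {μ : DForm M 3}
    {X : VField M} {φ : ℝ → M → M} {p : M} {τ : NormalMap M} {C t₀ : ℝ} {x : M}
    {e : Module.Basis (Fin 3) ℝ E3} {ζ₁ ζ₂ κ : ℝ → ℝ} {γ : ℝ → E3} {R a : ℝ}
    (hB : IsFlowBox g μ X φ p τ C t₀ x e ζ₁ ζ₂ κ γ R a) (hφ : Continuous fun t => φ t p)
    (hμ : IsCkForm ⊤ μ) {k : ℕ∞} (hk : 1 ≤ k) {ε Q : ℝ} (hε : 0 < ε) (hQ : 0 < Q) {b : ℝ → ℝ}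
    (hb : ContDiff ℝ k b) (hbε : |b t₀| < ε)
    {h : ℝ × ℝ → ℝ} {H : ℝ × ℝ →L[ℝ] ℝ × ℝ →L[ℝ] ℝ} (hh : IsBumpJet h H Q) :
    ∀ᶠ η in 𝓝[>] (0 : ℝ), ∀ θ : ℝ → ℝ, ContDiff ℝ ∞ θ → (∀ t, |θ t| ≤ 1) →
      tsupport θ ⊆ Ioo (t₀ - η) (t₀ + η) → ∀ O : Set M, IsOpen O → (∀ t ∈ tsupport θ, φ t p ∈ O) →
      ∃ F Z, IsClosed F ∧ F ⊆ O ∧ IsPiece g μ k F (9 * Q * C ^ 2 * ε) Z ∧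
        ∀ t ∈ Ioo (t₀ - η) (t₀ + η), fieldInChart Z x (γ t) = 0 ∧
          ∀ v, fderiv ℝ (fieldInChart Z x) (γ t) v = (θ t * b t) •
            (H (dwmap e ζ₁ ζ₂ (γ t) v) (0, 1) • e 1 - H (dwmap e ζ₁ ζ₂ (γ t) v) (1, 0) • e 2) := by
  obtain ⟨s₀, hs₀⟩ : ∃ s₀, s₀ = co e 0 (γ t₀) := ⟨_, rfl⟩
  have hκ0 : κ s₀ = t₀ := hs₀ ▸ hB.curve.self_of_nhds.2.1
  have hγκ : ContDiff ℝ ∞ fun s => γ (κ s) := hB.smooth_curve.comp hB.smooth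
  have htgt := hB.bounds.self_of_nhds.1
  -- the density along the curve
  obtain ⟨m, hm, hme⟩ := exists_contDiff_eventuallyEq
    ((isOpen_extChartAt_target (I := 𝓡 3) x).preimage hγκ.continuous)
    (by rwa [mem_preimage, hκ0] : s₀ ∈ _)
    ((contDiffOn_formInChart_apply hμ x e).comp hγκ.contDiffOn fun s hs => hs)
  have hm0 : m s₀ = formInChart μ x (γ t₀) e := by
    refine hme.self_of_nhds.trans ?_
    simp only [comp_apply, hκ0]
  -- the neighbourhood
  have hbm : ∀ᶠ u in 𝓝 (γ t₀), |b (κ (co e 0 u)) * m (co e 0 u) / formInChart μ x u e| ≤ ε := by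
    have h1 : ContinuousAt (fun u => formInChart μ x u e) (γ t₀) :=
      (contDiffOn_formInChart_apply hμ x e).continuousOn.continuousAt
        ((isOpen_extChartAt_target x).mem_nhds htgt)
    have h2 : Continuous fun u => b (κ (co e 0 u)) * m (co e 0 u) :=
      (hb.continuous.comp (hB.smooth.continuous.comp (co e 0).continuous)).mul
        (hm.continuous.comp (co e 0).continuous)
    have h3 := (h2.continuousAt.div h1 hB.bounds.self_of_nhds.2.1).abs
    refine (h3.eventually_lt continuousAt_const ?_).mono fun u hu => hu.le
    show |b (κ (co e 0 (γ t₀))) * m (co e 0 (γ t₀)) / formInChart μ x (γ t₀) e| < ε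
    rw [← hs₀, hκ0, hm0, mul_div_assoc, div_self hB.bounds.self_of_nhds.2.1, mul_one]
    exact hbε
  obtain ⟨N, hN, hNo, hN0⟩ := mem_nhds_iff.1 (inter_mem hB.bounds hbm)
  -- the time interval
  have hκt : Tendsto κ (𝓝 s₀) (𝓝 t₀) := hκ0 ▸ hB.smooth.continuous.tendsto s₀
  have hγt : Tendsto γ (𝓝 t₀) (𝓝 (γ t₀)) := hB.smooth_curve.continuous.tendsto t₀
  have hst : Tendsto (fun t => co e 0 (γ t)) (𝓝 t₀) (𝓝 s₀) :=
    hs₀ ▸ ((co e 0).continuous.comp hB.smooth_curve.continuous).tendsto t₀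
  have hsrc : ∀ᶠ t in 𝓝 t₀, φ t p ∈ (extChartAt (𝓡 3) x).source :=
    hφ.continuousAt.eventually ((isOpen_extChartAt_source x).mem_nhds hB.mem)
  have hS : ∀ᶠ s in 𝓝 s₀, (co e 0 (γ (κ s)) = s ∧ wmap e ζ₁ ζ₂ (γ (κ s)) = 0) ∧ γ (κ s) ∈ N ∧
      γ (κ s) = extChartAt (𝓡 3) x (φ (κ s) p) ∧ φ (κ s) p ∈ (extChartAt (𝓡 3) x).source ∧
      m s = formInChart μ x (γ (κ s)) e := by
    filter_upwards [hs₀ ▸ hB.inv, hκt.eventually (hγt.eventually (hNo.mem_nhds hN0)),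
      hκt.eventually hB.curve, hκt.eventually hsrc, hme] with s h1 h2 h3 h4 h5
    exact ⟨h1, h2, h3.1, h4, h5⟩
  obtain ⟨r, hr, hrS⟩ := Metric.eventually_nhds_iff_ball.1 hS
  let χ : ContDiffBump s₀ := ⟨r / 4, r / 2, by positivity, by linarith⟩
  have hχ : ContDiff ℝ ∞ χ := χ.contDiff
  have hev : ∀ᶠ t in 𝓝 t₀, γ t ∈ N ∧ κ (co e 0 (γ t)) = t ∧ wmap e ζ₁ ζ₂ (γ t) = 0 ∧
      χ (co e 0 (γ t)) = 1 ∧ m (co e 0 (γ t)) = formInChart μ x (γ t) e := by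
    have h0 : ∀ᶠ s in 𝓝 s₀, χ s = 1 := χ.eventuallyEq_one
    filter_upwards [hγt.eventually (hNo.mem_nhds hN0), hB.curve, hst.eventually h0,
      hst.eventually hS] with t h1 h2 h3 h4
    refine ⟨h1, h2.2.1, h2.2.2, h3, ?_⟩
    rw [h4.2.2.2.2, h2.2.1]
  obtain ⟨η₀, hη₀, hηS⟩ := Metric.eventually_nhds_iff_ball.1 hev
  filter_upwards [Ioo_mem_nhdsGT hη₀] with η hη θ hθ hθ1 hθs O hO hθO
  -- Exactness requires `β` to depend on `s` alone, so the density in the denominator is compensated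
  -- by its value `m s` on the curve: `β / μ(e)` is `θ b` on the curve and at most `ε` on `N`. The
  -- factor `χ` confines `β` to the range where `κ` and `m` have their geometric meaning.
  obtain ⟨β, hβdef⟩ : ∃ β, β = fun s => χ s * (θ (κ s) * (b (κ s) * m s)) := ⟨_, rfl⟩
  have hkt : ((k : ℕ∞) : WithTop ℕ∞) ≤ ((⊤ : ℕ∞) : WithTop ℕ∞) := by exact_mod_cast le_top
  have hβ : ContDiff ℝ k β := by
    rw [hβdef]
    exact (hχ.of_le hkt).mul (((hθ.comp hB.smooth).of_le hkt).mul
      ((hb.comp (hB.smooth.of_le hkt)).mul (hm.of_le hkt)))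
  have hβc : HasCompactSupport β := hβdef ▸ χ.hasCompactSupport.mul_right
  have hts1 : tsupport β ⊆ Metric.ball s₀ r := by
    refine (hβdef ▸ tsupport_mul_subset_left).trans ?_
    rw [χ.tsupport_eq]
    exact Metric.closedBall_subset_ball (by show r / 2 < r; linarith)
  have hts2 : ∀ s ∈ tsupport β, κ s ∈ tsupport θ := by
    intro s hs
    have h1 : s ∈ tsupport fun s => θ (κ s) :=
      (hβdef ▸ (tsupport_mul_subset_right.trans tsupport_mul_subset_left)) hs
    exact closure_minimal (fun s hs => subset_tsupport θ hs :
      (support fun s => θ (κ s)) ⊆ κ ⁻¹' tsupport θ)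
      ((isClosed_tsupport θ).preimage hB.smooth.continuous) h1
  obtain ⟨F, Z, hF, hFO, hZ, hZd⟩ := Franks.exists_isPiece hμ hk hB.smooth₁ hB.smooth₂ hβ hβc hNo
    (fun u hu => (hN hu).1.1) (fun u hu => (hN hu).1.2.1) hB.pos hε hB.nonneg hQ
    (fun u hu => by
      refine le_trans ?_ (hN hu).2
      rw [hβdef, mul_div_assoc, mul_div_assoc, abs_mul, abs_mul]
      have h1 : |χ (co e 0 u)| ≤ 1 := by
        rw [abs_of_nonneg χ.nonneg]; exact χ.le_one
      calc _ ≤ 1 * (1 * _) := mul_le_mul h1 (mul_le_mul_of_nonneg_right (hθ1 _) (abs_nonneg _))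
            (by positivity) zero_le_one
        _ = _ := by rw [one_mul, one_mul])
    (fun u hu => (hN hu).1.2.2.1) (fun u hu => (hN hu).1.2.2.2.1) (fun u hu => (hN hu).1.2.2.2.2.1)
    (fun u hu => (hN hu).1.2.2.2.2.2.1) (fun u hu => (hN hu).1.2.2.2.2.2.2) hO
    (fun s hs => by
      have h1 := hrS s (hts1 hs)
      refine ⟨γ (κ s), h1.2.1, ?_, h1.1.1, h1.1.2⟩
      rw [h1.2.2.1, (extChartAt (𝓡 3) x).left_inv h1.2.2.2.1]
      exact hθO _ (hts2 s hs)) hh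
  refine ⟨F, Z, hF, hFO, hZ, fun t ht => ?_⟩
  have h1 := hηS t (by
    rw [Metric.mem_ball, Real.dist_eq, abs_lt]
    constructor <;> linarith [ht.1, ht.2, hη.2])
  have h2 := hZd (γ t) h1.1 h1.2.2.1
  refine ⟨h2.1, fun v => (h2.2 v).trans ?_⟩
  have h3 : β (co e 0 (γ t)) / formInChart μ x (γ t) e = θ t * b t := by
    rw [hβdef]
    simp only [h1.2.1, h1.2.2.2.1, h1.2.2.2.2]
    rw [one_mul, ← mul_assoc, mul_div_assoc, div_self (hN h1.1).1.2.1, mul_one]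
  rw [h3]

end Franks
-- Sums of pieces and realization of a traceless matrix.
namespace Franks

open Filter Topology

variable {M : Type*} [TopologicalSpace M] [ChartedSpace E3 M] [IsManifold (𝓡 3) ∞ M]

theorem IsVolumePreserving.add {μ : DForm M 3} (hμ : IsCkForm ⊤ μ) {k : ℕ∞} (hk : 1 ≤ k)
    {X Z : VField M} (hX : IsCkField k X) (hZ : IsCkField k Z) (h : IsVolumePreserving μ X)
    (h' : IsVolumePreserving μ Z) : IsVolumePreserving μ (X + Z) := by
  have hμ' := hμ.of_le (le_top : k ≤ ⊤)
  unfold IsVolumePreserving at h h' ⊢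
  rw [contract_add, extD_add hk (hμ'.contract hX) (hμ'.contract hZ), h, h', add_zero]

theorem IsExactField.add {μ : DForm M 3} {k : ℕ∞} (hk : 1 ≤ k) {X Z : VField M}
    (h : IsExactField k μ X) (h' : IsExactField k μ Z) : IsExactField k μ (X + Z) := by
  obtain ⟨α, hα, h1⟩ := h
  obtain ⟨β, hβ, h2⟩ := h'
  exact ⟨α + β, hα.add hβ, by rw [extD_add hk hα hβ, h1, h2, contract_add]⟩

theorem len_add_le (g : RMetric M) {q : M} (V W : TangentSpace (𝓡 3) q) :
    len g (V + W) ≤ len g V + len g W := by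
  have hq := mem_extChartAt_source (I := 𝓡 3) q
  simp only [len_eq g hq]
  rw [map_add]
  exact bilin_sqrt_add (metricForm_symm g _ _) (metricForm_nonneg g _ _) _ _

theorem len_zero (g : RMetric M) {q : M} : len g (0 : TangentSpace (𝓡 3) q) = 0 := by
  simp [len]

theorem IsPiece.add {g : RMetric M} {μ : DForm M 3} (hμ : IsCkForm ⊤ μ) {k : ℕ∞} (hk : 1 ≤ k)
    {F F' : Set M} {r r' : ℝ} {Z Z' : VField M} (h : IsPiece g μ k F r Z)
    (h' : IsPiece g μ k F' r' Z') : IsPiece g μ k (F ∪ F') (r + r') (Z + Z') where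
  field := h.field.add h'.field
  volumePreserving := h.volumePreserving.add hμ hk h.field h'.field h'.volumePreserving
  exact := h.exact.add hk h'.exact
  eq_zero q hq := by
    rw [mem_union, not_or] at hq
    show Z q + Z' q = 0
    rw [h.eq_zero q hq.1, h'.eq_zero q hq.2, add_zero]
  len_le q := (len_add_le g _ _).trans (add_le_add (h.len_le q) (h'.len_le q))
  nabla_le q V W hV hW := by
    rw [nablaInner_add h.field h'.field hk]
    exact (abs_add_le _ _).trans (add_le_add (h.nabla_le q V W hV hW) (h'.nabla_le q V W hV hW))

/-- The transverse part of a vector in a frame adapted to the orbit. -/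
theorem IsFlowBox.tauC_eq {g : RMetric M} {μ : DForm M 3}
    {X : VField M} {φ : ℝ → M → M} {p : M} {τ : NormalMap M} {C t₀ : ℝ} {x : M}
    {e : Module.Basis (Fin 3) ℝ E3} {ζ₁ ζ₂ κ : ℝ → ℝ} {γ : ℝ → E3} {R a : ℝ}
    (hB : IsFlowBox g μ X φ p τ C t₀ x e ζ₁ ζ₂ κ γ R a) (hφ : IsFlow X φ) {T : ℝ}
    (hτ : IsNormalTrivialization X (fun t => φ t p) T τ) :
    ∀ᶠ t in 𝓝 t₀, t ∈ Icc 0 T → ∀ v, tauC τ (fun t => φ t p) x t v =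
      (dwmap e ζ₁ ζ₂ (γ t) v).1 • tauC τ (fun t => φ t p) x t (e 1) +
      (dwmap e ζ₁ ζ₂ (γ t) v).2 • tauC τ (fun t => φ t p) x t (e 2) := by
  have hsrc : ∀ᶠ t in 𝓝 t₀, φ t p ∈ (extChartAt (𝓡 3) x).source :=
    (hφ.continuous p).continuousAt.eventually ((isOpen_extChartAt_source x).mem_nhds hB.mem)
  filter_upwards [hB.curve.eventually_nhds, hsrc] with t hc hs ht v
  obtain ⟨w, hw⟩ : ∃ w, w = toChart x (φ t p) (X (φ t p)) := ⟨_, rfl⟩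
  have hd : HasDerivAt γ w t :=
    hw ▸ (hφ.hasDerivAt_chart p hs).congr_of_eventuallyEq (hc.mono fun t ht => ht.1)
  have h1 : dwmap e ζ₁ ζ₂ (γ t) w = 0 :=
    ((hasFDerivAt_wmap e hB.smooth₁ hB.smooth₂ (γ t)).comp_hasDerivAt t hd).unique
      ((hasDerivAt_const t (0 : ℝ × ℝ)).congr_of_eventuallyEq (hc.mono fun t ht => ht.2.2))
  have h2 : deriv κ (co e 0 (γ t)) * co e 0 w = 1 := by
    have h3 : HasDerivAt (fun t => co e 0 (γ t)) (co e 0 w) t :=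
      (co e 0).hasFDerivAt.comp_hasDerivAt t hd
    have h4 : HasDerivAt κ (deriv κ (co e 0 (γ t))) (co e 0 (γ t)) :=
      (hB.smooth.differentiable (by simp) _).hasDerivAt
    exact (h4.comp t h3).unique
      ((hasDerivAt_id t).congr_of_eventuallyEq (hc.mono fun t ht => ht.2.1))
  have h3 : tauC τ (fun t => φ t p) x t w = 0 := by
    rw [hw]
    exact (tauC_toChart τ (fun t => φ t p) hs _).trans (hτ.tau_self ht)
  obtain ⟨d, hd⟩ : ∃ d, d = dwmap e ζ₁ ζ₂ (γ t) := ⟨_, rfl⟩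
  rw [← hd] at h1 ⊢
  -- Both `τ` and `dw` kill the velocity `w` of the orbit. Differentiating `κ (co e 0 (γ t)) = t`
  -- shows that `w` has a nonzero component along `e 0`, so a multiple of it removes that component
  -- of `v`; on the span of `e 1`, `e 2` the formula is immediate.
  obtain ⟨r, hr⟩ : ∃ r, r = co e 0 v * deriv κ (co e 0 (γ t)) := ⟨_, rfl⟩
  have h4 : co e 0 (v - r • w) = 0 := by
    rw [map_sub, map_smul, smul_eq_mul, hr, mul_assoc, h2, mul_one, sub_self]
  have h5 : v - r • w = co e 1 (v - r • w) • e 1 + co e 2 (v - r • w) • e 2 := by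
    have h6 := sum_co e (v - r • w)
    rwa [h4, zero_smul, zero_add] at h6
  have h6 : d v = d (v - r • w) := by rw [map_sub, map_smul, h1, smul_zero, sub_zero]
  have h7 : (d v).1 = co e 1 (v - r • w) ∧ (d v).2 = co e 2 (v - r • w) := by
    rw [h6, hd]
    simp only [dwmap, ContinuousLinearMap.prod_apply, sub_apply, smul_apply, h4, smul_zero,
      sub_zero, and_self]
  obtain ⟨L, hL⟩ : ∃ L, L = tauC τ (fun t => φ t p) x t := ⟨_, rfl⟩
  rw [← hL] at h3 ⊢
  have h8 := congrArg L h5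
  rw [L.map_sub, L.map_smul, L.map_add, L.map_smul, L.map_smul, h3, smul_zero, sub_zero] at h8
  rw [h7.1, h7.2, h8]

/-- The local perturbations realizing a prescribed infinitesimal transverse linearization. -/
theorem IsFranksData.exists_localPiece [T2Space M] [CompactSpace M] {g : RMetric M} {μ : DForm M 3}
    {X : VField M} {φ : ℝ → M → M} {p : M} {T : ℝ} {τ : NormalMap M} {C ε : ℝ} {k : ℕ∞}
    {c : ℝ → Matrix (Fin 2) (Fin 2) ℝ} (h : IsFranksData g μ X φ p T τ C ε k c)
    {f₁ f₂ f₃ : ℝ × ℝ → ℝ} {H₁ H₂ H₃ : ℝ × ℝ →L[ℝ] ℝ × ℝ →L[ℝ] ℝ} {Q : ℝ} (hQ : 0 < Q)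
    (hf₁ : IsBumpJet f₁ H₁ Q) (hf₂ : IsBumpJet f₂ H₂ Q) (hf₃ : IsBumpJet f₃ H₃ Q)
    (hH₁ : ∀ a b, H₁ a b = a.1 * b.2 + a.2 * b.1) (hH₂ : ∀ a b, H₂ a b = a.2 * b.2)
    (hH₃ : ∀ a b, H₃ a b = a.1 * b.1) {t₀ : ℝ} (ht₀ : t₀ ∈ Icc 0 T) :
    ∀ᶠ η in 𝓝[>] (0 : ℝ), ∀ θ : ℝ → ℝ, ContDiff ℝ ∞ θ → (∀ t, |θ t| ≤ 1) →
      tsupport θ ⊆ Ioo (t₀ - η) (t₀ + η) → ∀ O : Set M, IsOpen O → (∀ t ∈ tsupport θ, φ t p ∈ O) →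
      ∃ F Z, IsClosed F ∧ F ⊆ O ∧ IsPiece g μ k F (27 * Q * C ^ 2 * ε) Z ∧
        ∀ t ∈ Icc 0 T, t ∈ Ioo (t₀ - η) (t₀ + η) → Z (φ t p) = 0 ∧
          φ t p ∈ (extChartAt (𝓡 3) (φ t₀ p)).source ∧ ∀ v i,
          tauC τ (fun t => φ t p) (φ t₀ p) t
            (fderiv ℝ (fieldInChart Z (φ t₀ p)) (extChartAt (𝓡 3) (φ t₀ p) (φ t p)) v) i =
          θ t * ∑ j, (c t - infinitesimalLin τ φ p T t) i j *
            tauC τ (fun t => φ t p) (φ t₀ p) t v j := by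
  obtain ⟨x, hxd⟩ : ∃ x, x = φ t₀ p := ⟨_, rfl⟩
  rw [← hxd]
  have hx : φ t₀ p ∈ (extChartAt (𝓡 3) x).source := hxd ▸ mem_extChartAt_source _
  obtain ⟨e, ζ₁, ζ₂, κ, γ, R, a, hB⟩ := h.exists_flowBox ht₀ hx
  obtain ⟨B, hBC, hBε, hBe⟩ := h.exists_coeff ht₀ hx hB.frame
  have hφ := h.flow.continuous p
  have hk := h.one_le
  have hsrc : ∀ᶠ t in 𝓝 t₀, φ t p ∈ (extChartAt (𝓡 3) x).source :=
    hφ.continuousAt.eventually ((isOpen_extChartAt_source x).mem_nhds hx)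
  have hev : ∀ᶠ t in 𝓝 t₀, (t ∈ Icc 0 T → B 0 0 t + B 1 1 t = 0 ∧ ∀ i j,
        ∑ l, tauC τ (fun t => φ t p) x t (e l.succ) i * B l j t =
          ∑ l, (c t - infinitesimalLin τ φ p T t) i l * tauC τ (fun t => φ t p) x t (e j.succ) l) ∧
      φ t p ∈ (extChartAt (𝓡 3) x).source ∧ γ t = extChartAt (𝓡 3) x (φ t p) ∧
      (t ∈ Icc 0 T → ∀ v, tauC τ (fun t => φ t p) x t v =
        (dwmap e ζ₁ ζ₂ (γ t) v).1 • tauC τ (fun t => φ t p) x t (e 1) +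
        (dwmap e ζ₁ ζ₂ (γ t) v).2 • tauC τ (fun t => φ t p) x t (e 2)) := by
    filter_upwards [eventually_nhdsWithin_iff.1 hBe, hsrc, hB.curve,
      hB.tauC_eq h.flow h.triv] with t h1 h2 h3 h4
    exact ⟨h1, h2, h3.1, h4⟩
  obtain ⟨η₀, hη₀, hηS⟩ := Metric.eventually_nhds_iff_ball.1 hev
  -- The Hamiltonians `xy`, `y²/2`, `x²/2` have the fields `(x, -y)`, `(y, 0)`, `(0, -x)`. With
  -- coefficients `B 0 0`, `B 0 1`, `-B 1 0` they add up to the matrix `B`, as `B 1 1 = -B 0 0`.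
  -- Three pieces of size `9 Q C² ε` give `27 Q C² ε`.
  filter_upwards [Ioo_mem_nhdsGT hη₀,
    hB.exists_isPiece hφ h.vol.1 hk h.eps hQ (hBC 0 0) (hBε 0 0) hf₁,
    hB.exists_isPiece hφ h.vol.1 hk h.eps hQ (hBC 0 1) (hBε 0 1) hf₂,
    hB.exists_isPiece hφ h.vol.1 hk h.eps hQ (b := fun t => -B 1 0 t) (hBC 1 0).neg
      (by rw [abs_neg]; exact hBε 1 0) hf₃] with η hη k₁ k₂ k₃ θ hθ hθ1 hθs O hO hθO
  obtain ⟨F₁, Z₁, hF₁, hFO₁, hZ₁, hd₁⟩ := k₁ θ hθ hθ1 hθs O hO hθO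
  obtain ⟨F₂, Z₂, hF₂, hFO₂, hZ₂, hd₂⟩ := k₂ θ hθ hθ1 hθs O hO hθO
  obtain ⟨F₃, Z₃, hF₃, hFO₃, hZ₃, hd₃⟩ := k₃ θ hθ hθ1 hθs O hO hθO
  have hZ := (hZ₁.add h.vol.1 hk hZ₂).add h.vol.1 hk hZ₃
  refine ⟨F₁ ∪ F₂ ∪ F₃, Z₁ + Z₂ + Z₃, (hF₁.union hF₂).union hF₃,
    union_subset (union_subset hFO₁ hFO₂) hFO₃, ?_, fun t ht hti => ?_⟩
  · convert hZ using 1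
    ring
  obtain ⟨g1, g2, g3, g4⟩ := hηS t (by
    rw [Metric.mem_ball, Real.dist_eq, abs_lt]
    constructor <;> linarith [hti.1, hti.2, hη.2])
  obtain ⟨g1a, g1b⟩ := g1 ht
  have g5 := g4 ht
  refine ⟨?_, g2, fun v i => ?_⟩
  · have h1 := fieldInChart_apply (Z₁ + Z₂ + Z₃) g2
    rw [fieldInChart_add, fieldInChart_add] at h1
    have h2 : toChart x (φ t p) ((Z₁ + Z₂ + Z₃) (φ t p)) = 0 := by
      refine h1.symm.trans ?_
      rw [← g3]
      show fieldInChart Z₁ x (γ t) + fieldInChart Z₂ x (γ t) + fieldInChart Z₃ x (γ t) = 0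
      rw [(hd₁ t hti).1, (hd₂ t hti).1, (hd₃ t hti).1, add_zero, add_zero]
    rw [← fromChart_toChart g2 ((Z₁ + Z₂ + Z₃) (φ t p)), h2, map_zero]
  · have hD : ∀ Z : VField M, IsCkField k Z → DifferentiableAt ℝ (fieldInChart Z x) (γ t) :=
      fun Z hZ => g3 ▸ hZ.differentiableAt hk g2
    obtain ⟨d, hd⟩ : ∃ d, d = dwmap e ζ₁ ζ₂ (γ t) v := ⟨_, rfl⟩
    have h1 : fderiv ℝ (fieldInChart (Z₁ + Z₂ + Z₃) x) (γ t) v =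
        (θ t * (B 0 0 t * d.1 + B 0 1 t * d.2)) • e 1 +
        (θ t * (B 1 0 t * d.1 + B 1 1 t * d.2)) • e 2 := by
      rw [fieldInChart_add, fieldInChart_add,
        fderiv_add ((hD _ hZ₁.field).add (hD _ hZ₂.field)) (hD _ hZ₃.field),
        fderiv_add (hD _ hZ₁.field) (hD _ hZ₂.field), add_apply, add_apply, (hd₁ t hti).2,
        (hd₂ t hti).2, (hd₃ t hti).2, ← hd]
      simp only [hH₁, hH₂, hH₃]
      have : B 1 1 t = - B 0 0 t := by linarith
      rw [this]
      module
    rw [← g3, h1, g5 v, ← hd]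
    obtain ⟨L, hL⟩ : ∃ L, L = tauC τ (fun t => φ t p) x t := ⟨_, rfl⟩
    rw [← hL] at g1b ⊢
    have h00 := g1b i 0
    have h01 := g1b i 1
    simp only [Fin.sum_univ_two] at h00 h01 ⊢
    have e1 : e (Fin.succ (0 : Fin 2)) = e 1 := rfl
    have e2 : e (Fin.succ (1 : Fin 2)) = e 2 := rfl
    rw [e1, e2] at h00 h01
    rw [L.map_add, L.map_smul, L.map_smul]
    simp only [PiLp.add_apply, PiLp.smul_apply, smul_eq_mul]
    linear_combination θ t * d.1 * h00 + θ t * d.2 * h01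

end Franks
-- Partition of time and locally finite sums.
namespace Franks

open Filter Topology

variable {M : Type*} [TopologicalSpace M] [ChartedSpace E3 M] [IsManifold (𝓡 3) ∞ M]

/-- A smooth partition of unity on `[0, T]` of mesh less than `δ`. -/
theorem exists_time_partition {T δ : ℝ} (hT : 0 < T) (hδ : 0 < δ) :
    ∃ (n : ℕ) (l : ℝ) (θ : ℕ → ℝ → ℝ), 0 < l ∧ l < δ ∧ (∀ i, ContDiff ℝ ∞ (θ i)) ∧
      (∀ i t, |θ i t| ≤ 1) ∧ (∀ i, tsupport (θ i) ⊆ Icc ((i - 1) * l) ((i + 1) * l)) ∧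
      (∀ i < n, (i * l : ℝ) ∈ Icc 0 T) ∧ ∀ t ∈ Icc 0 T, ∑ i ∈ Finset.range n, θ i t = 1 := by
  obtain ⟨N, hN⟩ := exists_nat_gt (T / δ)
  have hN0 : (0 : ℝ) < N := (div_pos hT hδ).trans hN
  have hl : 0 < T / N := div_pos hT hN0
  have hlN : (N : ℝ) * (T / N) = T := mul_div_cancel₀ _ hN0.ne'
  obtain ⟨l, hld⟩ : ∃ l, l = T / N := ⟨_, rfl⟩
  rw [← hld] at hl hlN
  let S := Real.smoothTransition
  have hS : ContDiff ℝ ∞ S := Real.smoothTransition.contDiff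
  -- Differences of consecutive translates of a smooth step, so the sum telescopes. The centres `i *
  -- l` run from `0` to `N * l = T`, both included, whence `N + 1` functions.
  refine ⟨N + 1, l, fun i t => S (t / l - i + 1) - S (t / l - i), hl, ?_, fun i => ?_, fun i t => ?_,
    fun i => ?_, fun i hi => ?_, fun t ht => ?_⟩
  · rw [hld, div_lt_iff₀ hN0]
    rwa [div_lt_iff₀ hδ, mul_comm] at hN
  · exact (hS.comp (((contDiff_id.div_const l).sub contDiff_const).add contDiff_const)).sub
      (hS.comp ((contDiff_id.div_const l).sub contDiff_const))
  · have h1 := Real.smoothTransition.nonneg (t / l - i + 1)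
    have h2 := Real.smoothTransition.le_one (t / l - i + 1)
    have h3 := Real.smoothTransition.nonneg (t / l - i)
    have h4 := Real.smoothTransition.le_one (t / l - i)
    show |Real.smoothTransition _ - Real.smoothTransition _| ≤ 1
    rw [abs_le]
    constructor <;> linarith
  · refine closure_minimal (fun t ht => ?_) isClosed_Icc
    by_contra hn
    refine ht ?_
    rw [mem_Icc, not_and_or, not_le, not_le, ← div_lt_iff₀ hl, ← lt_div_iff₀ hl] at hn
    show Real.smoothTransition _ - Real.smoothTransition _ = 0
    rcases hn with hn | hn
    · rw [Real.smoothTransition.zero_of_nonpos (by linarith),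
        Real.smoothTransition.zero_of_nonpos (by linarith), sub_self]
    · rw [Real.smoothTransition.one_of_one_le (by linarith),
        Real.smoothTransition.one_of_one_le (by linarith), sub_self]
  · refine ⟨by positivity, ?_⟩
    rw [← hlN]
    exact mul_le_mul_of_nonneg_right (by exact_mod_cast Nat.lt_succ_iff.1 hi) hl.le
  · have h1 : ∀ i ∈ Finset.range (N + 1), S (t / l - i + 1) - S (t / l - i) =
        S (t / l + 1 - i) - S (t / l + 1 - (i + 1 : ℕ)) := fun i _ => by
      push_cast
      congr 2 <;> ring
    rw [Finset.sum_congr rfl h1, Finset.sum_range_sub' fun i : ℕ => S (t / l + 1 - i)]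
    have h2 : 0 ≤ t / l := div_nonneg ht.1 hl.le
    have h3 : t / l ≤ N := by rw [div_le_iff₀ hl, hlN]; exact ht.2
    show Real.smoothTransition _ - Real.smoothTransition _ = 1
    push_cast
    rw [Real.smoothTransition.one_of_one_le (by linarith),
      Real.smoothTransition.zero_of_nonpos (by linarith), sub_zero]

/-- Disjoint members of a finite family of compact sets have disjoint neighbourhoods. -/
theorem exists_open_separation {α : Type*} [TopologicalSpace α] [T2Space α] (n : ℕ) {A : ℕ → Set α}
    (hA : ∀ i, IsCompact (A i)) : ∃ O : ℕ → Set α, (∀ i, IsOpen (O i) ∧ A i ⊆ O i) ∧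
      ∀ i < n, ∀ j < n, Disjoint (A i) (A j) → Disjoint (O i) (O j) := by
  have h1 : ∀ i j, ∃ V W : Set α, IsOpen V ∧ IsOpen W ∧ A i ⊆ V ∧ A j ⊆ W ∧
      (Disjoint (A i) (A j) → Disjoint V W) := fun i j => by
    by_cases h : Disjoint (A i) (A j)
    · obtain ⟨V, W, hV, hW, hAV, hAW, hd⟩ := SeparatedNhds.of_isCompact_isCompact (hA i) (hA j) h
      exact ⟨V, W, hV, hW, hAV, hAW, fun _ => hd⟩
    · exact ⟨univ, univ, isOpen_univ, isOpen_univ, subset_univ _, subset_univ _, fun h' => (h h').elim⟩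
  choose V W hV hW hAV hAW hd using h1
  -- The pairs `(i, j)` and `(j, i)` are separated by independent choices, so `O i` has to serve as
  -- the first set for one and as the second for the other.
  refine ⟨fun i => ⋂ j ∈ Finset.range n, (V i j ∩ W j i), fun i => ⟨?_, ?_⟩, fun i hi j hj h => ?_⟩
  · exact isOpen_biInter_finset fun j _ => (hV i j).inter (hW j i)
  · exact subset_iInter₂ fun j _ => subset_inter (hAV i j) (hAW j i)
  · refine (hd i j h).mono ?_ ?_
    · exact (iInter₂_subset j (Finset.mem_range.2 hj)).trans inter_subset_left
    · exact (iInter₂_subset i (Finset.mem_range.2 hi)).trans inter_subset_right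

theorem isCkField_zero (k : ℕ∞) : IsCkField k (0 : VField M) := by
  refine isCkField_iff.2 fun x => ?_
  have : fieldInChart (0 : VField M) x = fun _ => (0 : E3) := by
    funext u
    exact map_zero (toChart x ((extChartAt (𝓡 3) x).symm u))
  rw [this]
  exact contDiffOn_const

theorem formInChart_zero {n : ℕ} (x : M) : formInChart (0 : DForm M n) x = 0 := by
  funext u
  ext v
  rfl

theorem extD_zero {n : ℕ} : extD (0 : DForm M n) = 0 := by
  funext q
  exact extD_eq_zero (Eventually.of_forall fun _ => rfl)

theorem contract_zero (μ : DForm M 3) : contract (0 : VField M) μ = 0 := by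
  funext q
  exact map_zero (ContinuousAlternatingMap.curryLeft (E := E3) (μ q))

theorem isPiece_zero (g : RMetric M) (μ : DForm M 3) (k : ℕ∞) {r : ℝ} (hr : 0 ≤ r) :
    IsPiece g μ k ∅ r 0 where
  field := isCkField_zero k
  volumePreserving := by
    unfold IsVolumePreserving
    rw [contract_zero, extD_zero]
  exact := ⟨0, fun x => by rw [formInChart_zero]; exact contDiffOn_const, by
    rw [contract_zero, extD_zero]⟩
  eq_zero _ _ := rfl
  len_le q := (len_zero g).trans_le hr
  nabla_le q V W _ _ := by
    rw [nablaInner_eq_zero (X := (0 : VField M)) (Eventually.of_forall fun _ => rfl), abs_zero]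
    exact hr

/-- The sum of pieces whose supports overlap at most `m` times. -/
theorem IsPiece.sum {g : RMetric M} {μ : DForm M 3} (hμ : IsCkForm ⊤ μ) {k : ℕ∞} (hk : 1 ≤ k)
    {F : ℕ → Set M} (hF : ∀ i, IsClosed (F i)) {r : ℝ} (hr : 0 ≤ r) {Z : ℕ → VField M}
    (hZ : ∀ i, IsPiece g μ k (F i) r (Z i)) {s : Finset ℕ} {m : ℕ}
    (hm : ∀ q, ∃ s' : Finset ℕ, s'.card ≤ m ∧ ∀ i ∈ s, q ∈ F i → i ∈ s') :
    IsPiece g μ k (⋃ i ∈ s, F i) (m * r) (∑ i ∈ s, Z i) := by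
  classical
  have key : ∀ s' ⊆ s, IsPiece g μ k (⋃ i ∈ s', F i) (s'.card * r) (∑ i ∈ s', Z i) := by
    intro s'
    induction s' using Finset.induction_on with
    | empty => exact fun _ => by simpa using isPiece_zero g μ k le_rfl
    | insert i s' hi ih =>
      intro hs
      have h1 := (hZ i).add hμ hk (ih ((Finset.subset_insert _ _).trans hs))
      rw [Finset.sum_insert hi, Finset.card_insert_of_notMem hi, Finset.set_biUnion_insert]
      convert h1 using 1
      push_cast
      ring
  -- The triangle inequality over all of `s` would give the factor `s.card`. But the supports are
  -- closed, so near `q` the sum coincides with a subsum of at most `m` terms, and both the length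
  -- and the covariant derivative depend only on the germ.
  have hloc : ∀ q, ∃ s' ⊆ s, s'.card ≤ m ∧ ∀ᶠ q' in 𝓝 q, (∑ i ∈ s, Z i) q' = (∑ i ∈ s', Z i) q' := by
    intro q
    obtain ⟨s₁, hs₁, hs₁'⟩ := hm q
    refine ⟨s ∩ s₁, Finset.inter_subset_left, (Finset.card_le_card Finset.inter_subset_right).trans hs₁, ?_⟩
    have h1 : ∀ᶠ q' in 𝓝 q, ∀ i ∈ s, i ∉ s₁ → q' ∉ F i :=
      (s.eventually_all).2 fun i hi => by
        by_cases h : i ∈ s₁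
        · exact Eventually.of_forall fun q' h' => (h' h).elim
        · have h2 : ∀ᶠ q' in 𝓝 q, q' ∈ (F i)ᶜ :=
            (hF i).isOpen_compl.mem_nhds fun hq => h (hs₁' i hi hq)
          exact h2.mono fun q' hq' _ => hq'
    filter_upwards [h1] with q' hq'
    rw [Finset.sum_apply, Finset.sum_apply]
    refine (Finset.sum_subset Finset.inter_subset_left fun i hi hn => ?_).symm
    exact (hZ i).eq_zero q' (hq' i hi fun h => hn (Finset.mem_inter.2 ⟨hi, h⟩))
  have h1 := key s subset_rfl
  refine ⟨h1.field, h1.volumePreserving, h1.exact, h1.eq_zero, fun q => ?_, fun q V W hV hW => ?_⟩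
  · obtain ⟨s', hs', hc, he⟩ := hloc q
    rw [he.self_of_nhds]
    exact ((key s' hs').len_le q).trans (mul_le_mul_of_nonneg_right (by exact_mod_cast hc) hr)
  · obtain ⟨s', hs', hc, he⟩ := hloc q
    have h2 : ∑ i ∈ s, Z i = ∑ i ∈ s', Z i + (∑ i ∈ s, Z i - ∑ i ∈ s', Z i) := by abel
    have hd : IsCkField k (∑ i ∈ s, Z i - ∑ i ∈ s', Z i) := by
      rw [← Finset.sum_sdiff_eq_sub hs']
      exact (key _ Finset.sdiff_subset).field
    have h3 : nablaInner g (∑ i ∈ s, Z i - ∑ i ∈ s', Z i) q V W = 0 :=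
      nablaInner_eq_zero (he.mono fun q' hq' => sub_eq_zero.2 hq') V W
    rw [h2, nablaInner_add (key s' hs').field hd hk, h3, add_zero]
    exact ((key s' hs').nabla_le q V W hV hW).trans
      (mul_le_mul_of_nonneg_right (by exact_mod_cast hc) hr)

end Franks
-- Derivative of a field at a zero.
namespace Franks

open Filter Topology

variable {M : Type*} [TopologicalSpace M] [ChartedSpace E3 M] [IsManifold (𝓡 3) ∞ M]

/-- At a zero the derivative of a field does not depend on the chart. -/
theorem fderiv_fieldInChart_chg {k : ℕ∞} {Z : VField M} (hZ : IsCkField k Z) (hk : 1 ≤ k)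
    {x y q : M} (hx : q ∈ (extChartAt (𝓡 3) x).source) (hy : q ∈ (extChartAt (𝓡 3) y).source)
    (h0 : Z q = 0) (v : E3) :
    fderiv ℝ (fieldInChart Z y) (extChartAt (𝓡 3) y q) (tangentCoordChange (𝓡 3) x y q v) =
      tangentCoordChange (𝓡 3) x y q (fderiv ℝ (fieldInChart Z x) (extChartAt (𝓡 3) x q) v) := by
  obtain ⟨u, hu⟩ : ∃ u, u = extChartAt (𝓡 3) x q := ⟨_, rfl⟩
  have hD : HasFDerivAt (chg x y) (tangentCoordChange (𝓡 3) x y q) u := hu ▸ chg_hasFDerivAt hx hy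
  have hcu : chg x y u = extChartAt (𝓡 3) y q := by rw [hu, chg_apply hx]
  obtain ⟨L, hL⟩ : ∃ L : E3 →L[ℝ] E3, L = tangentCoordChange (𝓡 3) x y q := ⟨_, rfl⟩
  rw [← hL] at hD ⊢
  have h0' : HasFDerivAt (fieldInChart Z y) (fderiv ℝ (fieldInChart Z y) (extChartAt (𝓡 3) y q))
      (chg x y u) := by
    rw [hcu]
    exact (hZ.differentiableAt hk hy).hasFDerivAt
  have h1 := h0'.comp u hD
  have h2 : HasFDerivAt (fderiv ℝ (chg x y)) (fderiv ℝ (fderiv ℝ (chg x y)) u) u :=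
    (((hu ▸ chg_contDiffAt hx hy : ContDiffAt ℝ ∞ (chg x y) u).fderiv_right (m := ∞)
      (by simp)).differentiableAt (by simp)).hasFDerivAt
  have hz : fieldInChart Z x u = 0 := by
    rw [hu, fieldInChart_apply Z hx, h0, map_zero]
  have h3 := h2.clm_apply (hu ▸ hZ.differentiableAt hk hx :
    DifferentiableAt ℝ (fieldInChart Z x) u).hasFDerivAt
  -- Differentiating the transformation law of `Z` produces an extra term, the second derivative of
  -- the transition map applied to `Z`, which vanishes at a zero of `Z`.
  have h4 := h1.unique (h3.congr_of_eventuallyEq (hu ▸ fieldInChart_chg_eventually Z hx hy))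
  have h5 := congrArg (fun L : E3 →L[ℝ] E3 => L v) h4
  have h6 : fderiv ℝ (chg x y) u = L := hD.fderiv
  rw [h6] at h5
  rw [← hu]
  refine h5.trans ?_
  show L (fderiv ℝ (fieldInChart Z x) u v) +
    fderiv ℝ (fderiv ℝ (chg x y)) u v (fieldInChart Z x u) = _
  rw [hz, map_zero, add_zero]

/-- The local pieces are described in the chart at the centre of a time interval, their sum in the
chart at the point itself; the relation between `τ` and the derivative passes from one to the other
because both sides are intrinsic at a zero of the field. -/
theorem tauC_fderiv_chg {k : ℕ∞} {Z : VField M} (hZ : IsCkField k Z) (hk : 1 ≤ k)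
    {τ : NormalMap M} {γ : ℝ → M} {t : ℝ}
    {x y : M} (hx : γ t ∈ (extChartAt (𝓡 3) x).source) (hy : γ t ∈ (extChartAt (𝓡 3) y).source)
    (h0 : Z (γ t) = 0) {D : Matrix (Fin 2) (Fin 2) ℝ}
    (h : ∀ v i, tauC τ γ x t (fderiv ℝ (fieldInChart Z x) (extChartAt (𝓡 3) x (γ t)) v) i =
      ∑ j, D i j * tauC τ γ x t v j) (v : E3) (i : Fin 2) :
    tauC τ γ y t (fderiv ℝ (fieldInChart Z y) (extChartAt (𝓡 3) y (γ t)) v) i =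
      ∑ j, D i j * tauC τ γ y t v j := by
  have h1 : ∀ w, tauC τ γ y t (tangentCoordChange (𝓡 3) x y (γ t) w) = tauC τ γ x t w := fun w =>
    congrArg (τ (γ t)) (fromChart_chg hx hy w).symm
  obtain ⟨w, hw⟩ : ∃ w, tangentCoordChange (𝓡 3) x y (γ t) w = v := by
    refine ⟨toChart x (γ t) (fromChart y (γ t) v), ?_⟩
    rw [← toChart_chg hx hy, toChart_fromChart hy]
  rw [← hw, fderiv_fieldInChart_chg hZ hk hx hy h0, h1, h1, h]

end Franks
-- Injectivity of the orbit near its ends, and preservation of the orbit.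
namespace Franks

open Filter Topology

variable {M : Type*} [TopologicalSpace M] [ChartedSpace E3 M] [IsManifold (𝓡 3) ∞ M]

/-- A time window around `[0, T]`, or inside it if the orbit is closed, on which the orbit is
injective and outside of which nothing has to be changed. -/
theorem exists_time_window [T2Space M] {X : VField M} (hX : IsCkField ⊤ X) {φ : ℝ → M → M}
    (hφ : IsFlow X φ) {p : M} {T : ℝ} (hT : 0 < T) (hinj : InjOn (fun t => φ t p) (Ico 0 T))
    {c c' : ℝ → Matrix (Fin 2) (Fin 2) ℝ}
    (hclosed : φ T p = p → ∃ δ > 0, ∀ t ∈ Icc 0 T, t < δ ∨ T - δ < t → c t = c' t)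
    {U : Set M} (hU : IsOpen U) (hΓU : ∀ t ∈ Icc 0 T, φ t p ∈ U) :
    ∃ a b δ : ℝ, 0 < δ ∧ (∀ t ∈ Ioo a b, φ t p ∈ U) ∧
      (∀ t ∈ Ioo a b, ∀ t' ∈ Icc 0 T ∪ Ioo a b, φ t p = φ t' p → t = t') ∧
      ∀ t ∈ Icc 0 T, t < a + δ ∨ b - δ < t → c t = c' t := by
  have h0 : φ 0 p = p := (hφ p).1
  have hadd : ∀ s t, φ (s + t) p = φ s (φ t p) := fun s t => hφ.add hX le_top s t p
  -- For a closed orbit the window cannot exceed the open interval `(0, T)`, and the hypothesis at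
  -- the ends makes up for what it misses.
  by_cases hp : φ T p = p
  · obtain ⟨δ, hδ, hc⟩ := hclosed hp
    refine ⟨0, T, δ, hδ, fun t ht => hΓU t ⟨ht.1.le, ht.2.le⟩, fun t ht t' ht' he => ?_, fun t ht h => ?_⟩
    · have ht'' : t' ∈ Icc 0 T := by
        rcases ht' with h | h
        · exact h
        · exact ⟨h.1.le, h.2.le⟩
      rcases ht''.2.eq_or_lt with h | h
      · subst h
        have := hinj ⟨ht.1.le, ht.2⟩ ⟨le_rfl, hT⟩ (he.trans (hp.trans h0.symm))
        exact (ht.1.ne' this).elim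
      · exact hinj ⟨ht.1.le, ht.2⟩ ⟨ht''.1, h⟩ he
    · exact hc t ht (by rwa [zero_add] at h)
  · have hcont := hφ.continuous p
    have hper : ∀ s ∈ Ioc 0 T, φ s p ≠ p := by
      intro s hs h
      rcases hs.2.eq_or_lt with h' | h'
      · exact hp (h' ▸ h)
      · exact hs.1.ne' (hinj ⟨hs.1.le, h'⟩ ⟨le_rfl, hT⟩ (h.trans h0.symm))
    have e1 : ∀ᶠ t in 𝓝 T, φ t p ≠ p ∧ φ t p ∈ U :=
      (hcont.continuousAt.eventually_ne hp).and
        (hcont.continuousAt.eventually (hU.mem_nhds (hΓU T ⟨hT.le, le_rfl⟩)))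
    have e2 : ∀ᶠ t in 𝓝 (0 : ℝ), φ t p ∈ U :=
      hcont.continuousAt.eventually (hU.mem_nhds (hΓU 0 ⟨le_rfl, hT.le⟩))
    obtain ⟨r, hr, hrS⟩ := Metric.eventually_nhds_iff_ball.1 e1
    obtain ⟨r', hr', hrS'⟩ := Metric.eventually_nhds_iff_ball.1 e2
    have hr1 : ∀ t, T ≤ t → t < T + r → φ t p ≠ p ∧ φ t p ∈ U := fun t h1 h2 =>
      hrS t (by rw [Metric.mem_ball, Real.dist_eq, abs_lt]; constructor <;> linarith)
    have hr2 : ∀ t, t ≤ 0 → -r' < t → φ t p ∈ U := fun t h1 h2 =>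
      hrS' t (by rw [Metric.mem_ball, Real.dist_eq, abs_lt]; constructor <;> linarith)
    -- Two times in the enlarged window differ by less than `T + 2 * η ≤ T + r`, a range in which
    -- the orbit does not return to `p`.
    obtain ⟨η, hη, hη1, hη2⟩ : ∃ η > 0, η ≤ r / 2 ∧ η ≤ r' :=
      ⟨min (r / 2) r', by positivity, min_le_left _ _, min_le_right _ _⟩
    have key : ∀ t t', -η < t → t < t' → t' < T + η → φ t p ≠ φ t' p := by
      intro t t' h1 h2 h3 he
      have h4 : φ (t' - t) p = p := by
        rw [sub_eq_neg_add, hadd, ← he, ← hadd, neg_add_cancel, h0]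
      rcases le_or_gt (t' - t) T with h5 | h5
      · exact hper _ ⟨by linarith, h5⟩ h4
      · exact (hr1 _ h5.le (by linarith)).1 h4
    -- The window exceeds `[0, T]` by `η` on both sides, so the condition near its ends is vacuous.
    refine ⟨-η, T + η, η, hη, fun t ht => ?_, fun t ht t' ht' he => ?_, fun t ht h => ?_⟩
    · rcases le_or_gt t 0 with h | h
      · exact hr2 t h (by linarith [ht.1])
      · rcases le_or_gt t T with h' | h'
        · exact hΓU t ⟨h.le, h'⟩
        · exact (hr1 t h'.le (by linarith [ht.2])).2
    · have ht'' : t' ∈ Ioo (-η) (T + η) := by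
        rcases ht' with h | h
        · exact ⟨by linarith [h.1], by linarith [h.2]⟩
        · exact h
      rcases lt_trichotomy t t' with h | h | h
      · exact (key t t' ht.1 h ht''.2 he).elim
      · exact h
      · exact (key t' t ht''.1 h ht.2 he.symm).elim
    · exfalso
      rcases h with h | h
      · linarith [ht.1]
      · linarith [ht.2]

/-- A perturbation vanishing along an orbit segment does not change the segment. -/
theorem IsFlow.eq_of_eq_zero [T2Space M] {k : ℕ∞} {X Y : VField M} (hX : IsCkField ⊤ X)
    (hY : IsCkField k Y) (hk : 1 ≤ k) {φ ψ : ℝ → M → M} (hφ : IsFlow X φ) (hψ : IsFlow Y ψ) {p : M}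
    {T : ℝ} (hT : 0 < T) (h : ∀ t ∈ Icc 0 T, Y (φ t p) = X (φ t p)) {t : ℝ} (ht : t ∈ Icc 0 T) :
    φ t p = ψ t p := by
  -- Uniqueness of integral curves is applied on an open interval symmetric about `T / 2`.
  -- Continuity adds the endpoints, and running back by `r` identifies the starting point as `p`.
  obtain ⟨r, hr, hrT⟩ : ∃ r > 0, T = r + r := ⟨T / 2, by positivity, by ring⟩
  have hadd : ∀ s t, φ (s + t) p = φ s (φ t p) := fun s t => hφ.add hX le_top s t p
  have h1 : ∀ s ∈ Ioo (-r) r, ψ s (φ r p) = φ s (φ r p) := fun s hs =>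
    IsFlow.eq_local hY hk hψ hr (γ := fun s => φ s (φ r p)) (hφ (φ r p)).1 (fun s hs => by
      have h2 := ((hφ (φ r p)).2 s).hasMFDerivWithinAt (s := Ioo (-r) r)
      beta_reduce at h2
      have h3 : Y (φ s (φ r p)) = X (φ s (φ r p)) := by
        have := h (s + r) ⟨by linarith [hs.1], by linarith [hs.2]⟩
        rwa [hadd] at this
      rw [← h3] at h2
      exact h2) hs
  have h2 : ∀ s ∈ Icc (-r) r, ψ s (φ r p) = φ s (φ r p) := fun s hs => by
    have h3 : IsClosed {s | ψ s (φ r p) = φ s (φ r p)} :=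
      isClosed_eq (hψ.continuous _) (hφ.continuous _)
    have h4 := closure_minimal h1 h3
    rw [closure_Ioo (by linarith)] at h4
    exact h4 hs
  have h3 : ψ (-r) (φ r p) = p := by
    rw [h2 (-r) ⟨le_rfl, by linarith⟩, ← hadd, neg_add_cancel, (hφ p).1]
  have h4 : t = (t - r) + r := by ring
  rw [h4, hadd, ← h2 (t - r) ⟨by linarith [ht.1], by linarith [ht.2]⟩]
  conv_rhs => rw [← h3]
  rw [← hψ.add hY hk]
  congr 1
  ring

end Franks
-- Assembling the perturbation.
namespace Franks

open Filter Topology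

variable {M : Type*} [TopologicalSpace M] [ChartedSpace E3 M] [IsManifold (𝓡 3) ∞ M]

theorem fderiv_fieldInChart_sum {k : ℕ∞} (hk : 1 ≤ k) {Z : ℕ → VField M} {x q : M}
    (hx : q ∈ (extChartAt (𝓡 3) x).source) {L : E3 →L[ℝ] E2} {a : ℕ → ℝ} {S : E3 → Fin 2 → ℝ}
    {s : Finset ℕ} (hZ : ∀ i ∈ s, IsCkField k (Z i))
    (h : ∀ i ∈ s, ∀ v j, L (fderiv ℝ (fieldInChart (Z i) x) (extChartAt (𝓡 3) x q) v) j = a i * S v j) :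
    IsCkField k (∑ i ∈ s, Z i) ∧ ∀ v j,
      L (fderiv ℝ (fieldInChart (∑ i ∈ s, Z i) x) (extChartAt (𝓡 3) x q) v) j =
        (∑ i ∈ s, a i) * S v j := by
  classical
  induction s using Finset.induction_on with
  | empty =>
    refine ⟨by simpa using isCkField_zero k, fun v j => ?_⟩
    have h1 : fieldInChart (0 : VField M) x = fun _ => (0 : E3) := by
      funext u
      exact map_zero (toChart x ((extChartAt (𝓡 3) x).symm u))
    rw [Finset.sum_empty, Finset.sum_empty, zero_mul, h1, fderiv_fun_const]
    show L 0 j = 0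
    rw [map_zero]
    rfl
  | insert i s hi ih =>
    obtain ⟨h1, h2⟩ := ih (fun j hj => hZ j (Finset.mem_insert_of_mem hj))
      fun j hj => h j (Finset.mem_insert_of_mem hj)
    have h3 := hZ i (Finset.mem_insert_self i s)
    rw [Finset.sum_insert hi, Finset.sum_insert hi]
    refine ⟨h3.add h1, fun v j => ?_⟩
    rw [fieldInChart_add, fderiv_add (h3.differentiableAt hk hx) (h1.differentiableAt hk hx),
      add_apply, map_add, PiLp.add_apply, h2, h i (Finset.mem_insert_self i s), add_mul]

/-- The perturbation of the field. -/
theorem IsFranksData.exists_perturbation [T2Space M] [CompactSpace M] {g : RMetric M}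
    {μ : DForm M 3} {X : VField M} {φ : ℝ → M → M} {p : M} {T : ℝ} {τ : NormalMap M} {C ε : ℝ}
    {k : ℕ∞} {c : ℝ → Matrix (Fin 2) (Fin 2) ℝ} (h : IsFranksData g μ X φ p T τ C ε k c)
    {f₁ f₂ f₃ : ℝ × ℝ → ℝ} {H₁ H₂ H₃ : ℝ × ℝ →L[ℝ] ℝ × ℝ →L[ℝ] ℝ} {Q : ℝ} (hQ : 0 < Q)
    (hf₁ : IsBumpJet f₁ H₁ Q) (hf₂ : IsBumpJet f₂ H₂ Q) (hf₃ : IsBumpJet f₃ H₃ Q)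
    (hH₁ : ∀ a b, H₁ a b = a.1 * b.2 + a.2 * b.1) (hH₂ : ∀ a b, H₂ a b = a.2 * b.2)
    (hH₃ : ∀ a b, H₃ a b = a.1 * b.1) (hinj : InjOn (fun t => φ t p) (Ico 0 T))
    (hclosed : φ T p = p → ∃ δ > 0, ∀ t ∈ Icc 0 T, t < δ ∨ T - δ < t →
      c t = infinitesimalLin τ φ p T t)
    {U : Set M} (hU : IsOpen U) (hΓU : ∀ t ∈ Icc 0 T, φ t p ∈ U) :
    ∃ F Z, F ⊆ U ∧ IsPiece g μ k F (81 * Q * C ^ 2 * ε) Z ∧ ∀ t ∈ Icc 0 T, Z (φ t p) = 0 ∧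
      ∀ v i, tauC τ (fun t => φ t p) (φ t p) t
        (fderiv ℝ (fieldInChart Z (φ t p)) (extChartAt (𝓡 3) (φ t p) (φ t p)) v) i =
      ∑ j, (c t - infinitesimalLin τ φ p T t) i j * tauC τ (fun t => φ t p) (φ t p) t v j := by
  have hφ := h.flow.continuous p
  have hk := h.one_le
  obtain ⟨r, hrd⟩ : ∃ r, r = 27 * Q * C ^ 2 * ε := ⟨_, rfl⟩
  have hr : 0 ≤ r := by
    have := h.eps
    rw [hrd]; positivity
  obtain ⟨a, b, δ₁, hδ₁, hDU, hDinj, hDc⟩ := exists_time_window h.field h.flow h.pos hinj hclosed hU hΓU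
  have hloc := fun t₀ (ht₀ : t₀ ∈ Icc 0 T) => ((h.exists_localPiece hQ hf₁ hf₂ hf₃ hH₁ hH₂ hH₃
    ht₀).and self_mem_nhdsWithin).exists
  rw [← hrd] at hloc
  choose! η hη hη0 using hloc
  obtain ⟨δ₂, hδ₂, hleb⟩ := lebesgue_number_lemma_of_metric (isCompact_Icc (a := (0 : ℝ)) (b := T))
    (c := fun t : Icc (0 : ℝ) T => Ioo (t - η t) (t + η t)) (fun t => isOpen_Ioo) fun t ht => by
      refine mem_iUnion.2 ⟨⟨t, ht⟩, ?_⟩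
      have : 0 < η t := hη0 t ht
      constructor <;> dsimp only <;> linarith
  -- A mesh below the Lebesgue number puts each interval `J i` with `i < n` inside one admissible
  -- interval. A mesh below `δ₁ / 2` makes `J i`, of length `2 * l`, stay within `δ₁` of the end of
  -- the window whenever it sticks out.
  obtain ⟨n, l, θ, hl, hlδ, hθ, hθ1, hθs, hθm, hθsum⟩ := exists_time_partition h.pos
    (lt_min hδ₂ (half_pos hδ₁))
  have hlδ₂ : l < δ₂ := hlδ.trans_le (min_le_left _ _)
  have hlδ₁ : l < δ₁ / 2 := hlδ.trans_le (min_le_right _ _)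
  obtain ⟨J, hJ⟩ : ∃ J : ℕ → Set ℝ, J = fun i : ℕ => Icc (((i : ℝ) - 1) * l) ((i + 1) * l) := ⟨_, rfl⟩
  -- The arcs of the orbit over the intervals `J i`. Those leaving the window are replaced by the
  -- empty set, since they carry no perturbation.
  obtain ⟨A, hA⟩ : ∃ A : ℕ → Set M, A = fun i => {q | J i ⊆ Ioo a b ∧ ∃ t ∈ J i, φ t p = q} := ⟨_, rfl⟩
  have hAc : ∀ i, IsCompact (A i) := fun i => by
    by_cases hi : J i ⊆ Ioo a b
    · have : A i = (fun t => φ t p) '' J i := by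
        rw [hA]; ext q; simp [hi]
      rw [this, hJ]
      exact isCompact_Icc.image hφ
    · have : A i = ∅ := by
        rw [hA]; ext q; simp [hi]
      rw [this]
      exact isCompact_empty
  obtain ⟨O, hO, hOd⟩ := exists_open_separation n hAc
  have pieces : ∀ i, ∃ F Z, IsClosed F ∧ F ⊆ U ∧ F ⊆ O i ∧ IsPiece g μ k F r Z ∧ (i < n → ∀ t ∈ Icc 0 T, Z (φ t p) = 0 ∧ ∀ v j,
        tauC τ (fun t => φ t p) (φ t p) t
          (fderiv ℝ (fieldInChart Z (φ t p)) (extChartAt (𝓡 3) (φ t p) (φ t p)) v) j =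
        θ i t * ∑ j', (c t - infinitesimalLin τ φ p T t) j j' *
          tauC τ (fun t => φ t p) (φ t p) t v j') := by
    intro i
    have triv : ∀ (Z : VField M) (t : ℝ), (∀ᶠ q in 𝓝 (φ t p), Z q = 0) → ∀ v j,
        tauC τ (fun t => φ t p) (φ t p) t
          (fderiv ℝ (fieldInChart Z (φ t p)) (extChartAt (𝓡 3) (φ t p) (φ t p)) v) j = 0 := by
      intro Z t hZ v j
      have h1 : fieldInChart Z (φ t p) =ᶠ[𝓝 (extChartAt (𝓡 3) (φ t p) (φ t p))] fun _ => (0 : E3) := by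
        filter_upwards [eventually_chart_symm (mem_extChartAt_source (I := 𝓡 3) (φ t p)) hZ] with u hu
        show toChart _ _ (Z _) = 0
        rw [hu, map_zero]
      rw [h1.fderiv_eq, fderiv_fun_const]
      show tauC τ (fun t => φ t p) (φ t p) t 0 j = 0
      rw [map_zero]
      rfl
    have hθ0 : ∀ t ∉ J i, θ i t = 0 := fun t ht => by
      rw [hJ] at ht
      exact image_eq_zero_of_notMem_tsupport fun h' => ht (hθs i h')
    by_cases hi : i < n ∧ J i ⊆ Ioo a b
    · obtain ⟨⟨m, hm⟩, hball⟩ := hleb (i * l) (hθm i hi.1)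
      have hJm : J i ⊆ Ioo (m - η m) (m + η m) := fun t ht => hball (by
        rw [hJ] at ht
        rw [Metric.mem_ball, Real.dist_eq, abs_lt]
        constructor <;> linarith [ht.1, ht.2])
      -- The piece must avoid the part of the orbit outside its own time interval, where
      -- `IsFranksData.exists_localPiece` gives no information. By injectivity the arc over the
      -- support of `θ i` is disjoint from this compact set.
      have hK : IsCompact ((fun t => φ t p) '' (Icc 0 T \ Ioo (m - η m) (m + η m))) :=
        (isCompact_Icc.diff isOpen_Ioo).image hφ
      have hts : tsupport (θ i) ⊆ J i := by rw [hJ]; exact hθs i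
      obtain ⟨F, Z, hF, hFO, hZ, hZe⟩ := hη m hm (θ i) (hθ i) (hθ1 i) (hts.trans hJm)
        (O i ∩ U ∩ ((fun t => φ t p) '' (Icc 0 T \ Ioo (m - η m) (m + η m)))ᶜ)
        (((hO i).1.inter hU).inter hK.isClosed.isOpen_compl) (fun t ht => by
          refine ⟨⟨(hO i).2 ?_, hDU t (hi.2 (hts ht))⟩, ?_⟩
          · rw [hA]
            exact ⟨hi.2, t, hts ht, rfl⟩
          · rintro ⟨t', ht', he⟩
            have h1 := hDinj t (hi.2 (hts ht)) t' (Or.inl ht'.1) he.symm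
            exact ht'.2 (h1 ▸ hJm (hts ht)))
      refine ⟨F, Z, hF, fun q hq => (hFO hq).1.2, fun q hq => (hFO hq).1.1, hZ, fun _ t ht => ?_⟩
      by_cases htm : t ∈ Ioo (m - η m) (m + η m)
      · obtain ⟨h1, h2, h3⟩ := hZe t ht htm
        refine ⟨h1, fun v j => ?_⟩
        have h4 := tauC_fderiv_chg hZ.field hk (τ := τ) (γ := fun t => φ t p) (t := t) h2
          (mem_extChartAt_source (φ t p)) h1 (D := θ i t • (c t - infinitesimalLin τ φ p T t))
          (fun v j => by
            rw [h3, Finset.mul_sum]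
            exact Finset.sum_congr rfl fun j' _ => by
              rw [Matrix.smul_apply, smul_eq_mul, mul_assoc]) v j
        rw [h4, Finset.mul_sum]
        exact Finset.sum_congr rfl fun j' _ => by rw [Matrix.smul_apply, smul_eq_mul, mul_assoc]
      · have h1 : φ t p ∉ F := fun hq => (hFO hq).2 ⟨t, ⟨ht, htm⟩, rfl⟩
        refine ⟨hZ.eq_zero _ h1, fun v j => ?_⟩
        rw [triv Z t (by
          filter_upwards [hF.isOpen_compl.mem_nhds h1] with q hq
          exact hZ.eq_zero q hq), hθ0 t fun h' => htm (hJm h'), zero_mul]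
    -- If `J i` leaves the window, then `c = 𝔞` at the times of `[0, T]` in `J i`, and the zero
    -- field already has the required derivative.
    · refine ⟨∅, 0, isClosed_empty, empty_subset _, empty_subset _,
        isPiece_zero g μ k hr, fun hin t ht => ⟨rfl, fun v j => ?_⟩⟩
      rw [triv 0 t (Eventually.of_forall fun _ => rfl)]
      by_cases htJ : t ∈ J i
      · have h1 : ¬ J i ⊆ Ioo a b := fun h' => hi ⟨hin, h'⟩
        obtain ⟨s, hs, hs'⟩ := not_subset.1 h1
        rw [mem_Ioo, not_and_or, not_lt, not_lt] at hs'
        rw [hJ] at hs htJ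
        have h2 := hDc t ht (by
          rcases hs' with h' | h'
          · left; linarith [hs.1, htJ.2]
          · right; linarith [hs.2, htJ.1])
        rw [h2, sub_self]
        simp
      · rw [hθ0 t htJ, zero_mul]
  choose F Z hF hFU hFO hZ hZe using pieces
  -- If two supports meet, so do the separating neighbourhoods, hence the arcs; by injectivity the
  -- arcs share a time, so the indices differ by at most `2`. Counting from the least index, at most
  -- three supports contain a given point, which turns `27` into `81`.
  have hover : ∀ q, ∀ i < n, ∀ j < n, q ∈ F i → q ∈ F j → i ≤ j + 2 := by
    intro q i hi j hj hqi hqj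
    have h1 : ¬ Disjoint (A i) (A j) := fun hd =>
      disjoint_left.1 (hOd i hi j hj hd) (hFO i hqi) (hFO j hqj)
    obtain ⟨q', hq1, hq2⟩ := not_disjoint_iff.1 h1
    rw [hA] at hq1 hq2
    obtain ⟨hJi, t, ht, rfl⟩ := hq1
    obtain ⟨hJj, t', ht', hte⟩ := hq2
    have h2 := hDinj t (hJi ht) t' (Or.inr (hJj ht')) hte.symm
    subst h2
    rw [hJ] at ht ht'
    have h3 : ((i : ℝ) - 1) * l ≤ (j + 1) * l := ht.1.trans ht'.2
    have h4 := le_of_mul_le_mul_right h3 hl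
    have h5 : (i : ℝ) ≤ (j + 2 : ℕ) := by push_cast; linarith
    exact_mod_cast h5
  have hP := IsPiece.sum h.vol.1 hk hF hr hZ (s := Finset.range n) (m := 3) fun q => by
    classical
    by_cases hq : ∃ i, i < n ∧ q ∈ F i
    · refine ⟨Finset.Icc (Nat.find hq) (Nat.find hq + 2), by simp; omega, fun i hi hqi => ?_⟩
      rw [Finset.mem_range] at hi
      exact Finset.mem_Icc.2 ⟨Nat.find_min' hq ⟨hi, hqi⟩,
        hover q i hi _ (Nat.find_spec hq).1 hqi (Nat.find_spec hq).2⟩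
    · exact ⟨∅, by simp, fun i hi hqi => (hq ⟨i, Finset.mem_range.1 hi, hqi⟩).elim⟩
  refine ⟨⋃ i ∈ Finset.range n, F i, ∑ i ∈ Finset.range n, Z i, iUnion₂_subset fun i _ => hFU i, ?_, fun t ht => ⟨?_, fun v i => ?_⟩⟩
  · convert hP using 1
    rw [hrd]; push_cast; ring
  · rw [Finset.sum_apply]
    exact Finset.sum_eq_zero fun i hi => (hZe i (Finset.mem_range.1 hi) t ht).1
  · have h1 := (fderiv_fieldInChart_sum hk (mem_extChartAt_source (I := 𝓡 3) (φ t p))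
      (fun i _ => (hZ i).field)
      (fun i hi => (hZe i (Finset.mem_range.1 hi) t ht).2)).2 v i
    rw [hθsum t ht, one_mul] at h1
    exact h1

end Franks
-- Universal constants and the theorem.
namespace Franks

open Filter Topology

variable {M : Type*} [TopologicalSpace M] [ChartedSpace E3 M] [IsManifold (𝓡 3) ∞ M]

set_option maxSynthPendingDepth 5 in
theorem IsBumpJet.mono {h : ℝ × ℝ → ℝ} {H : ℝ × ℝ →L[ℝ] ℝ × ℝ →L[ℝ] ℝ} {Q Q' : ℝ}
    (hh : IsBumpJet h H Q) (hQ : Q ≤ Q') : IsBumpJet h H Q' :=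
  ⟨hh.smooth, hh.supp, fun y => (hh.d1 y).trans hQ, fun y => (hh.d2 y).trans hQ, hh.crit, hh.hess⟩

/-- The Hessians of `xy`, `y²/2` and `x²/2`, whose linear Hamiltonian fields span `sl(2)`. The bound
`Q` is fixed before the manifold is given, which makes the final constant universal. -/
theorem exists_quadratic_jets : ∃ (f₁ f₂ f₃ : ℝ × ℝ → ℝ) (H₁ H₂ H₃ : ℝ × ℝ →L[ℝ] ℝ × ℝ →L[ℝ] ℝ)
    (Q : ℝ), 0 < Q ∧ IsBumpJet f₁ H₁ Q ∧ IsBumpJet f₂ H₂ Q ∧ IsBumpJet f₃ H₃ Q ∧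
      (∀ a b, H₁ a b = a.1 * b.2 + a.2 * b.1) ∧ (∀ a b, H₂ a b = a.2 * b.2) ∧
      ∀ a b, H₃ a b = a.1 * b.1 := by
  let x : ℝ × ℝ →L[ℝ] ℝ := ContinuousLinearMap.fst ℝ ℝ ℝ
  let y : ℝ × ℝ →L[ℝ] ℝ := ContinuousLinearMap.snd ℝ ℝ ℝ
  obtain ⟨f₁, Q₁, h₁⟩ := exists_isBumpJet (x.smulRight y + y.smulRight x) fun a b => by
    show a.1 * b.2 + a.2 * b.1 = b.1 * a.2 + b.2 * a.1
    ring
  obtain ⟨f₂, Q₂, h₂⟩ := exists_isBumpJet (y.smulRight y) fun a b => mul_comm a.2 b.2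
  obtain ⟨f₃, Q₃, h₃⟩ := exists_isBumpJet (x.smulRight x) fun a b => mul_comm a.1 b.1
  refine ⟨f₁, f₂, f₃, _, _, _, |Q₁| + |Q₂| + |Q₃| + 1, by positivity, h₁.mono ?_, h₂.mono ?_,
    h₃.mono ?_, fun a b => rfl, fun a b => rfl, fun a b => rfl⟩
  all_goals linarith [le_abs_self Q₁, le_abs_self Q₂, le_abs_self Q₃, abs_nonneg Q₁, abs_nonneg Q₂,
    abs_nonneg Q₃]

theorem len_neg (g : RMetric M) {q : M} (V : TangentSpace (𝓡 3) q) : len g (-V) = len g V := by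
  unfold len
  rw [map_neg, map_neg, neg_apply, neg_neg]

/-- The factor `2` adds the supremum of the field and that of its covariant derivative, each at most
`r`. -/
theorem IsPiece.c1Norm_le {g : RMetric M} {μ : DForm M 3} {k : ℕ∞} {F : Set M} {r : ℝ}
    {X Z : VField M} (hr : 0 ≤ r) (hZ : IsPiece g μ k F r Z) :
    c1Norm g (X - (X + Z)) ≤ ENNReal.ofReal (2 * r) := by
  have h1 : X - (X + Z) = -Z := by abel
  rw [h1, two_mul, ENNReal.ofReal_add hr hr]
  refine add_le_add (iSup_le fun q => ENNReal.ofReal_le_ofReal ?_)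
    (iSup_le fun q => iSup_le fun V => iSup_le fun W => iSup_le fun hV => iSup_le fun hW =>
      ENNReal.ofReal_le_ofReal ?_)
  · exact (len_neg g (Z q)).trans_le (hZ.len_le q)
  · rw [nablaInner_neg, abs_neg]
    exact hZ.nabla_le q V W hV hW

end Franks

theorem mainTheorem6 :
    ∃ K : ℝ → ℝ → ℝ,
    ∀ (M : Type*) [TopologicalSpace M] [ChartedSpace Franks.E3 M] [IsManifold (𝓡 3) ∞ M]
      [T2Space M] [CompactSpace M]
      (g : Franks.RMetric M) (μ : Franks.DForm M 3) (_hμ : Franks.IsMetricVolumeForm g μ)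
      (X : Franks.VField M) (_hX : Franks.IsCkField ⊤ X) (_hXμ : Franks.IsVolumePreserving μ X)
      (φ : ℝ → M → M) (_hφ : Franks.IsFlow X φ)
      (p : M) (T : ℝ) (_hT : 0 < T) (_hinj : InjOn (fun t => φ t p) (Ico 0 T))
      (τ : Franks.NormalMap M)
      (_hτ : Franks.IsNormalTrivialization X (fun t => φ t p) T τ)
      (_hSL : ∀ t ∈ Icc 0 T, (Franks.transverseLin τ φ p t).det = 1)
      (C : ℝ) (_hC : Franks.IsTrivializationConstant g X (fun t => φ t p) T τ C)
      (ε : ℝ) (_hε : 0 < ε) (k : ℕ∞) (_hk : 1 ≤ k)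
      (c : ℝ → Matrix (Fin 2) (Fin 2) ℝ) (_hc : ContDiffOn ℝ k c (Icc 0 T))
      (_hsl : ∀ t ∈ Icc 0 T, (c t).trace = 0)
      (_hclose : ∀ t ∈ Icc 0 T, ‖Franks.infinitesimalLin τ φ p T t - c t‖ < ε)
      (_hclosed : φ T p = p → ∃ δ > 0, ∀ t ∈ Icc 0 T, t < δ ∨ T - δ < t →
        c t = Franks.infinitesimalLin τ φ p T t)
      (U : Set M) (_hU : IsOpen U) (_hΓU : ∀ t ∈ Icc 0 T, φ t p ∈ U),
    ∃ (Y : Franks.VField M) (ψ : ℝ → M → M),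
      Franks.IsCkField k Y ∧
      Franks.IsVolumePreserving μ Y ∧
      (Franks.IsExactField ⊤ μ X → Franks.IsExactField k μ Y) ∧
      Franks.IsFlow Y ψ ∧
      (∀ q, q ∉ U → Y q = X q) ∧
      Franks.c1Norm g (X - Y) ≤ ENNReal.ofReal (K (Franks.c0Norm g X).toReal C * ε) ∧
      (∀ t ∈ Icc 0 T, φ t p = ψ t p) ∧
      (∀ t ∈ Icc 0 T,
        MDifferentiableAt (𝓡 3) (𝓡 3) (ψ t) p ∧
        DifferentiableWithinAt ℝ (Franks.transverseLin τ ψ p) (Icc 0 T) t ∧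
        (Franks.transverseLin τ ψ p t).det = 1 ∧
        Franks.infinitesimalLin τ ψ p T t = c t) := by
  obtain ⟨f₁, f₂, f₃, H₁, H₂, H₃, Q, hQ, hf₁, hf₂, hf₃, hH₁, hH₂, hH₃⟩ :=
    Franks.exists_quadratic_jets
  -- `162 = 2 * 3 * 3 * 9`: the two parts of the `C¹` norm, the overlap of the supports, the three
  -- generators of `sl(2)`, and the bound `9 Q C² ε` for one piece.
  refine ⟨fun _ C => 162 * Q * C ^ 2, ?_⟩
  intro M _ _ _ _ _ g μ hμ X hX hXμ φ hφ p T hT hinj τ hτ hSL C hC ε hε k hk c hc hsl hclose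
    hclosed U hU hΓU
  have h : Franks.IsFranksData g μ X φ p T τ C ε k c :=
    ⟨hμ, hX, hφ, hT, hτ, hSL, hC, hε, hk, hc, hsl, hclose⟩
  obtain ⟨F, Z, hFU, hZ, hZe⟩ := h.exists_perturbation hQ hf₁ hf₂ hf₃ hH₁ hH₂ hH₃ hinj hclosed hU hΓU
  have hXk : Franks.IsCkField k X := hX.of_le le_top
  have hY := hXk.add hZ.field
  obtain ⟨ψ, hψ⟩ := Franks.exists_isFlow hY hk
  have hφψ : ∀ t ∈ Icc 0 T, φ t p = ψ t p := fun t ht =>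
    Franks.IsFlow.eq_of_eq_zero hX hY hk hφ hψ hT (fun t ht => by
      show X (φ t p) + Z (φ t p) = X (φ t p)
      rw [(hZe t ht).1, add_zero]) ht
  refine ⟨X + Z, ψ, hY, hXμ.add hμ.1 hk hXk hZ.field hZ.volumePreserving, fun hE => ?_, hψ,
    fun q hq => ?_, ?_, hφψ, fun t ht => ?_⟩
  · obtain ⟨α, hα, hαX⟩ := hE
    exact Franks.IsExactField.add hk ⟨α, hα.of_le le_top, hαX⟩ hZ.exact
  · show X q + Z q = X q
    rw [hZ.eq_zero q fun h => hq (hFU h), add_zero]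
  · refine (hZ.c1Norm_le (X := X) (by positivity)).trans (ENNReal.ofReal_le_ofReal (le_of_eq ?_))
    ring
  · exact ⟨Franks.IsFlow.mdifferentiableAt hY hk hψ t p,
      Franks.transverseLin_perturb hXk hZ.field hk hφ hψ hY hT hτ hSL hφψ hsl
        (fun t ht => ⟨φ t p, mem_extChartAt_source _, (hZe t ht).2⟩) ht⟩
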